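/- Let $\mathbb F$ be a field of characteristic $0$ and let $q_1,\dots,q_r\ge 1$ be the parts of a partition of $N$, with largest part $p_1$. The right-aligned pyramid has rows of lengths $q_1,\dots,q_r$, all ending in the same rightmost column; its $N$ boxes label a basis of $V=\mathbb F^N$. Let $F\in\operatorname{End}V$ be the shift by one box to the left, $F^t$ the shift by one box to the right, $V_-=\ker F$ (spanned by the leftmost boxes of the rows) and $V_+=\ker F^t$ (spanned by the rightmost boxes). For a subspace $S$ spanned by boxes, $\mathbb 1_S$ denotes the projection to $S$ along the other boxes. Let $\mathfrak g=\operatorname{End}V$ with $(A|B)=\operatorname{tr}(AB)$, and let $f\in\mathfrak g$ be $F$. Elements of $\mathfrak g\subset U(\mathfrak g)$ are written in lower case, and the same elements of $\operatorname{End}V$ in upper case. Let $\mathfrak g=\bigoplus_{j\in\mathbb Z}\mathfrak g[j]$ be the good grading $\Gamma$ in which the matrix unit sending box $b$ to box $a$ has degree (column of $a$) $-$ (column of $b$), columns being numbered from left to right, and let $\mathfrak g^f$ be the centralizer of $f$. Put $\mathcal I=U(\mathfrak g)\operatorname{Span}\{b-(f|b)\}_{b\in\mathfrak g[\ge1]}$,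 $W(\mathfrak g,f)=(U(\mathfrak g)/\mathcal I)^{\operatorname{ad}\mathfrak g[\ge1]}$, and let $\bar1$ be the class of $1$. The Kazhdan filtration is $F_\Delta U(\mathfrak g)=\sum_{s-j_1-\dots-j_s\le\Delta}\mathfrak g[j_1]\cdots\mathfrak g[j_s]$; its associated graded algebra is $S(\mathfrak g)$, it induces a filtration on $U(\mathfrak g)/\mathcal I$ with associated graded $S(\mathfrak g)/S(\mathfrak g)\operatorname{Span}\{b-(f|b)\}_{b\in\mathfrak g[\ge1]}$, and $F_\Delta W(\mathfrak g,f)$ is the intersection of $W(\mathfrak g,f)$ with the image of $F_\Delta U(\mathfrak g)$. Let $$U^\perp=\mathbb 1_{F^tV}\operatorname{End}V\oplus\mathbb 1_{V_-}(\operatorname{End}V)[>0]\subset\mathfrak g .$$ When $\mathfrak g=\mathfrak g^f\oplus U^\perp$, let $\pi^f:\mathfrak g\to\mathfrak g^f$ be the projection with kernel $U^\perp$ and let $\eta^f:S(\mathfrak g)\to S(\mathfrak g^f)$ be the algebra homomorphism with $\eta^f(a)=\pi^f(a)+(f|a)$ for $a\in\mathfrak g$; it induces a map on the associated graded of $U(\mathfrak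 g)/\mathcal I$. A Premet map is an injective linear map $w:\mathfrak g^f\to W(\mathfrak g,f)$ such that, for all $\Delta$ and all $a\in\mathfrak g^f\cap\mathfrak g[1-\Delta]$, (i) $w(a)\in F_\Delta W(\mathfrak g,f)$ and (ii) $\eta^f(\operatorname{gr}_\Delta w(a))=a$. Let $$Z(z)=z\mathbb 1_{V_+}(1+zF^t)^{-1}\mathbb 1_{V_-}+\sum_i\sum_{\ell\ge0}(-z)^\ell\phi_\ell(u_i)\,U^i,\qquad \phi_\ell(A)=\sum_{k=0}^{\ell}F^k(F^t)^\ell A(F^t)^\ell F^{\ell-k},$$ where $\{u_i\}$ is the basis of matrix units of $\operatorname{Hom}(V_+,V_-)$ and $\{U^i\}$ is the dual basis of $\operatorname{Hom}(V_-,V_+)$ for the trace form. Its coefficients lie in $(\mathbb F\oplus\mathfrak g^f)\otimes\operatorname{Hom}(V_-,V_+)$. Let $W(z)=\widetilde W(z)\bar1$, where $\widetilde W(z)\in U(\mathfrak g)[z]\otimes\operatorname{Hom}(V_-,V_+)$ is defined by recursion on the number $p_1$ of columns. Let $\{u_i\}$ now be the basis of all matrix units of $\mathfrak g$ and $\{u^i\}$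 the dual basis, and set $E=\sum_iu_iU^i$, $E_j=\sum_{u_i\in\mathfrak g[j]}u_iU^i$ and $D=-\sum_{u_i\in\mathfrak g[\ge1]}U^iU_i$. If $p_1=1$, then $\widetilde W(z)=z\mathbb 1_V+E$. If $p_1>1$, let $\widetilde W'(z)$ be the matrix of the pyramid obtained by removing the leftmost column, let $V_-^d$ be the span of the boxes in the leftmost column, $r_1=\dim V_-^d$, and $V_-^u$ the span of the leftmost boxes of the other rows; then $$\begin{aligned}\widetilde W(z)={}&\widetilde W'(z)\mathbb 1_{V_-^u}-\tfrac1{r_1}\big[\widetilde W'(z),\mathbb 1_{F^tV_-^d}E_{-1}\big]^1-\widetilde W'(z)F^t(z\mathbb 1_V+E_0+D)\mathbb 1_{V_-^d}\\&+\operatorname{Res}_x x^{-1}\,\widetilde W'(z)\mathbb 1_{V_-^u}(1+x^{-1}F)^{-1}\widetilde W'(x)F^t\mathbb 1_{V_-^d},\end{aligned}$$ where $[aA,bB]^1=[a,b]AB$ for $a,b\in U(\mathfrak g)[z]$ and $A,B\in\operatorname{End}V$, and $(1+x^{-1}F)^{-1}$ is expanded as a geometric series. Then $\mathfrak g=\mathfrak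 g^f\oplus U^\perp$, and there exists a Premet map $w:\mathfrak g^f\to W(\mathfrak g,f)$ such that $$w(Z(z))=W(z),$$ where $w$ is applied to the coefficients of $Z(z)$ and is extended to $\mathbb F\oplus\mathfrak g^f$ by $w(1)=\bar1$. -/

import Mathlib

open Polynomial

namespace RightPyramid

variable {r : ℕ}

/-- Boxes of the right-aligned pyramid with rows `i : Fin r` of lengths `q i`.
In the box `⟨i, c⟩` the number `c` counts the columns from the right, starting from `c = 0`
for the rightmost column. The boxes label the standard basis of `V`. -/
abbrev Box (q : Fin r → ℕ) : Type := Σ i : Fin r, Fin (q i)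

/-- The number of columns of the pyramid (the largest part of the partition). -/
def numCols (q : Fin r → ℕ) : ℕ := Finset.univ.sup q

/-- The degree of the matrix unit `e_{ab}` (the arrow from box `b` to box `a`), that is the
difference of the `x`-coordinates of `a` and of `b`. All degrees are integers, since the pyramid
is right-aligned. -/
def deg {q : Fin r → ℕ} (a b : Box q) : ℤ := ((b.2 : ℕ) : ℤ) - ((a.2 : ℕ) : ℤ)

/-- The rightmost box of a row; these boxes span `V_+ = ker Fᵗ`. -/
def IsRight {q : Fin r → ℕ} (a : Box q) : Prop := (a.2 : ℕ) = 0

/-- The leftmost box of a row; these boxes span `V_- = ker F`. -/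
def IsLeft {q : Fin r → ℕ} (a : Box q) : Prop := (a.2 : ℕ) + 1 = q a.1

instance {q : Fin r → ℕ} : DecidablePred (IsRight (q := q)) :=
  fun a => inferInstanceAs (Decidable ((a.2 : ℕ) = 0))

instance {q : Fin r → ℕ} : DecidablePred (IsLeft (q := q)) :=
  fun a => inferInstanceAs (Decidable ((a.2 : ℕ) + 1 = q a.1))

variable (𝕜 : Type*) [Field 𝕜] (q : Fin r → ℕ)

/-- `𝔤 = End V`, as matrices indexed by the boxes. -/
abbrev gl : Type _ := Matrix (Box q) (Box q) 𝕜

/-- The commutator bracket of `End V`. -/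
instance glLieRing : LieRing (gl 𝕜 q) := LieRing.ofAssociativeRing

instance glLieAlgebra : LieAlgebra 𝕜 (gl 𝕜 q) := LieAlgebra.ofAssociativeAlgebra

/-- The nilpotent element: the shift by one box to the left. -/
def F : gl 𝕜 q := Matrix.of fun a b => if a.1 = b.1 ∧ (a.2 : ℕ) = (b.2 : ℕ) + 1 then 1 else 0

/-- The shift by one box to the right, `Fᵗ`. -/
def Ft : gl 𝕜 q := (F 𝕜 q).transpose

/-- The projection of `V` onto the span of a set of boxes, along the span of the other boxes. -/
def proj (P : Box q → Prop) [DecidablePred P] : gl 𝕜 q :=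
  Matrix.diagonal fun a => if P a then 1 else 0

/-- The graded component `𝔤[j]`. (The components of half-odd degree vanish.) -/
def grade (j : ℤ) : Submodule 𝕜 (gl 𝕜 q) where
  carrier := {A | ∀ a b, deg a b ≠ j → A a b = 0}
  add_mem' := fun hA hB a b h => by simp [hA a b h, hB a b h]
  zero_mem' := fun _ _ _ => rfl
  smul_mem' := fun c A hA a b h => by simp [hA a b h]

/-- `𝔤[≥ 1]`. As there are no half-odd degrees, this is also `𝔤[> 0]`. Moreover `𝔤[1/2] = 0`, so
that both of the nilpotent subalgebras `𝔪` and `𝔫` defining the W-algebra are equal to it. -/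
def gePos : Submodule 𝕜 (gl 𝕜 q) := ⨆ j : {j : ℤ // 1 ≤ j}, grade 𝕜 q j

/-- The centralizer `𝔤^f`. -/
def centralizerF : Submodule 𝕜 (gl 𝕜 q) where
  carrier := {A | F 𝕜 q * A = A * F 𝕜 q}
  add_mem' := fun hA hB => by
    simp only [Set.mem_ofPred_eq] at hA hB ⊢
    rw [mul_add, add_mul, hA, hB]
  zero_mem' := by simp
  smul_mem' := fun c A hA => by
    simp only [Set.mem_ofPred_eq] at hA ⊢
    rw [mul_smul_comm, smul_mul_assoc, hA]

/-- `U^⊥ = 1_{FᵗV} End V ⊕ 1_{V_-} (End V)[> 0]`. -/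
def Uperp : Submodule 𝕜 (gl 𝕜 q) :=
  LinearMap.range (LinearMap.mulLeft 𝕜 (proj 𝕜 q fun a => ¬ IsLeft a)) ⊔
    (gePos 𝕜 q).map (LinearMap.mulLeft 𝕜 (proj 𝕜 q IsLeft))

/-! ### The W-algebra and its Kazhdan filtration -/

/-- The universal enveloping algebra `U(𝔤)`. -/
abbrev Ug : Type _ := UniversalEnvelopingAlgebra 𝕜 (gl 𝕜 q)

instance ugLieRing : LieRing (Ug 𝕜 q) := LieRing.ofAssociativeRing

instance ugLieAlgebra : LieAlgebra 𝕜 (Ug 𝕜 q) := LieAlgebra.ofAssociativeAlgebra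

/-- The inclusion `𝔤 → U(𝔤)`. -/
def inc : gl 𝕜 q →ₗ[𝕜] Ug 𝕜 q := (UniversalEnvelopingAlgebra.ι 𝕜 : gl 𝕜 q →ₗ⁅𝕜⁆ Ug 𝕜 q)

/-- The left ideal `ℐ = U(𝔤) Span{b - (f|b)}_{b ∈ 𝔪}`, with `(A|B) = tr(AB)`. -/
def leftIdeal : Submodule (Ug 𝕜 q) (Ug 𝕜 q) :=
  Submodule.span (Ug 𝕜 q)
    {x | ∃ b ∈ gePos 𝕜 q, x = inc 𝕜 q b - algebraMap 𝕜 (Ug 𝕜 q) (Matrix.trace (F 𝕜 q * b))}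

/-- The quotient `U(𝔤)/ℐ`. -/
abbrev UmodI : Type _ := Ug 𝕜 q ⧸ leftIdeal 𝕜 q

/-- The quotient map `U(𝔤) → U(𝔤)/ℐ`, `u ↦ u 1̄`. -/
def mk : Ug 𝕜 q →ₗ[𝕜] UmodI 𝕜 q := (leftIdeal 𝕜 q).mkQ.restrictScalars 𝕜

/-- The W-algebra `W(𝔤,f) = (U(𝔤)/ℐ)^{ad 𝔫}`: the classes of the elements `u` of `U(𝔤)` such that
`[a, u] ∈ ℐ` for every `a ∈ 𝔫`. -/
def WAlg : Submodule 𝕜 (UmodI 𝕜 q) :=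
  Submodule.map (mk 𝕜 q)
    (⨅ a : gePos 𝕜 q, LinearMap.ker
      (mk 𝕜 q ∘ₗ (LinearMap.mulLeft 𝕜 (inc 𝕜 q a) - LinearMap.mulRight 𝕜 (inc 𝕜 q a))))

/-- The Kazhdan filtration of `U(𝔤)`: `F_Δ U(𝔤)` is the sum of the `𝔤[j₁] ⋯ 𝔤[jₛ]` with
`s - j₁ - ⋯ - jₛ ≤ Δ`. As all degrees are integers, integer `Δ` suffice. -/
def kazhdan (Δ : ℤ) : Submodule 𝕜 (Ug 𝕜 q) :=
  Submodule.span 𝕜 {u | ∃ l : List (ℤ × gl 𝕜 q),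
    (∀ p ∈ l, p.2 ∈ grade 𝕜 q p.1) ∧ (l.map fun p => 1 - p.1).sum ≤ Δ ∧
    u = (l.map fun p => inc 𝕜 q p.2).prod}

/-- The induced filtration of `U(𝔤)/ℐ`; its intersection with `W(𝔤,f)` is `F_Δ W(𝔤,f)`. -/
def kazhdanQ (Δ : ℤ) : Submodule 𝕜 (UmodI 𝕜 q) := (kazhdan 𝕜 q Δ).map (mk 𝕜 q)

/-- The symmetric algebra `S(𝔤)`. -/
abbrev Sg : Type _ := SymmetricAlgebra 𝕜 (gl 𝕜 q)

/-- Pairs consisting of an element of `F_Δ U(𝔤)` and an element of `S(𝔤)` of Kazhdan degree `Δ`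
that are the same linear combination of products of homogeneous elements of `𝔤` of Kazhdan degree
`Δ`; this is the identification `gr_Δ U(𝔤) = S(𝔤)_Δ`. -/
def symbolPairs (Δ : ℤ) : Submodule 𝕜 (Ug 𝕜 q × Sg 𝕜 q) :=
  Submodule.span 𝕜 {x | ∃ l : List (ℤ × gl 𝕜 q),
    (∀ p ∈ l, p.2 ∈ grade 𝕜 q p.1) ∧ (l.map fun p => 1 - p.1).sum = Δ ∧
    x = ((l.map fun p => inc 𝕜 q p.2).prod,
         (l.map fun p => SymmetricAlgebra.ι 𝕜 (gl 𝕜 q) p.2).prod)}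

/-- `s ∈ S(𝔤)_Δ` represents `gr_Δ(x) ∈ gr_Δ(U(𝔤)/ℐ) = (S(𝔤)/S(𝔤) Span{b - (f|b)}_{b ∈ 𝔪})_Δ`:
there is `u ∈ F_Δ U(𝔤)` with symbol `s` and `u 1̄ = x` modulo lower filtration. -/
def IsSymbol (Δ : ℤ) (x : UmodI 𝕜 q) (s : Sg 𝕜 q) : Prop :=
  ∃ u : Ug 𝕜 q, (u, s) ∈ symbolPairs 𝕜 q Δ ∧ x - mk 𝕜 q u ∈ kazhdanQ 𝕜 q (Δ - 1)

/-! ### Premet maps -/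

variable {𝕜 q} in
/-- The projection `π^f : 𝔤 → 𝔤^f` with kernel `U^⊥`. -/
noncomputable def piF (hc : IsCompl (centralizerF 𝕜 q) (Uperp 𝕜 q)) :
    gl 𝕜 q →ₗ[𝕜] centralizerF 𝕜 q :=
  Submodule.projectionOnto (centralizerF 𝕜 q) (Uperp 𝕜 q) hc

variable {𝕜 q} in
/-- The algebra homomorphism `η^f : S(𝔤) → S(𝔤^f)`, `η^f(a) = π^f(a) + (f|a)` for `a ∈ 𝔤`. -/
noncomputable def etaF (hc : IsCompl (centralizerF 𝕜 q) (Uperp 𝕜 q)) :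
    Sg 𝕜 q →ₐ[𝕜] SymmetricAlgebra 𝕜 (centralizerF 𝕜 q) :=
  SymmetricAlgebra.lift
    (SymmetricAlgebra.ι 𝕜 (centralizerF 𝕜 q) ∘ₗ piF hc +
      Algebra.linearMap 𝕜 (SymmetricAlgebra 𝕜 (centralizerF 𝕜 q)) ∘ₗ
        Matrix.traceLinearMap (Box q) 𝕜 𝕜 ∘ₗ LinearMap.mulLeft 𝕜 (F 𝕜 q))

variable {𝕜 q} in
/-- Premet maps, with respect to the complement `U^⊥` of `𝔤^f`. The condition
`η^f(gr_Δ(w(a))) = a` includes that its left-hand side is well defined: `gr_Δ(w(a))` has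
representatives in `S(𝔤)_Δ`, and `η^f` takes the same value on all of them. -/
structure IsPremetMap (hc : IsCompl (centralizerF 𝕜 q) (Uperp 𝕜 q))
    (w : centralizerF 𝕜 q →ₗ[𝕜] WAlg 𝕜 q) : Prop where
  injective : Function.Injective w
  mem_kazhdan : ∀ (Δ : ℤ) (a : centralizerF 𝕜 q), (a : gl 𝕜 q) ∈ grade 𝕜 q (1 - Δ) →
    (w a : UmodI 𝕜 q) ∈ kazhdanQ 𝕜 q Δ
  eta_symbol : ∀ (Δ : ℤ) (a : centralizerF 𝕜 q), (a : gl 𝕜 q) ∈ grade 𝕜 q (1 - Δ) →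
    (∃ s, IsSymbol 𝕜 q Δ (w a) s) ∧
    ∀ s, IsSymbol 𝕜 q Δ (w a) s → etaF hc s = SymmetricAlgebra.ι 𝕜 (centralizerF 𝕜 q) a

/-! ### The matrix `Z(z)` -/

/-- `φ_ℓ(A) = ∑_{i=0}^ℓ Fⁱ (Fᵗ)^ℓ A (Fᵗ)^ℓ F^{ℓ-i}`. -/
def phi (l : ℕ) (A : gl 𝕜 q) : gl 𝕜 q :=
  ∑ i ∈ Finset.range (l + 1), F 𝕜 q ^ i * Ft 𝕜 q ^ l * A * Ft 𝕜 q ^ l * F 𝕜 q ^ (l - i)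

section helpers

variable {𝕜 q}

theorem box_ext {a b : Box q} (h1 : a.1 = b.1) (h2 : (a.2 : ℕ) = b.2) : a = b := by
  obtain ⟨i, x⟩ := a
  obtain ⟨j, y⟩ := b
  obtain rfl : i = j := h1
  obtain rfl : x = y := Fin.ext h2
  rfl

theorem F_mul_diag_mul_Ft {D : gl 𝕜 q} (hD : D.IsDiag) :
    (F 𝕜 q * D * Ft 𝕜 q).IsDiag := by
  intro a c hac
  simp only [Matrix.mul_apply, Ft, Matrix.transpose_apply]
  refine Finset.sum_eq_zero fun b _ => ?_
  rw [Finset.sum_eq_single b (fun d _ hd => by simp [hD hd]) (by simp)]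
  simp only [F, Matrix.of_apply]
  split_ifs with h1 h2
  · exact absurd (box_ext (h1.1.trans h2.1.symm) (h1.2.trans h2.2.symm)) hac
  all_goals simp

theorem Ft_mul_diag_mul_F {D : gl 𝕜 q} (hD : D.IsDiag) :
    (Ft 𝕜 q * D * F 𝕜 q).IsDiag := by
  intro a c hac
  simp only [Matrix.mul_apply, Ft, Matrix.transpose_apply]
  refine Finset.sum_eq_zero fun b _ => ?_
  rw [Finset.sum_eq_single b (fun d _ hd => by simp [hD hd]) (by simp)]
  simp only [F, Matrix.of_apply]
  split_ifs with h1 h2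
  · exact absurd (box_ext (h1.1.symm.trans h2.1) (by omega)) hac
  all_goals simp

theorem F_Ft_pow_isDiag (l : ℕ) : (F 𝕜 q ^ l * Ft 𝕜 q ^ l).IsDiag := by
  induction l with
  | zero => simp [Matrix.isDiag_one]
  | succ l ih =>
    have := F_mul_diag_mul_Ft ih
    rwa [← mul_assoc, ← pow_succ', mul_assoc, ← pow_succ] at this

theorem Ft_F_pow_isDiag (l : ℕ) : (Ft 𝕜 q ^ l * F 𝕜 q ^ l).IsDiag := by
  induction l with
  | zero => simp [Matrix.isDiag_one]
  | succ l ih =>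
    have := Ft_mul_diag_mul_F ih
    rwa [← mul_assoc, ← pow_succ', mul_assoc, ← pow_succ] at this

theorem isDiag_comm {A B : gl 𝕜 q} (hA : A.IsDiag) (hB : B.IsDiag) : A * B = B * A := by
  rw [← hA.diagonal_diag, ← hB.diagonal_diag, Matrix.diagonal_mul_diagonal,
    Matrix.diagonal_mul_diagonal]
  congr 1
  ext
  exact mul_comm _ _

theorem F_Ft_F : F 𝕜 q * (Ft 𝕜 q * F 𝕜 q) = F 𝕜 q := by
  have hd : (Ft 𝕜 q * F 𝕜 q).IsDiag := by simpa using Ft_F_pow_isDiag (𝕜 := 𝕜) (q := q) 1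
  ext a b
  rw [Matrix.mul_apply, Finset.sum_eq_single b (fun d _ hdb => by simp [hd hdb]) (by simp),
    Matrix.mul_apply]
  by_cases h : a.1 = b.1 ∧ (a.2 : ℕ) = (b.2 : ℕ) + 1
  · rw [Finset.sum_eq_single a]
    · simp [F, Ft, h]
    · intro d _ hda
      have : ¬ (d.1 = b.1 ∧ (d.2 : ℕ) = (b.2 : ℕ) + 1) := fun h' =>
        hda (box_ext (h'.1.trans h.1.symm) (h'.2.trans h.2.symm))
      simp [F, Ft, this]
    · simp
  · simp [F, h]

theorem F_mul_phi_comm (l : ℕ) {A : gl 𝕜 q} (h1 : F 𝕜 q * A = 0) (h2 : A * F 𝕜 q = 0) :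
    F 𝕜 q * phi 𝕜 q l A = phi 𝕜 q l A * F 𝕜 q := by
  set f := F 𝕜 q with hf
  set t := Ft 𝕜 q with ht
  have hft1 : (f * t).IsDiag := by simpa using F_Ft_pow_isDiag (𝕜 := 𝕜) (q := q) 1
  have htf1 : (t * f).IsDiag := by simpa using Ft_F_pow_isDiag (𝕜 := 𝕜) (q := q) 1
  have e1 : f ^ (l + 1) * t ^ l = f * (f ^ l * t ^ l) * t * f := by
    have := isDiag_comm htf1 (F_Ft_pow_isDiag (𝕜 := 𝕜) (q := q) l)
    calc f ^ (l + 1) * t ^ l = f * (t * f) * (f ^ l * t ^ l) := by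
          rw [F_Ft_F, pow_succ', mul_assoc]
      _ = f * ((f ^ l * t ^ l) * (t * f)) := by rw [mul_assoc, this]
      _ = _ := by simp only [mul_assoc]
  have e2 : t ^ l * f ^ (l + 1) = f * (t * (t ^ l * f ^ l) * f) := by
    have := isDiag_comm hft1 (Ft_F_pow_isDiag (𝕜 := 𝕜) (q := q) l)
    calc t ^ l * f ^ (l + 1) = (t ^ l * f ^ l) * (f * (t * f)) := by
          rw [F_Ft_F, pow_succ, mul_assoc]
      _ = (t ^ l * f ^ l) * (f * t) * f := by simp only [mul_assoc]
      _ = (f * t) * (t ^ l * f ^ l) * f := by rw [this]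
      _ = _ := by simp only [mul_assoc]
  have z1 : f ^ (l + 1) * t ^ l * A = 0 := by rw [e1, mul_assoc, h1, mul_zero]
  have z2 : A * (t ^ l * f ^ (l + 1)) = 0 := by rw [e2, ← mul_assoc, h2, zero_mul]
  have L : f * phi 𝕜 q l A =
      ∑ i ∈ Finset.range (l + 1), f ^ (i + 1) * (t ^ l * A * t ^ l) * f ^ (l + 1 - (i + 1)) := by
    rw [phi, Finset.mul_sum]
    refine Finset.sum_congr rfl fun i _ => ?_
    rw [Nat.add_sub_add_right, pow_succ']
    simp only [mul_assoc, hf, ht]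
  have R : phi 𝕜 q l A * f =
      ∑ i ∈ Finset.range (l + 1), f ^ i * (t ^ l * A * t ^ l) * f ^ (l + 1 - i) := by
    rw [phi, Finset.sum_mul]
    refine Finset.sum_congr rfl fun i hi => ?_
    rw [Nat.sub_add_comm (Nat.lt_succ_iff.mp (Finset.mem_range.mp hi)), pow_succ]
    simp only [mul_assoc, hf, ht]
  rw [L, R, ← sub_eq_zero, ← Finset.sum_sub_distrib,
    Finset.sum_range_sub (fun i => f ^ i * (t ^ l * A * t ^ l) * f ^ (l + 1 - i))]
  have z1' : f ^ (l + 1) * (t ^ l * A * t ^ l) = 0 := by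
    rw [← mul_assoc, ← mul_assoc, z1, zero_mul]
  have z2' : t ^ l * A * t ^ l * f ^ (l + 1) = 0 := by
    rw [mul_assoc, mul_assoc, z2, mul_zero]
  simp [z1', z2']

/-- The elementary matrices in `Hom(V_+, V_-)` are mapped by `φ_ℓ` into `𝔤^f`. -/
theorem phi_single_mem (l : ℕ) {a b : Box q} (ha : IsRight a) (hb : IsLeft b) :
    phi 𝕜 q l (Matrix.single b a 1) ∈ centralizerF 𝕜 q := by
  refine F_mul_phi_comm l ?_ ?_
  · ext c d
    rw [Matrix.mul_apply]
    refine Finset.sum_eq_zero fun e _ => ?_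
    by_cases he : b = e
    · subst he
      have : ¬ (c.1 = b.1 ∧ (c.2 : ℕ) = (b.2 : ℕ) + 1) := by
        rintro ⟨h1, h2⟩
        have h3 := c.2.isLt
        rw [h2, hb, h1] at h3
        exact lt_irrefl _ h3
      simp [F, this]
    · simp [he]
  · ext c d
    rw [Matrix.mul_apply]
    refine Finset.sum_eq_zero fun e _ => ?_
    by_cases he : a = e
    · subst he
      have h0 : (a.2 : ℕ) = 0 := ha
      simp [F, h0]
    · simp [he]

end helpers

/-- The coefficient of `z^ℓ` in `z 1_{V_+} (1 + z Fᵗ)⁻¹ 1_{V_-} = ∑_k (-1)^k z^{k+1} 1_{V_+} (Fᵗ)^k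
1_{V_-}`. -/
def leadCoeff : ℕ → gl 𝕜 q
  | 0 => 0
  | k + 1 => (-1 : 𝕜) ^ k • (proj 𝕜 q IsRight * Ft 𝕜 q ^ k * proj 𝕜 q IsLeft)

/-- The coefficient of `z^ℓ` in
`Z(z) = z 1_{V_+} (1 + z Fᵗ)⁻¹ 1_{V_-} + ∑_i φ_z(u_i) U^i`, where `φ_z = ∑_ℓ (-z)^ℓ φ_ℓ`, the `u_i`
are the elementary matrices `e_{ba}` in `Hom(V_+, V_-)` and the dual basis consists of the
`E_{ab}`. The entries lie in the subspace `𝕜 ⊕ 𝔤^f` of `U(𝔤^f)`. -/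
def Z (l : ℕ) : Matrix (Box q) (Box q) (𝕜 × centralizerF 𝕜 q) :=
  Matrix.of fun a b =>
    (leadCoeff 𝕜 q l a b,
      if h : IsRight a ∧ IsLeft b then
        (-1 : 𝕜) ^ l • ⟨phi 𝕜 q l (Matrix.single b a 1), phi_single_mem l h.1 h.2⟩
      else 0)

/-! ### The matrix `W(z)` -/

/-- `U(𝔤)[z] ⊗ End V`. -/
abbrev UMat : Type _ := Matrix (Box q) (Box q) (Ug 𝕜 q)[X]

/-- The inclusion of `End V` in `U(𝔤)[z] ⊗ End V`. -/
noncomputable def sc (M : gl 𝕜 q) : UMat 𝕜 q := M.map (algebraMap 𝕜 (Ug 𝕜 q)[X])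

/-- `z 1_V`. -/
noncomputable def zOne : UMat 𝕜 q := Matrix.diagonal fun _ => X

/-- `E = ∑_i u_i U^i = ∑_{a,b} e_{ba} E_{ab}`. -/
noncomputable def E : UMat 𝕜 q :=
  Matrix.of fun a b => C (inc 𝕜 q (Matrix.single b a 1))

/-- `E_j`, the part of `E` with `u_i ∈ 𝔤[j]`. -/
noncomputable def Edeg (j : ℤ) : UMat 𝕜 q :=
  Matrix.of fun a b => if deg b a = j then C (inc 𝕜 q (Matrix.single b a 1)) else 0

/-- `D = - ∑_{i ∈ I_{≥ 1}} U^i U_i`. -/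
def D : gl 𝕜 q :=
  - ∑ a : Box q, ∑ b : Box q,
    if 1 ≤ deg a b then Matrix.single b a 1 * Matrix.single a b 1 else 0

variable {𝕜 q} in
/-- The bracket of the first factors together with the product of the second factors,
`[a₁ A₂, b₁ B₂]¹ = [a₁, b₁] A₂ B₂`. -/
noncomputable def bracketOne (A B : UMat 𝕜 q) : UMat 𝕜 q :=
  Matrix.of fun a c => ∑ b, (A a b * B b c - B b c * A a b)

variable {𝕜 q} in
/-- `Res_x x⁻¹ (1 + x⁻¹ F)⁻¹ M(x) = ∑_k (-F)^k M_k`, for `M(x) = ∑_k x^k M_k`; the sum may be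
restricted to `k` less than the number of columns since the other powers of `F` vanish. -/
noncomputable def resTerm (M : UMat 𝕜 q) : UMat 𝕜 q :=
  ∑ k ∈ Finset.range (numCols q), sc 𝕜 q ((-F 𝕜 q) ^ k) * M.map fun p => C (p.coeff k)

/-- The matrix `W̃(z)` for the right-aligned pyramid formed by the `n` rightmost columns
(`1 ≤ n ≤ numCols q`), whose row lengths are `min (q i) n`. The recursion goes from this pyramid
with its leftmost column removed (`W'`) to the pyramid itself. All of these matrices are viewed in
`U(𝔤)[z] ⊗ End V`, by the inclusions `𝔤' ⊂ 𝔤` and `Hom(V'_-, V_+) ⊂ End V`. With respect to the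
pyramid with `n` columns, `Vu` is the projection to the span `V_-^u` of the leftmost boxes of the
rows of length `< n`, `Vd` the projection to the leftmost column `V_-^d`, `FtVd` the projection to
`Fᵗ V_-^d`, and `r₁` the height of the leftmost column. -/
noncomputable def Wtilde : ℕ → UMat 𝕜 q
  | 0 => 0
  | 1 => sc 𝕜 q (proj 𝕜 q IsRight) * (zOne 𝕜 q + E 𝕜 q) * sc 𝕜 q (proj 𝕜 q IsRight)
  | m + 2 =>
    let n := m + 2
    let W' := Wtilde (m + 1)
    let Vu := sc 𝕜 q (proj 𝕜 q fun a => IsLeft a ∧ q a.1 < n)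
    let Vd := sc 𝕜 q (proj 𝕜 q fun a => (a.2 : ℕ) + 1 = n)
    let FtVd := sc 𝕜 q (proj 𝕜 q fun a => (a.2 : ℕ) + 2 = n ∧ n ≤ q a.1)
    let r₁ : ℕ := (Finset.univ.filter fun i => n ≤ q i).card
    W' * Vu - (1 / (r₁ : 𝕜)) • bracketOne W' (FtVd * Edeg 𝕜 q (-1))
      - W' * sc 𝕜 q (Ft 𝕜 q) * (zOne 𝕜 q + Edeg 𝕜 q 0 + sc 𝕜 q (D 𝕜 q)) * Vd
      + W' * Vu * resTerm W' * sc 𝕜 q (Ft 𝕜 q) * Vd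

/-- The coefficient of `z^ℓ` in `W(z) = W̃(z) 1̄`, for the whole pyramid. -/
noncomputable def W (l : ℕ) : Matrix (Box q) (Box q) (UmodI 𝕜 q) :=
  (Wtilde 𝕜 q (numCols q)).map fun p => mk 𝕜 q (p.coeff l)

variable {𝕜 q} in
/-- The extension of `w : 𝔤^f → W(𝔤,f)` to `𝕜 ⊕ 𝔤^f` by `1 ↦ 1̄`. -/
noncomputable def extend (w : centralizerF 𝕜 q →ₗ[𝕜] WAlg 𝕜 q) :
    𝕜 × centralizerF 𝕜 q →ₗ[𝕜] UmodI 𝕜 q :=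
  (LinearMap.toSpanSingleton 𝕜 (UmodI 𝕜 q) (mk 𝕜 q 1)).coprod ((WAlg 𝕜 q).subtype ∘ₗ w)

end RightPyramid

/-! The recursion for `Wtilde` becomes transparent once its bracket term is made explicit. Let `T n`
be the matrix, indexed by rows, of the pyramid of the `n` rightmost columns, and let `Q n` be its
part that is linear in the new box, as a function of this box. Bracketing with the matrix unit from
`b` to `c` turns `Q n i b` into `Q n i c` (`ad_Q_replace`). Hence all rows that reach the new column
contribute the same vector to the bracket with `E_{-1}`, and dividing by `r₁` leaves one copy. In
this way `Wtilde_apply` identifies `Wtilde` with `T`; inverting `r₁` is the only use of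
characteristic zero.

Invariance under `𝔤[≥ 1]` (`ad_T_mem`) is an induction on the number of columns, modulo the left
ideal. Units between old columns commute with the units by which the new column is reached, so the
old invariance propagates. For a unit from the new column to its neighbour, the bracket with the
recursion for `T (n + 2)` reproduces the right-hand side of the recursion for `T (n + 1)` minus its
left-hand side, hence zero. The integer shifts match because `-D` counts boxes to the right and so
grows by the height of a column. All other units are commutators of these two kinds.

Commuting with `F` means being constant along diagonals, so an element of `𝔤^f` is determined by its
entries at `(b, x)` with `b` leftmost and `x` weakly to the right of `b`; `U^⊥` is the space where
these entries vanish. Modulo `U^⊥`, the element `φ_ℓ(e_{ba})` is the unit `e_{bx}` with `x` lying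
`ℓ` steps to the left of `a`, or zero. The Premet map `premet` therefore sends `e_{bx}` to `(-1)^ℓ`
times the coefficient of `z^ℓ` in the matching entry of `T`, which makes `w(Z(z)) = W(z)` a
comparison of coefficients together with a computation of the leading ones (`coeff_T`).

If `z` has Kazhdan degree one, the symbol of `T` satisfies the same recursion without the shift by
`D` (`polySym_T_Q`). The map `η^f` kills every unit into a non-leftmost box from a box weakly to its
right, so the recursion collapses to a linear one, and `η^f` of the symbol of `w(a)` is `a`
(`etaF_liftS`).

It remains to see that `η^f` does not depend on the chosen symbol, that is, that it kills every
symbol of zero in `U(𝔤)/ℐ`. Instead of a PBW basis, an oscillator representation of `𝔤` on a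
polynomial ring is used, whose vacuum is a Whittaker vector; its associated graded map is an algebra
homomorphism through which `η^f` factors (`eq_zero_of_isSymbol_zero`). This also gives injectivity,
by looking at top symbols. -/

namespace RightPyramid

variable {r : ℕ}

/-! ### The explicit recursion: degrees, leading coefficients, the linear case. -/

section Recursion

variable {A : Type*} [Ring A] (q : Fin r → ℕ) (d : ℕ → ℕ) (g : Fin r × ℕ → Fin r × ℕ → A)

/-- The pair formed by the matrices `T n` of the pyramids with `n` columns, and by the auxiliary
row vectors `Q n` obtained from them by replacing the leftmost box of a row by another box. Boxes
are given by the row and the column, and `g x y` stands for the matrix unit from `y` to `x`. -/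
noncomputable def recPair : ℕ → (Fin r → Fin r → A[X]) × (Fin r → Fin r × ℕ → A[X])
  | 0 => (fun i j => if i = j then -1 else 0, fun _ _ => 0)
  | n + 1 =>
    (fun i j => if n < q j then
        (recPair n).2 i (j, n) - ∑ h, (recPair n).1 i h * C (g (j, n) (h, n))
          - X * (recPair n).1 i j + d n • (recPair n).1 i j
          - ∑ h, if q h ≤ n then
              (-1 : ℤ) ^ q h • ((recPair n).1 i h * C (((recPair n).1 h j).coeff (q h - 1))) else 0
      else (recPair n).1 i j,
     fun i c => (recPair n).2 i c - ∑ h, (recPair n).1 i h * C (g c (h, n)))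

/-- The matrix of the pyramid with `n` columns, by an explicit recursion. -/
noncomputable def T (n : ℕ) : Fin r → Fin r → A[X] := (recPair q d g n).1

/-- The part of the matrix `T` that is linear in the new box, as a function of this box. -/
noncomputable def Q (n : ℕ) : Fin r → Fin r × ℕ → A[X] := (recPair q d g n).2

/-- The sign is chosen so that one step of the recursion gives `X + E`, the matrix of a single
column. -/
theorem T_zero (i j : Fin r) : T q d g 0 i j = if i = j then -1 else 0 := rfl

theorem Q_zero (i : Fin r) (c) : Q q d g 0 i c = 0 := rfl

theorem Q_succ (n : ℕ) (i : Fin r) (c) :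
    Q q d g (n + 1) i c = Q q d g n i c - ∑ h, T q d g n i h * C (g c (h, n)) := rfl

theorem T_succ_of_lt {n : ℕ} {j : Fin r} (h : n < q j) (i : Fin r) :
    T q d g (n + 1) i j = Q q d g (n + 1) i (j, n) - X * T q d g n i j + d n • T q d g n i j
      - ∑ h, if q h ≤ n then
          (-1 : ℤ) ^ q h • (T q d g n i h * C ((T q d g n h j).coeff (q h - 1))) else 0 :=
  if_pos h

theorem T_succ_of_le {n : ℕ} {j : Fin r} (h : q j ≤ n) (i : Fin r) :
    T q d g (n + 1) i j = T q d g n i j :=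
  if_neg h.not_gt

theorem T_eq_of_le {n m : ℕ} {j : Fin r} (h : q j ≤ n) (hm : n ≤ m) (i : Fin r) :
    T q d g m i j = T q d g n i j := by
  induction m, hm using Nat.le_induction with
  | base => rfl
  | succ m hm ih => rw [T_succ_of_le q d g (h.trans hm), ih]

variable {q}

/-- The quadratic term controls the degree: once row `i` is exhausted, its summand `h = i` contains
the scalar leading coefficient of the diagonal entry and cancels the top term of `X * T i j`. So off
the diagonal the degree stays below `q i`, and on the diagonal the leading coefficient is a scalar.
-/
theorem coeff_T_Q (hq : ∀ i, 0 < q i) (hg : ∀ x y, q y.1 ≤ y.2 → g x y = 0) (n : ℕ) :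
    (∀ i j l, min (min (q i) (q j)) n ≤ l →
      (T q d g n i j).coeff l = if i = j ∧ l = min (q i) n then -(-1) ^ l else 0) ∧
    (∀ i c l, min (q i) n ≤ l → (Q q d g n i c).coeff l = 0) := by
  induction n with
  | zero =>
    refine ⟨fun i j l _ => ?_, fun i c l _ => by simp [Q_zero]⟩
    rw [T_zero]
    by_cases hij : i = j
    · by_cases hl : l = 0
      · simp [hij, hl]
      · simp [hij, hl, coeff_one]
    · simp [hij]
  | succ n ih =>
    obtain ⟨ihT, ihQ⟩ := ih
    have hQ : ∀ i c l, min (q i) (n + 1) ≤ l → (Q q d g (n + 1) i c).coeff l = 0 := by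
      intro i c l hl
      rw [Q_succ, coeff_sub, ihQ i c l (by omega), finsetSum_coeff, zero_sub, neg_eq_zero]
      refine Finset.sum_eq_zero fun h _ => ?_
      by_cases hh : q h ≤ n
      · rw [hg _ _ hh, C_0, mul_zero, coeff_zero]
      · rw [coeff_mul_C, ihT i h l (by omega), if_neg, zero_mul]
        rintro ⟨rfl, h2⟩
        omega
    refine ⟨fun i j l hl => ?_, hQ⟩
    by_cases hj : q j ≤ n
    · rw [T_succ_of_le q d g hj, ihT i j l (by omega)]
      refine if_congr (and_congr_right fun h => ?_) rfl rfl
      subst h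
      omega
    push Not at hj
    rw [T_succ_of_lt q d g hj]
    simp only [coeff_sub, coeff_add, coeff_smul, finsetSum_coeff]
    rw [hQ i _ l (by omega), ihT i j l (by omega)]
    have hd : d n • (if i = j ∧ l = min (q i) n then -(-1) ^ l else 0 : A) = 0 := by
      rw [if_neg, smul_zero]
      rintro ⟨rfl, h2⟩
      omega
    rw [hd]
    obtain ⟨l, rfl⟩ : ∃ l', l = l' + 1 := Nat.exists_eq_succ_of_ne_zero (by have := hq i; omega)
    rw [coeff_X_mul]
    by_cases hi : q i ≤ n
    -- Only `h = i` survives; at `l + 1 = q i` it carries the leading coefficient `-(-1) ^ q i`,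
    -- which offsets the top coefficient raised by `X`.
    · rw [Finset.sum_eq_single i, if_pos hi, coeff_smul, coeff_mul_C, ihT i i _ (by omega),
        if_neg (c := i = j ∧ _) (by rintro ⟨rfl, h2⟩; omega)]
      · by_cases hl' : l + 1 = q i
        · rw [if_pos ⟨rfl, by omega⟩, ← hl', Nat.add_sub_cancel]
          have h1 : ((-1 : A) ^ (l + 1)) * (-1) ^ (l + 1) = 1 := by
            rw [← pow_add, Even.neg_one_pow ⟨_, rfl⟩]
          rw [neg_mul, smul_neg, zsmul_eq_mul]
          push_cast
          rw [← mul_assoc, h1]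
          simp
        · rw [if_neg (by omega), ihT i j l (by omega), if_neg (by rintro ⟨rfl, h2⟩; omega)]
          simp
      · intro h _ hh
        split_ifs with hn
        · rw [coeff_smul, coeff_mul_C, ihT i h _ (by omega), if_neg (by tauto)]
          simp
        · simp
      · simp
    · rw [Finset.sum_eq_zero, ihT i j l (by omega)]
      · by_cases hij : i = j ∧ l = n
        · rw [if_pos (by omega), if_pos (by omega), pow_succ]
          simp
        · rw [if_neg (by omega), if_neg (by omega)]
          simp
      · intro h _
        split_ifs with hn
        · rw [coeff_smul, coeff_mul_C, ihT i h _ (by omega), if_neg]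
          · simp
          · rintro ⟨rfl, -⟩
            omega
        · simp

theorem coeff_T (hq : ∀ i, 0 < q i) (hg : ∀ x y, q y.1 ≤ y.2 → g x y = 0) {n l : ℕ} {i j : Fin r}
    (hl : min (min (q i) (q j)) n ≤ l) :
    (T q d g n i j).coeff l = if i = j ∧ l = min (q i) n then -(-1) ^ l else 0 :=
  (coeff_T_Q d g hq hg n).1 i j l hl

variable {g} in
theorem Q_of_eq_zero (hg : ∀ c x, c.2 + 1 < q c.1 → x.2 ≤ c.2 → g c x = 0) {n : ℕ} (i : Fin r)
    {c : Fin r × ℕ} (hc : c.2 + 1 < q c.1) (hn : n ≤ c.2 + 1) : Q q d g n i c = 0 := by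
  induction n with
  | zero => rfl
  | succ n ih =>
    rw [Q_succ, ih (by omega), zero_sub, neg_eq_zero]
    refine Finset.sum_eq_zero fun h _ => ?_
    rw [hg _ _ hc (by simpa using hn), C_0, mul_zero]

variable {g} in
/-- If `g c x = 0` for `x` weakly to the right of `c`, unless `c` is a leftmost box, then the
matrix `T` is a scalar matrix before the row in question is exhausted. -/
theorem T_of_eq_zero (hg : ∀ c x, c.2 + 1 < q c.1 → x.2 ≤ c.2 → g c x = 0) {n : ℕ} (i : Fin r)
    {j : Fin r} (hn : n < q j) : T q (fun _ => 0) g n i j = if i = j then -(-X) ^ n else 0 := by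
  induction n generalizing i j with
  | zero => rw [T_zero, pow_zero]
  | succ n ih =>
    rw [T_succ_of_lt q _ g (by omega), Q_of_eq_zero _ hg (c := (j, n)) i hn le_rfl, ih _ (by omega),
      Finset.sum_eq_zero]
    · split_ifs <;> simp [pow_succ']
    · intro h _
      split_ifs with hh
      -- Here `q h ≤ n < q j`, so `h ≠ j` and the second factor is an off-diagonal entry, hence
      -- zero.
      · rw [ih (j := j) _ (by omega), if_neg (by rintro rfl; omega)]
        simp
      · rfl

variable {g} in
/-- If `g c x = 0` for `x` weakly to the right of `c`, unless `c` is a leftmost box, then the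
matrix `T` is linear in the remaining generators. -/
theorem T_linear_of_eq_zero (hq : ∀ i, 0 < q i) (hg0 : ∀ x y, q y.1 ≤ y.2 → g x y = 0)
    (hg : ∀ c x, c.2 + 1 < q c.1 → x.2 ≤ c.2 → g c x = 0) {n : ℕ} (i j : Fin r) (hn : q j ≤ n) :
    T q (fun _ => 0) g n i j = (if i = j then -(-X) ^ q j else 0) +
      ∑ l ∈ Finset.range (q j), (-X) ^ l * C (g (j, q j - 1) (i, l)) := by
  have hQ : ∀ n c, Q q (fun _ => 0) g n i c =
      ∑ l ∈ Finset.range n, (-X) ^ l * C (g c (i, l)) := by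
    intro n c
    induction n with
    | zero => rfl
    | succ n ih =>
      rw [Q_succ, ih, Finset.sum_range_succ, sub_eq_add_neg, Finset.sum_eq_single i]
      · by_cases hi : n < q i
        · rw [T_of_eq_zero hg _ hi]
          simp
        · rw [hg0 _ _ (by simpa using hi)]
          simp
      · intro h _ hh
        by_cases hi : n < q h
        · rw [T_of_eq_zero hg _ hi, if_neg hh.symm, zero_mul]
        · rw [hg0 _ _ (by simpa using hi)]
          simp
      · simp
  obtain ⟨m, hm⟩ : ∃ m, q j = m + 1 := Nat.exists_eq_succ_of_ne_zero (hq j).ne'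
  rw [T_eq_of_le q _ g le_rfl hn, hm, T_succ_of_lt q _ g (by omega), hQ,
    T_of_eq_zero hg _ (by omega), Finset.sum_eq_zero (f := fun h => ite _ _ _)]
  · split_ifs <;> simp [pow_succ', sub_eq_add_neg, add_comm]
  · intro h _
    split_ifs with hh
    · rw [T_of_eq_zero hg (j := j) _ (by omega), if_neg (by rintro rfl; omega)]
      simp
    · rfl

/-- The recursion uses only ring operations. Applied to `etaF`, this brings the symbols of the
matrix entries into the situation of `T_linear_of_eq_zero`. -/
theorem map_T_Q {B : Type*} [Ring B] (f : A →+* B) (n : ℕ) :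
    (∀ i j, T q d (fun x y => f (g x y)) n i j = (T q d g n i j).map f) ∧
    (∀ i c, Q q d (fun x y => f (g x y)) n i c = (Q q d g n i c).map f) := by
  induction n with
  | zero =>
    refine ⟨fun i j => ?_, fun i c => by simp [Q_zero]⟩
    rw [T_zero, T_zero]
    split_ifs <;> simp
  | succ n ih =>
    obtain ⟨ihT, ihQ⟩ := ih
    have hQ : ∀ i c, Q q d (fun x y => f (g x y)) (n + 1) i c = (Q q d g (n + 1) i c).map f := by
      intro i c
      simp only [Q_succ, ihT, ihQ, Polynomial.map_sub, Polynomial.map_sum, Polynomial.map_mul,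
        map_C]
    refine ⟨fun i j => ?_, hQ⟩
    by_cases hj : q j ≤ n
    · rw [T_succ_of_le q d _ hj, T_succ_of_le q d _ hj, ihT]
    · push Not at hj
      rw [T_succ_of_lt q d _ hj, T_succ_of_lt q d _ hj, hQ]
      simp only [ihT, Polynomial.map_sub, Polynomial.map_add, Polynomial.map_sum,
        Polynomial.map_mul, map_X, nsmul_eq_mul, zsmul_eq_mul]
      congr 1
      · simp
      · refine Finset.sum_congr rfl fun h _ => ?_
        split_ifs <;> simp

end Recursion

/-! ### Matrix units from oscillators. -/

section Oscillator

variable {ι κ R : Type*} [Fintype κ] [DecidableEq ι] [DecidableEq κ] [Ring R]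

/-- Only the Weyl relation between `p` and `x` contributes: the normally ordered quartic terms agree
in both products. -/
theorem oscillator_comm {x p : ι → κ → R} (hx : ∀ i k j l, x i k * x j l = x j l * x i k)
    (hp : ∀ i k j l, p i k * p j l = p j l * p i k)
    (hpx : ∀ j k i l, p j k * x i l = x i l * p j k + if j = i ∧ k = l then 1 else 0)
    (i j l n : ι) :
    (∑ k, x i k * p j k) * (∑ k, x l k * p n k) - (∑ k, x l k * p n k) * (∑ k, x i k * p j k) =
      (if j = l then ∑ k, x i k * p n k else 0) - (if n = i then ∑ k, x l k * p j k else 0) := by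
  have key : ∀ k t, x i k * p j k * (x l t * p n t) - x l t * p n t * (x i k * p j k) =
      (if k = t then (if j = l then x i k * p n t else 0) else 0) -
        (if k = t then (if n = i then x l t * p j k else 0) else 0) := by
    intro k t
    have h1 : x i k * p j k * (x l t * p n t) = x i k * x l t * p j k * p n t +
        if k = t then (if j = l then x i k * p n t else 0) else 0 := by
      rw [mul_assoc, ← mul_assoc (p j k), hpx, add_mul, mul_add]
      simp only [mul_assoc]
      split_ifs <;> simp_all
    have h2 : x l t * p n t * (x i k * p j k) = x i k * x l t * p j k * p n t +
        if k = t then (if n = i then x l t * p j k else 0) else 0 := by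
      rw [mul_assoc, ← mul_assoc (p n t), hpx, add_mul, mul_add, mul_assoc (x i k * x l t),
        hp j k n t, hx i k l t]
      simp only [mul_assoc]
      by_cases h : k = t
      · subst h; split_ifs <;> simp_all
      · simp [h, Ne.symm h]
    rw [h1, h2]
    abel
  rw [Finset.sum_mul_sum, Finset.sum_mul_sum, Finset.sum_comm (f := fun k t => x l k * p n k * _),
    ← Finset.sum_sub_distrib]
  simp_rw [← Finset.sum_sub_distrib, key]
  simp only [Finset.sum_sub_distrib, Finset.sum_ite_eq, Finset.mem_univ, if_true]
  congr 1 <;> split_ifs <;> simp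

end Oscillator

/-! ### Fock space with a Whittaker vacuum, and homomorphisms on the associated graded of `U(𝔤)/ℐ`.
-/

section Fock

variable (𝕜 : Type*) [Field 𝕜] (q : Fin r → ℕ)

/-- The polynomial ring on which `𝔤` acts by an oscillator representation. -/
abbrev Fock : Type _ := MvPolynomial (Box q × Box q) 𝕜

variable {q} in
/-- The symbol of the oscillator `x`. -/
noncomputable def xSym (i k : Box q) : Fock 𝕜 q :=
  if (k.2 : ℕ) ≤ i.2 then MvPolynomial.X (i, k) else MvPolynomial.C (F 𝕜 q k i)

variable {q} in
/-- The symbol of the oscillator `p`. -/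
noncomputable def pSym (j k : Box q) : Fock 𝕜 q :=
  if (k.2 : ℕ) ≤ j.2 then MvPolynomial.C (if j = k then 1 else 0) else MvPolynomial.X (j, k)

variable {q} in
/-- The operators `f + c ∂_v`. -/
noncomputable def diffOp (f : Fock 𝕜 q) (c : 𝕜) (v : Box q × Box q) : Module.End 𝕜 (Fock 𝕜 q) :=
  LinearMap.mulLeft 𝕜 f + c • (MvPolynomial.pderiv v : Derivation 𝕜 (Fock 𝕜 q) (Fock 𝕜 q))

theorem pderiv_comm {σ : Type*} (v w : σ) (h : MvPolynomial σ 𝕜) :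
    MvPolynomial.pderiv v (MvPolynomial.pderiv w h) =
      MvPolynomial.pderiv w (MvPolynomial.pderiv v h) := by
  classical
  have : ⁅(MvPolynomial.pderiv v : Derivation 𝕜 (MvPolynomial σ 𝕜) (MvPolynomial σ 𝕜)),
      (MvPolynomial.pderiv w : Derivation 𝕜 (MvPolynomial σ 𝕜) (MvPolynomial σ 𝕜))⁆ = 0 := by
    refine MvPolynomial.derivation_ext (R := 𝕜) fun i => ?_
    rw [Derivation.commutator_apply]
    by_cases hv : i = v <;> by_cases hw : i = w <;>
      simp [MvPolynomial.pderiv_X, Pi.single_apply, hv, hw] <;> split_ifs <;> simp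
  rw [← sub_eq_zero, ← Derivation.commutator_apply, this, Derivation.zero_apply]

variable {q} in
-- The derivatives have constant coefficients and commute, so the commutator of two such operators
-- is multiplication by a polynomial.
theorem diffOp_comm (f g : Fock 𝕜 q) (c c' : 𝕜) (v w : Box q × Box q) :
    diffOp 𝕜 f c v * diffOp 𝕜 g c' w = diffOp 𝕜 g c' w * diffOp 𝕜 f c v +
      LinearMap.mulLeft 𝕜 (c • MvPolynomial.pderiv v g - c' • MvPolynomial.pderiv w f) := by
  refine LinearMap.ext fun h => ?_
  simp only [diffOp, Module.End.mul_apply, LinearMap.add_apply, LinearMap.smul_apply,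
    LinearMap.mulLeft_apply, Derivation.coeFn_coe, map_add, Derivation.leibniz, 
    smul_eq_mul, MvPolynomial.smul_eq_C_mul, MvPolynomial.pderiv_C, pderiv_comm 𝕜 v w]
  ring

variable {q} in
/-- The oscillator `x`. -/
noncomputable def xOp (i k : Box q) : Module.End 𝕜 (Fock 𝕜 q) :=
  diffOp 𝕜 (xSym 𝕜 i k) (if (k.2 : ℕ) ≤ i.2 then 0 else -1) (i, k)

variable {q} in
/-- The oscillator `p`. -/
noncomputable def pOp (j k : Box q) : Module.End 𝕜 (Fock 𝕜 q) :=
  diffOp 𝕜 (pSym 𝕜 j k) (if (k.2 : ℕ) ≤ j.2 then 1 else 0) (j, k)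

variable {q} in
theorem xOp_comm (i k j l : Box q) : xOp 𝕜 i k * xOp 𝕜 j l = xOp 𝕜 j l * xOp 𝕜 i k := by
  rw [xOp, xOp, diffOp_comm, add_eq_left]
  convert LinearMap.mulLeft_zero_eq_zero 𝕜 (Fock 𝕜 q)
  unfold xSym
  split_ifs with h1 h2 h2 <;> simp [MvPolynomial.pderiv_X, Pi.single_apply] <;>
    (rintro rfl rfl; omega)

variable {q} in
theorem pOp_comm (i k j l : Box q) : pOp 𝕜 i k * pOp 𝕜 j l = pOp 𝕜 j l * pOp 𝕜 i k := by
  rw [pOp, pOp, diffOp_comm, add_eq_left]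
  convert LinearMap.mulLeft_zero_eq_zero 𝕜 (Fock 𝕜 q)
  unfold pSym
  split_ifs with h1 h2 h2 <;> simp [MvPolynomial.pderiv_X, Pi.single_apply] <;>
    (rintro rfl rfl; omega)

variable {q} in
theorem pOp_xOp (j k i l : Box q) : pOp 𝕜 j k * xOp 𝕜 i l =
    xOp 𝕜 i l * pOp 𝕜 j k + if j = i ∧ k = l then 1 else 0 := by
  rw [pOp, xOp, diffOp_comm]
  congr 1
  have : (if j = i ∧ k = l then 1 else 0 : Module.End 𝕜 (Fock 𝕜 q)) =
      LinearMap.mulLeft 𝕜 (if j = i ∧ k = l then 1 else 0 : Fock 𝕜 q) := by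
    split_ifs
    · rw [LinearMap.mulLeft_one]; rfl
    · rw [LinearMap.mulLeft_zero_eq_zero]
  rw [this]
  congr 1
  unfold pSym xSym
  by_cases h : j = i ∧ k = l
  · obtain ⟨rfl, rfl⟩ := h
    split_ifs <;> simp_all
  · have h' : ¬ (i = j ∧ l = k) := fun h' => h ⟨h'.1.symm, h'.2.symm⟩
    split_ifs <;> simp_all [MvPolynomial.pderiv_X]

variable {q} in
/-- The action of the matrix unit from `j` to `i`. -/
noncomputable def unitOp (i j : Box q) : Module.End 𝕜 (Fock 𝕜 q) := ∑ k, xOp 𝕜 i k * pOp 𝕜 j k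

theorem unitOp_comm (i j l n : Box q) :
    unitOp 𝕜 i j * unitOp 𝕜 l n - unitOp 𝕜 l n * unitOp 𝕜 i j =
      (if j = l then unitOp 𝕜 i n else 0) - (if n = i then unitOp 𝕜 l j else 0) :=
  oscillator_comm (xOp_comm 𝕜) (pOp_comm 𝕜) (pOp_xOp 𝕜) i j l n

noncomputable instance fockEndLieRing : LieRing (Module.End 𝕜 (Fock 𝕜 q)) :=
  LieRing.ofAssociativeRing

noncomputable instance fockEndLieAlgebra : LieAlgebra 𝕜 (Module.End 𝕜 (Fock 𝕜 q)) :=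
  LieAlgebra.ofAssociativeAlgebra

variable {q} in
/-- The linear map underlying the oscillator representation. -/
noncomputable def oscLin : gl 𝕜 q →ₗ[𝕜] Module.End 𝕜 (Fock 𝕜 q) where
  toFun a := ∑ i, ∑ j, a i j • unitOp 𝕜 i j
  map_add' a b := by simp only [Matrix.add_apply, add_smul, Finset.sum_add_distrib]
  map_smul' c a := by simp only [Matrix.smul_apply, smul_assoc, Finset.smul_sum, RingHom.id_apply]

variable {q} in
theorem oscLin_single (i j : Box q) (c : 𝕜) :
    oscLin 𝕜 (Matrix.single i j c) = c • unitOp 𝕜 i j := by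
  change ∑ k, ∑ l, Matrix.single i j c k l • unitOp 𝕜 k l = _
  rw [Finset.sum_eq_single i, Finset.sum_eq_single j]
  · simp
  · intro l _ h
    simp [h.symm]
  · simp
  · intro l _ h
    simp [h.symm]
  · simp

variable {q} in
theorem oscLin_lie (a b : gl 𝕜 q) :
    oscLin 𝕜 (a * b - b * a) = oscLin 𝕜 a * oscLin 𝕜 b - oscLin 𝕜 b * oscLin 𝕜 a := by
  induction a using Matrix.induction_on' with
  | h_zero => simp
  | h_add a a' h h' =>
    rw [add_mul, mul_add, add_sub_add_comm, map_add, h, h', map_add, add_mul, mul_add]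
    abel
  | h_std_basis i j x =>
    induction b using Matrix.induction_on' with
    | h_zero => simp
    | h_add b b' h h' =>
      rw [add_mul, mul_add, add_sub_add_comm, map_add, h, h', map_add, add_mul, mul_add]
      abel
    | h_std_basis l n y =>
      rw [oscLin_single, oscLin_single, smul_mul_smul_comm, smul_mul_smul_comm, mul_comm y x,
        ← smul_sub, unitOp_comm, map_sub, smul_sub]
      congr 1
      · split_ifs with h
        · subst h
          rw [Matrix.single_mul_single_same, oscLin_single]
        · rw [Matrix.single_mul_single_of_ne _ _ _ _ h]
          simp
      · split_ifs with h
        · subst h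
          rw [Matrix.single_mul_single_same, oscLin_single, mul_comm]
        · rw [Matrix.single_mul_single_of_ne _ _ _ _ h]
          simp

/-- The oscillator representation. -/
noncomputable def oscRep : Ug 𝕜 q →ₐ[𝕜] Module.End 𝕜 (Fock 𝕜 q) :=
  UniversalEnvelopingAlgebra.lift 𝕜 { oscLin 𝕜 with map_lie' := oscLin_lie 𝕜 _ _ }

theorem oscRep_inc (a : gl 𝕜 q) : oscRep 𝕜 q (inc 𝕜 q a) = oscLin 𝕜 a := by
  exact UniversalEnvelopingAlgebra.lift_ι_apply 𝕜 _ a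

/-- The weight of a variable. -/
def fockWeight (v : Box q × Box q) : ℤ :=
  if (v.2.2 : ℕ) ≤ v.1.2 then ((v.1.2 : ℕ) : ℤ) - (v.2.2 : ℕ) + 1
  else ((v.2.2 : ℕ) : ℤ) - (v.1.2 : ℕ)

/-- The polynomials of weighted degree at most `Δ`. -/
noncomputable def fockLE (Δ : ℤ) : Submodule 𝕜 (Fock 𝕜 q) :=
  Submodule.span 𝕜 {f | ∃ n ≤ Δ, MvPolynomial.IsWeightedHomogeneous (fockWeight q) f n}

variable {q}

theorem fockLE_mono {Δ Δ' : ℤ} (h : Δ ≤ Δ') : fockLE 𝕜 q Δ ≤ fockLE 𝕜 q Δ' :=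
  Submodule.span_mono fun _ ⟨n, hn, hf⟩ => ⟨n, hn.trans h, hf⟩

variable {𝕜} in
theorem mem_fockLE_of_homogeneous {f : Fock 𝕜 q} {n Δ : ℤ}
    (hf : MvPolynomial.IsWeightedHomogeneous (fockWeight q) f n) (h : n ≤ Δ) : f ∈ fockLE 𝕜 q Δ :=
  Submodule.subset_span ⟨n, h, hf⟩

variable {𝕜} in
theorem eq_zero_of_mem_fockLE {f : Fock 𝕜 q} {Δ : ℤ}
    (hf : MvPolynomial.IsWeightedHomogeneous (fockWeight q) f Δ) (h : f ∈ fockLE 𝕜 q (Δ - 1)) :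
    f = 0 := by
  have h1 : ∀ g ∈ fockLE 𝕜 q (Δ - 1),
      MvPolynomial.weightedHomogeneousComponent (fockWeight q) Δ g = 0 := by
    intro g hg
    induction hg using Submodule.span_induction with
    | mem g hg =>
      obtain ⟨n, hn, hg⟩ := hg
      exact MvPolynomial.IsWeightedHomogeneous.weightedHomogeneousComponent_ne _ hg (by omega)
    | zero => simp
    | add g g' _ _ h h' => rw [map_add, h, h', add_zero]
    | smul c g _ h => rw [map_smul, h, smul_zero]
  rw [← hf.weightedHomogeneousComponent_same, h1 f h]

variable {𝕜} in
theorem mul_mem_fockLE {f g : Fock 𝕜 q} {n Δ : ℤ}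
    (hf : MvPolynomial.IsWeightedHomogeneous (fockWeight q) f n) (hg : g ∈ fockLE 𝕜 q Δ) :
    f * g ∈ fockLE 𝕜 q (n + Δ) := by
  induction hg using Submodule.span_induction with
  | mem g hg =>
    obtain ⟨m, hm, hg⟩ := hg
    exact mem_fockLE_of_homogeneous (hf.mul hg) (by omega)
  | zero => simp
  | add g g' _ _ h h' => rw [mul_add]; exact add_mem h h'
  | smul c g _ h => rw [mul_smul_comm]; exact Submodule.smul_mem _ _ h

variable {𝕜} in
theorem pderiv_mem_fockLE {g : Fock 𝕜 q} {Δ : ℤ} (v : Box q × Box q) (hg : g ∈ fockLE 𝕜 q Δ) :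
    MvPolynomial.pderiv v g ∈ fockLE 𝕜 q (Δ - fockWeight q v) := by
  induction hg using Submodule.span_induction with
  | mem g hg =>
    obtain ⟨m, hm, hg⟩ := hg
    exact mem_fockLE_of_homogeneous (hg.pderiv (n' := m - fockWeight q v) (by omega)) (by omega)
  | zero => simp
  | add g g' _ _ h h' => rw [map_add]; exact add_mem h h'
  | smul c g _ h => rw [Derivation.map_smul]; exact Submodule.smul_mem _ _ h

theorem xSym_homogeneous (i k : Box q) :
    MvPolynomial.IsWeightedHomogeneous (fockWeight q) (xSym 𝕜 i k)
      (((i.2 : ℕ) : ℤ) - (k.2 : ℕ) + 1) := by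
  unfold xSym
  split_ifs with h
  · convert MvPolynomial.isWeightedHomogeneous_X 𝕜 (fockWeight q) (i, k) using 1
    simp [fockWeight, h]
  · by_cases h' : (k.2 : ℕ) = i.2 + 1
    · convert MvPolynomial.isWeightedHomogeneous_C (fockWeight q) _ using 1
      omega
    · convert MvPolynomial.isWeightedHomogeneous_zero 𝕜 (fockWeight q) _
      simp [F, h']

theorem pSym_homogeneous (j k : Box q) :
    MvPolynomial.IsWeightedHomogeneous (fockWeight q) (pSym 𝕜 j k)
      (((k.2 : ℕ) : ℤ) - (j.2 : ℕ)) := by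
  unfold pSym
  split_ifs with h h'
  · subst h'
    convert MvPolynomial.isWeightedHomogeneous_C (fockWeight q) _ using 1
    omega
  · rw [MvPolynomial.C_0]
    exact MvPolynomial.isWeightedHomogeneous_zero 𝕜 (fockWeight q) _
  · convert MvPolynomial.isWeightedHomogeneous_X 𝕜 (fockWeight q) (j, k) using 1
    simp [fockWeight, h]

variable {𝕜} in
-- The weights are chosen so that the derivative shifts the weight by one less than multiplication
-- by the symbol does. An operator thus equals its symbol up to lower filtration.
theorem xOp_sub_mem {g : Fock 𝕜 q} {Δ : ℤ} (i k : Box q) (hg : g ∈ fockLE 𝕜 q Δ) :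
    xOp 𝕜 i k g - xSym 𝕜 i k * g ∈ fockLE 𝕜 q (((i.2 : ℕ) : ℤ) - (k.2 : ℕ) + Δ) := by
  have h1 : xOp 𝕜 i k g - xSym 𝕜 i k * g =
      (if (k.2 : ℕ) ≤ i.2 then 0 else -1 : 𝕜) • MvPolynomial.pderiv (i, k) g := by
    simp only [xOp, diffOp, LinearMap.add_apply, LinearMap.mulLeft_apply, LinearMap.smul_apply,
      add_sub_cancel_left, Derivation.coeFn_coe]
  rw [h1]
  split_ifs with h
  · simp
  · refine Submodule.smul_mem _ _ (fockLE_mono 𝕜 ?_ (pderiv_mem_fockLE (i, k) hg))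
    simp [fockWeight, h]
    omega

variable {𝕜} in
theorem pOp_sub_mem {g : Fock 𝕜 q} {Δ : ℤ} (j k : Box q) (hg : g ∈ fockLE 𝕜 q Δ) :
    pOp 𝕜 j k g - pSym 𝕜 j k * g ∈ fockLE 𝕜 q (((k.2 : ℕ) : ℤ) - (j.2 : ℕ) - 1 + Δ) := by
  have h1 : pOp 𝕜 j k g - pSym 𝕜 j k * g =
      (if (k.2 : ℕ) ≤ j.2 then 1 else 0 : 𝕜) • MvPolynomial.pderiv (j, k) g := by
    simp only [pOp, diffOp, LinearMap.add_apply, LinearMap.mulLeft_apply, LinearMap.smul_apply,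
      add_sub_cancel_left, Derivation.coeFn_coe]
  rw [h1]
  split_ifs with h
  · refine Submodule.smul_mem _ _ (fockLE_mono 𝕜 ?_ (pderiv_mem_fockLE (j, k) hg))
    simp [fockWeight, h]
    omega
  · simp

variable (q) in
/-- The symbol of the oscillator representation on `𝔤`. -/
noncomputable def symLin : gl 𝕜 q →ₗ[𝕜] Fock 𝕜 q where
  toFun a := ∑ i, ∑ j, a i j • ∑ k, xSym 𝕜 i k * pSym 𝕜 j k
  map_add' a b := by simp only [Matrix.add_apply, add_smul, Finset.sum_add_distrib]
  map_smul' c a := by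
    simp only [Matrix.smul_apply, smul_assoc, Finset.smul_sum, RingHom.id_apply]

variable {𝕜} in
theorem symLin_homogeneous {j : ℤ} {a : gl 𝕜 q} (ha : a ∈ grade 𝕜 q j) :
    MvPolynomial.IsWeightedHomogeneous (fockWeight q) (symLin 𝕜 q a) (1 - j) := by
  refine sum_mem (S := MvPolynomial.weightedHomogeneousSubmodule 𝕜 (fockWeight q) (1 - j))
    fun i _ => sum_mem fun l _ => ?_
  by_cases h : deg i l = j
  · refine Submodule.smul_mem _ _ (sum_mem fun k _ => ?_)
    rw [MvPolynomial.mem_weightedHomogeneousSubmodule]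
    convert (xSym_homogeneous 𝕜 i k).mul (pSym_homogeneous 𝕜 l k) using 1
    rw [← h, deg]
    ring
  · rw [ha i l h, zero_smul]
    exact zero_mem _

variable {𝕜} in
theorem oscLin_sub_mem {j Δ : ℤ} {a : gl 𝕜 q} (ha : a ∈ grade 𝕜 q j) {g : Fock 𝕜 q}
    (hg : g ∈ fockLE 𝕜 q Δ) : oscLin 𝕜 a g - symLin 𝕜 q a * g ∈ fockLE 𝕜 q (Δ - j) := by
  have h1 : oscLin 𝕜 a g - symLin 𝕜 q a * g = ∑ i, ∑ l, a i l • ∑ k,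
      (xOp 𝕜 i k (pOp 𝕜 l k g) - xSym 𝕜 i k * pSym 𝕜 l k * g) := by
    simp only [oscLin, symLin, unitOp, LinearMap.coe_mk, AddHom.coe_mk, LinearMap.sum_apply,
      LinearMap.smul_apply, Module.End.mul_apply, Finset.sum_mul, Finset.sum_sub_distrib, smul_sub,
      smul_mul_assoc]
  rw [h1]
  refine sum_mem fun i _ => sum_mem fun l _ => ?_
  by_cases h : deg i l = j
  · refine Submodule.smul_mem _ _ (sum_mem fun k _ => ?_)
    have h2 := pOp_sub_mem l k hg
    have h3 : pOp 𝕜 l k g ∈ fockLE 𝕜 q (((k.2 : ℕ) : ℤ) - (l.2 : ℕ) + Δ) := by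
      rw [← sub_add_cancel (pOp 𝕜 l k g) (pSym 𝕜 l k * g)]
      exact add_mem (fockLE_mono 𝕜 (by omega) h2) (mul_mem_fockLE (pSym_homogeneous 𝕜 l k) hg)
    have h4 : xOp 𝕜 i k (pOp 𝕜 l k g) - xSym 𝕜 i k * pSym 𝕜 l k * g =
        (xOp 𝕜 i k (pOp 𝕜 l k g) - xSym 𝕜 i k * pOp 𝕜 l k g) +
          xSym 𝕜 i k * (pOp 𝕜 l k g - pSym 𝕜 l k * g) := by ring
    rw [h4]
    unfold deg at h
    exact add_mem (fockLE_mono 𝕜 (by omega) (xOp_sub_mem i k h3))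
      (fockLE_mono 𝕜 (by omega) (mul_mem_fockLE (xSym_homogeneous 𝕜 i k) h2))
  · rw [ha i l h, zero_smul]
    exact zero_mem _

variable (q) in
/-- The symbol of the oscillator representation. -/
noncomputable def fockSym : Sg 𝕜 q →ₐ[𝕜] Fock 𝕜 q := SymmetricAlgebra.lift (symLin 𝕜 q)

variable {𝕜} in
-- The associated graded of `u ↦ u · 1` is the algebra homomorphism `fockSym`: factor by factor,
-- each element of `𝔤` acts by its symbol up to lower weight.
theorem oscRep_prod (l : List (ℤ × gl 𝕜 q)) (hl : ∀ p ∈ l, p.2 ∈ grade 𝕜 q p.1) :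
    MvPolynomial.IsWeightedHomogeneous (fockWeight q)
      (fockSym 𝕜 q (l.map fun p => SymmetricAlgebra.ι 𝕜 (gl 𝕜 q) p.2).prod)
      (l.map fun p => 1 - p.1).sum ∧
    oscRep 𝕜 q (l.map fun p => inc 𝕜 q p.2).prod 1 -
      fockSym 𝕜 q (l.map fun p => SymmetricAlgebra.ι 𝕜 (gl 𝕜 q) p.2).prod ∈
        fockLE 𝕜 q ((l.map fun p => 1 - p.1).sum - 1) := by
  induction l with
  | nil =>
    simp [MvPolynomial.isWeightedHomogeneous_one]
  | cons p l ih =>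
    obtain ⟨h1, h2⟩ := ih fun x hx => hl x (List.mem_cons_of_mem _ hx)
    have hp := hl p List.mem_cons_self
    simp only [List.map_cons, List.prod_cons, List.sum_cons, map_mul, oscRep_inc,
      Module.End.mul_apply]
    rw [fockSym, SymmetricAlgebra.lift_ι_apply, ← fockSym]
    refine ⟨(symLin_homogeneous hp).mul h1, ?_⟩
    set P := oscRep 𝕜 q (l.map fun p => inc 𝕜 q p.2).prod 1
    set s := fockSym 𝕜 q (l.map fun p => SymmetricAlgebra.ι 𝕜 (gl 𝕜 q) p.2).prod
    have h3 : P ∈ fockLE 𝕜 q (l.map fun p => 1 - p.1).sum := by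
      rw [← sub_add_cancel P s]
      exact add_mem (fockLE_mono 𝕜 (by omega) h2) (mem_fockLE_of_homogeneous h1 le_rfl)
    have h4 : oscLin 𝕜 p.2 P - symLin 𝕜 q p.2 * s =
        (oscLin 𝕜 p.2 P - symLin 𝕜 q p.2 * P) + symLin 𝕜 q p.2 * (P - s) := by ring
    rw [h4]
    exact add_mem (fockLE_mono 𝕜 (by omega) (oscLin_sub_mem hp h3))
      (fockLE_mono 𝕜 (by omega) (mul_mem_fockLE (symLin_homogeneous hp) h2))

variable {𝕜} in
theorem oscRep_symbolPairs {Δ : ℤ} {x : Ug 𝕜 q × Sg 𝕜 q} (hx : x ∈ symbolPairs 𝕜 q Δ) :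
    MvPolynomial.IsWeightedHomogeneous (fockWeight q) (fockSym 𝕜 q x.2) Δ ∧
      oscRep 𝕜 q x.1 1 - fockSym 𝕜 q x.2 ∈ fockLE 𝕜 q (Δ - 1) := by
  induction hx using Submodule.span_induction with
  | mem x hx =>
    obtain ⟨l, hl, rfl, rfl⟩ := hx
    exact oscRep_prod l hl
  | zero => simpa using MvPolynomial.isWeightedHomogeneous_zero 𝕜 (fockWeight q) Δ
  | add x y _ _ h h' =>
    simp only [Prod.fst_add, Prod.snd_add, map_add, LinearMap.add_apply]
    refine ⟨h.1.add h'.1, ?_⟩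
    rw [add_sub_add_comm]
    exact add_mem h.2 h'.2
  | smul c x _ h =>
    simp only [Prod.smul_fst, Prod.smul_snd, map_smul, LinearMap.smul_apply]
    rw [← smul_sub]
    exact ⟨Submodule.smul_mem (MvPolynomial.weightedHomogeneousSubmodule 𝕜 _ _) c h.1,
      Submodule.smul_mem _ _ h.2⟩

variable {𝕜} in
theorem oscRep_kazhdan {Δ : ℤ} {u : Ug 𝕜 q} (hu : u ∈ kazhdan 𝕜 q Δ) :
    oscRep 𝕜 q u 1 ∈ fockLE 𝕜 q Δ := by
  induction hu using Submodule.span_induction with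
  | mem u hu =>
    obtain ⟨l, hl, hΔ, rfl⟩ := hu
    obtain ⟨h1, h2⟩ := oscRep_prod l hl
    refine fockLE_mono 𝕜 hΔ ?_
    rw [← sub_add_cancel (oscRep 𝕜 q _ 1)]
    exact add_mem (fockLE_mono 𝕜 (by omega) h2) (mem_fockLE_of_homogeneous h1 le_rfl)
  | zero => simp
  | add x y _ _ h h' =>
    rw [map_add, LinearMap.add_apply]
    exact add_mem h h'
  | smul c x _ h =>
    rw [map_smul, LinearMap.smul_apply]
    exact Submodule.smul_mem _ _ h

variable {𝕜} in
theorem apply_eq_zero_of_mem_gePos {b : gl 𝕜 q} (hb : b ∈ gePos 𝕜 q) {i j : Box q}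
    (h : (j.2 : ℕ) ≤ i.2) : b i j = 0 := by
  have h1 : gePos 𝕜 q ≤ LinearMap.ker (Matrix.entryLinearMap 𝕜 𝕜 i j) := by
    refine iSup_le fun m a ha => ha i j ?_
    have := m.2
    unfold deg
    omega
  exact h1 hb

/-- The vacuum is a Whittaker vector. Only `k = j` contributes: `p j k` kills `1` for the other `k`
weakly to the right of `j`, and for `k` to the left of `j` the entry `F k i` is zero and the
derivative in `(i, k)` kills the variable `(j, k)`. -/
theorem unitOp_one {i j : Box q} (h : (i.2 : ℕ) < j.2) :
    unitOp 𝕜 i j 1 = MvPolynomial.C (F 𝕜 q j i) := by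
  have hij : i ≠ j := by rintro rfl; omega
  rw [unitOp, LinearMap.sum_apply, Finset.sum_eq_single j]
  · simp [xOp, pOp, diffOp, xSym, pSym, h.not_ge]
  · intro k _ hk
    by_cases hkj : (k.2 : ℕ) ≤ j.2
    · simp [pOp, diffOp, pSym, hkj, hk.symm]
    · have hki : ¬ (k.2 : ℕ) ≤ i.2 := by omega
      have hF : F 𝕜 q k i = 0 := by
        simp only [F, Matrix.of_apply, ite_eq_right_iff]
        omega
      simp [pOp, xOp, diffOp, pSym, xSym, hkj, hki, hF, MvPolynomial.pderiv_X, hij.symm]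
  · simp

theorem trace_F_single (i j : Box q) (c : 𝕜) :
    Matrix.trace (F 𝕜 q * Matrix.single i j c) = F 𝕜 q j i * c := by
  simp [Matrix.trace_mul_single]

variable {𝕜} in
theorem oscRep_leftIdeal {u : Ug 𝕜 q} (hu : u ∈ leftIdeal 𝕜 q) : oscRep 𝕜 q u 1 = 0 := by
  induction hu using Submodule.span_induction with
  | mem u hu =>
    obtain ⟨b, hb, rfl⟩ := hu
    rw [map_sub, oscRep_inc, AlgHom.commutes, LinearMap.sub_apply, Module.algebraMap_end_apply,
      sub_eq_zero]
    have h1 : Matrix.trace (F 𝕜 q * b) = ∑ i, ∑ j, b i j * F 𝕜 q j i := by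
      simp only [Matrix.trace, Matrix.diag_apply, Matrix.mul_apply]
      rw [Finset.sum_comm]
      simp only [mul_comm]
    simp only [oscLin, LinearMap.coe_mk, AddHom.coe_mk, LinearMap.sum_apply, LinearMap.smul_apply]
    rw [h1, Finset.sum_smul]
    refine Finset.sum_congr rfl fun i _ => ?_
    rw [Finset.sum_smul]
    refine Finset.sum_congr rfl fun j _ => ?_
    by_cases h : (i.2 : ℕ) < j.2
    · rw [unitOp_one 𝕜 h, MvPolynomial.smul_eq_C_mul, MvPolynomial.smul_eq_C_mul, map_mul, mul_one]
    · rw [apply_eq_zero_of_mem_gePos hb (by omega)]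
      simp
  | zero => simp
  | add x y _ _ h h' => rw [map_add, LinearMap.add_apply, h, h', add_zero]
  | smul c x _ h => rw [smul_eq_mul, map_mul, Module.End.mul_apply, h, map_zero]

/-- An algebra homomorphism from the symmetric algebra of `𝔤` that sends `b ∈ 𝔤[≥ 1]` to `(f|b)`
is well defined on the associated graded of `U(𝔤)/ℐ`. -/
theorem eq_zero_of_isSymbol_zero {B : Type*} [CommRing B] [Algebra 𝕜 B] (f : Sg 𝕜 q →ₐ[𝕜] B)
    (hf : ∀ i j : Box q, (i.2 : ℕ) < j.2 →
      f (SymmetricAlgebra.ι 𝕜 (gl 𝕜 q) (Matrix.single i j 1)) = algebraMap 𝕜 B (F 𝕜 q j i))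
    {Δ : ℤ} {s : Sg 𝕜 q} (hs : IsSymbol 𝕜 q Δ 0 s) : f s = 0 := by
  obtain ⟨u, hus, hu⟩ := hs
  obtain ⟨h1, h2⟩ := oscRep_symbolPairs hus
  rw [zero_sub, neg_mem_iff] at hu
  obtain ⟨v, hv, hvu⟩ := hu
  have h3 : v - u ∈ leftIdeal 𝕜 q := (Submodule.Quotient.eq _).1 hvu
  have h4 := oscRep_leftIdeal h3
  rw [map_sub, LinearMap.sub_apply, sub_eq_zero] at h4
  -- On the vacuum `u` acts like `v`, which has filtration `Δ - 1`; so a polynomial homogeneous of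
  -- weight `Δ` lies in lower filtration and vanishes.
  have h5 : fockSym 𝕜 q s = 0 := by
    refine eq_zero_of_mem_fockLE h1 ?_
    have h6 : fockSym 𝕜 q s = oscRep 𝕜 q v 1 - (oscRep 𝕜 q u 1 - fockSym 𝕜 q s) := by
      rw [h4]; ring
    rw [h6]
    exact sub_mem (oscRep_kazhdan hv) h2
  -- Specializing the variables of the `x` oscillators to values of `f`, and those of the `p`
  -- oscillators to zero, recovers `f` from `fockSym`.
  let θ : Fock 𝕜 q →ₐ[𝕜] B := MvPolynomial.aeval fun v =>
    if (v.2.2 : ℕ) ≤ v.1.2 then f (SymmetricAlgebra.ι 𝕜 (gl 𝕜 q) (Matrix.single v.1 v.2 1)) else 0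
  have h7 : θ.comp (fockSym 𝕜 q) = f := by
    refine SymmetricAlgebra.algHom_ext (Matrix.ext_linearMap _ fun i j => ?_)
    refine LinearMap.ext_ring ?_
    change θ (fockSym 𝕜 q (SymmetricAlgebra.ι 𝕜 (gl 𝕜 q) (Matrix.single i j 1))) =
      f (SymmetricAlgebra.ι 𝕜 (gl 𝕜 q) (Matrix.single i j 1))
    have hp : ∀ k, θ (pSym 𝕜 j k) = if j = k then 1 else 0 := by
      intro k
      by_cases hk : (k.2 : ℕ) ≤ j.2
      · simp only [pSym, hk, if_true, θ]
        split_ifs <;> simp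
      · have : j ≠ k := by rintro rfl; omega
        simp [pSym, hk, θ, this]
    have hs' : symLin 𝕜 q (Matrix.single i j 1) = ∑ k, xSym 𝕜 i k * pSym 𝕜 j k := by
      change ∑ k, ∑ l, Matrix.single i j (1 : 𝕜) k l • ∑ n, xSym 𝕜 k n * pSym 𝕜 l n = _
      rw [Finset.sum_eq_single i, Finset.sum_eq_single j]
      · simp
      · intro l _ h
        simp [h.symm]
      · simp
      · intro l _ h
        simp [h.symm]
      · simp
    rw [fockSym, SymmetricAlgebra.lift_ι_apply, hs', map_sum]
    simp only [map_mul, hp, mul_ite, mul_one, mul_zero, Finset.sum_ite_eq, Finset.mem_univ, if_true]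
    by_cases h : (j.2 : ℕ) ≤ i.2
    · simp [xSym, h, θ]
    · rw [hf i j (by omega)]
      simp [xSym, h, θ]
  rw [← h7, AlgHom.comp_apply, h5, map_zero]

end Fock

/-! ### Commutators as derivations. -/

section Commutator

variable {R : Type*} [Ring R]

/-- The commutator with `a`, as an additive map. -/
def ad (a : R) : R →+ R := AddMonoidHom.mulLeft a - AddMonoidHom.mulRight a

theorem ad_apply (a b : R) : ad a b = a * b - b * a := rfl

theorem ad_mul (a b c : R) : ad a (b * c) = ad a b * c + b * ad a c := by
  simp only [ad_apply]
  noncomm_ring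

theorem ad_C_C (a b : R) : ad (C a) (C b) = C (a * b - b * a) := by
  simp [ad_apply]

theorem ad_X (a : R) : ad (C a) X = 0 := by
  rw [ad_apply, X_mul_C, sub_self]

theorem coeff_ad_C (a : R) (p : R[X]) (n : ℕ) : (ad (C a) p).coeff n = ad a (p.coeff n) := by
  simp [ad_apply]

theorem ad_C_coeff (a : R) (p : R[X]) (n : ℕ) :
    ad (C a) (C (p.coeff n)) = C ((ad (C a) p).coeff n) := by
  rw [coeff_ad_C, ad_C_C, ad_apply]

theorem ad_ad (a b c : R) : ad (ad a b) c = ad a (ad b c) - ad b (ad a c) := by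
  simp only [ad_apply]
  noncomm_ring

end Commutator

/-! ### Brackets of matrix units with `T` and `Q`. -/

section Relations

variable {A : Type*} [Ring A] {q : Fin r → ℕ} {g : Fin r × ℕ → Fin r × ℕ → A} (d : ℕ → ℕ)

variable (q g) in
/-- The commutation relations of the matrix units. -/
structure IsUnitSystem : Prop where
  eq_zero : ∀ x y, q y.1 ≤ y.2 → g x y = 0
  eq_zero_left : ∀ x y, q x.1 ≤ x.2 → g x y = 0
  comm : ∀ x y z w, g x y * g z w - g z w * g x y =
    (if y = z ∧ y.2 < q y.1 then g x w else 0) - if w = x ∧ x.2 < q x.1 then g z y else 0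

theorem ad_Q_of_forall {n : ℕ} {i : Fin r} {c u v : Fin r × ℕ}
    (hQ : ad (C (g u v)) (Q q d g n i c) = 0) (hT : ∀ h, ad (C (g u v)) (T q d g n i h) = 0) :
    ad (C (g u v)) (Q q d g (n + 1) i c) =
      - ∑ h, T q d g n i h * C (g u v * g c (h, n) - g c (h, n) * g u v) := by
  rw [Q_succ, map_sub, hQ, map_sum, zero_sub]
  simp only [ad_mul, hT, zero_mul, zero_add, ad_C_C]

theorem ad_T_of_forall {n : ℕ} {i j : Fin r} {u v : Fin r × ℕ} (hj : n < q j)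
    (hT : ∀ i h, ad (C (g u v)) (T q d g n i h) = 0) :
    ad (C (g u v)) (T q d g (n + 1) i j) = ad (C (g u v)) (Q q d g (n + 1) i (j, n)) := by
  rw [T_succ_of_lt q d g hj]
  simp only [map_sub, map_add, map_sum, map_nsmul, ad_mul, ad_X, hT, mul_zero, zero_mul, add_zero,
    smul_zero, sub_zero, sub_eq_self]
  refine Finset.sum_eq_zero fun h _ => ?_
  split_ifs
  · simp only [map_zsmul, ad_mul, hT, ad_C_coeff, coeff_zero, C_0, mul_zero, zero_mul, add_zero,
      smul_zero]
  · rw [map_zero]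

variable (hg : IsUnitSystem q g)

include hg

/-- `T n` is built from units between the `n` rightmost columns, and `Q n i c` involves besides
these only units from such columns to `c`. The bracket with `g u v` can therefore only contract `v`
with `c`. -/
theorem ad_T_Q_eq_zero (n : ℕ) {u v : Fin r × ℕ} (hu : n ≤ u.2) (hv : n ≤ v.2) :
    (∀ i j, ad (C (g u v)) (T q d g n i j) = 0) ∧
      ∀ i c, v ≠ c → ad (C (g u v)) (Q q d g n i c) = 0 := by
  induction n with
  | zero =>
    refine ⟨fun i j => ?_, fun i c _ => by rw [Q_zero, map_zero]⟩
    rw [T_zero]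
    split_ifs <;> simp [ad_apply]
  | succ n ih =>
    obtain ⟨ihT, ihQ⟩ := ih (by omega) (by omega)
    have hQ : ∀ i c, v ≠ c → ad (C (g u v)) (Q q d g (n + 1) i c) = 0 := by
      intro i c hc
      rw [ad_Q_of_forall d (ihQ i c hc) (ihT i), neg_eq_zero]
      refine Finset.sum_eq_zero fun h _ => ?_
      rw [hg.comm, if_neg (by tauto), if_neg, sub_zero, C_0, mul_zero]
      rintro ⟨rfl, -⟩
      simp at hu
    refine ⟨fun i j => ?_, hQ⟩
    by_cases hj : n < q j
    · rw [ad_T_of_forall d hj ihT, hQ]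
      rintro rfl
      simp at hv
    · rw [T_succ_of_le q d g (not_lt.1 hj), ihT]

theorem ad_T_eq_zero {n : ℕ} {u v : Fin r × ℕ} (hu : n ≤ u.2) (hv : n ≤ v.2) (i j : Fin r) :
    ad (C (g u v)) (T q d g n i j) = 0 :=
  (ad_T_Q_eq_zero d hg n hu hv).1 i j

theorem ad_Q_eq_zero {n : ℕ} {u v : Fin r × ℕ} (hu : n ≤ u.2) (hv : n ≤ v.2) (i : Fin r)
    {c : Fin r × ℕ} (hc : v ≠ c) : ad (C (g u v)) (Q q d g n i c) = 0 :=
  (ad_T_Q_eq_zero d hg n hu hv).2 i c hc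

/-- Only the last summand of `Q_succ` is affected, by contracting `(h, n)` with `(l, n)`. -/
theorem ad_Q_succ {n : ℕ} {l : Fin r} {v c : Fin r × ℕ} (hl : n < q l) (hv : n ≤ v.2)
    (hc : v ≠ c) (i : Fin r) :
    ad (C (g (l, n) v)) (Q q d g (n + 1) i c) = T q d g n i l * C (g c v) := by
  rw [ad_Q_of_forall d (ad_Q_eq_zero d hg le_rfl hv i hc) (ad_T_eq_zero d hg le_rfl hv i),
    Finset.sum_eq_single l]
  · rw [hg.comm, if_neg (by tauto), if_pos ⟨rfl, hl⟩]
    simp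
  · intro h _ hh
    rw [hg.comm, if_neg (by tauto), if_neg (by simp [hh])]
    simp
  · simp

theorem ad_T_succ {n : ℕ} {l : Fin r} {v : Fin r × ℕ} (hl : n < q l) (hv : n + 1 ≤ v.2)
    (i j : Fin r) :
    ad (C (g (l, n) v)) (T q d g (n + 1) i j) =
      if n < q j then T q d g n i l * C (g (j, n) v) else 0 := by
  split_ifs with hj
  · rw [ad_T_of_forall d hj (ad_T_eq_zero d hg le_rfl (by omega)),
      ad_Q_succ d hg hl (by omega)]
    rintro rfl
    simp at hv
  · rw [T_succ_of_le q d g (not_lt.1 hj), ad_T_eq_zero d hg le_rfl (by omega)]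

/-- Each term of `Q n i b` is linear in a unit `g b x`, and `[g c b, g b x] = g c x` because `x`
lies to the right of `c`. This is why the bracket with `E_{-1}` produces the entries for the new
column. -/
theorem ad_Q_replace {n : ℕ} {b c : Fin r × ℕ} (hb : b.2 < q b.1) (hn : n ≤ b.2 + 1)
    (hc : n ≤ c.2) (i : Fin r) :
    ad (C (g c b)) (Q q d g n i b) = Q q d g n i c := by
  induction n with
  | zero => rw [Q_zero, Q_zero, map_zero]
  | succ n ih =>
    rw [Q_succ, map_sub, ih (by omega) (by omega), map_sum, Q_succ]
    congr 1
    refine Finset.sum_congr rfl fun h _ => ?_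
    rw [ad_mul, ad_T_eq_zero d hg (by omega) (by omega), ad_C_C, hg.comm, if_pos ⟨rfl, hb⟩, if_neg]
    · simp
    · rintro ⟨rfl, -⟩
      simp at hc

theorem ad_T_replace {n : ℕ} {k : Fin r} {c : Fin r × ℕ} (hk : n < q k) (hc : n + 1 ≤ c.2)
    (i : Fin r) : ad (C (g c (k, n))) (T q d g (n + 1) i k) = Q q d g (n + 1) i c := by
  rw [ad_T_of_forall d hk (ad_T_eq_zero d hg (by omega) (by simp)),
    ad_Q_replace d hg (by simpa using hk) (by simp) hc]

end Relations

/-! ### Invariance of `T` modulo the Whittaker left ideal. -/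

section Invariance

variable {A : Type*} [Ring A] {q : Fin r → ℕ} {g : Fin r × ℕ → Fin r × ℕ → A} (d : ℕ → ℕ)

/-- The condition that the box `v` is the left neighbour of the box `u`. -/
abbrev IsNext (u v : Fin r × ℕ) : Prop := u.1 = v.1 ∧ v.2 = u.2 + 1

variable (g) in
/-- The left ideal of polynomials defining the Whittaker module for the pyramid with `n` columns. -/
noncomputable def polyIdeal (n : ℕ) : Submodule A[X] A[X] :=
  Submodule.span A[X] {p | ∃ u v : Fin r × ℕ, u.2 < v.2 ∧ v.2 < n ∧ v.2 < q v.1 ∧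
    p = C (g u v) - if IsNext u v then 1 else 0}

theorem polyIdeal_mono {n m : ℕ} (h : n ≤ m) : polyIdeal (q := q) g n ≤ polyIdeal (q := q) g m :=
  Submodule.span_mono fun _ ⟨u, v, h1, h2, h3⟩ => ⟨u, v, h1, h2.trans_le h, h3⟩

theorem mul_left_mem_polyIdeal {n : ℕ} (c : A[X]) {p : A[X]} (hp : p ∈ polyIdeal (q := q) g n) :
    c * p ∈ polyIdeal (q := q) g n :=
  Submodule.smul_mem _ c hp

theorem ad_mem_polyIdeal {n : ℕ} {a : A[X]}
    (ha : ∀ u v : Fin r × ℕ, u.2 < v.2 → v.2 < n → v.2 < q v.1 →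
      ad a (C (g u v)) ∈ polyIdeal (q := q) g n)
    {p : A[X]} (hp : p ∈ polyIdeal (q := q) g n) : ad a p ∈ polyIdeal (q := q) g n := by
  induction hp using Submodule.span_induction with
  | mem p hp =>
    obtain ⟨u, v, h1, h2, h3, rfl⟩ := hp
    rw [map_sub]
    refine sub_mem (ha u v h1 h2 h3) ?_
    split_ifs <;> simp [ad_apply]
  | zero => simp
  | add x y _ _ hx hy => rw [map_add]; exact add_mem hx hy
  | smul c x hx h =>
    rw [smul_eq_mul, ad_mul]
    exact add_mem (Submodule.smul_mem _ _ hx) (Submodule.smul_mem _ _ h)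

/-- A left ideal absorbs right multiplication by `t` once the generators commute with `t` modulo the
ideal. This is the reason why products of invariants are invariant. -/
theorem mul_mem_polyIdeal {n : ℕ} {t : A[X]}
    (ht : ∀ u v : Fin r × ℕ, u.2 < v.2 → v.2 < n → ad (C (g u v)) t ∈ polyIdeal (q := q) g n)
    {p : A[X]} (hp : p ∈ polyIdeal (q := q) g n) : p * t ∈ polyIdeal (q := q) g n := by
  induction hp using Submodule.span_induction with
  | mem p hp =>
    obtain ⟨u, v, h1, h2, h3, rfl⟩ := hp
    have h4 : (C (g u v) - if IsNext u v then 1 else 0) * t =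
        t * (C (g u v) - if IsNext u v then 1 else 0) + ad (C (g u v)) t := by
      rw [ad_apply]
      split_ifs <;> noncomm_ring
    rw [h4]
    exact add_mem (Submodule.smul_mem _ t (Submodule.subset_span ⟨u, v, h1, h2, h3, rfl⟩))
      (ht u v h1 h2)
  | zero => simp
  | add x y _ _ hx hy => rw [add_mul]; exact add_mem hx hy
  | smul c x hx h =>
    rw [smul_eq_mul, mul_assoc]
    exact Submodule.smul_mem _ c h

/-- The generators are constant in `X`. Single coefficients are needed for the quadratic term of the
recursion. -/
theorem C_coeff_mem_polyIdeal {n : ℕ} {p : A[X]} (hp : p ∈ polyIdeal (q := q) g n) (k : ℕ) :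
    C (p.coeff k) ∈ polyIdeal (q := q) g n := by
  induction hp using Submodule.span_induction generalizing k with
  | mem p hp =>
    obtain ⟨u, v, h1, h2, h3, rfl⟩ := hp
    have h4 : (C (g u v) - if IsNext u v then 1 else 0 : A[X]) =
        C (g u v - if IsNext u v then 1 else 0) := by
      rw [C_sub]
      split_ifs <;> simp
    by_cases hk : k = 0
    · rw [hk, h4, coeff_C_zero, ← h4]
      exact Submodule.subset_span ⟨u, v, h1, h2, h3, rfl⟩
    · rw [h4, coeff_C_of_ne_zero hk, C_0]
      exact zero_mem _
  | zero => simp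
  | add x y _ _ hx hy => rw [coeff_add, C_add]; exact add_mem (hx k) (hy k)
  | smul c x hx h =>
    rw [smul_eq_mul, coeff_mul, map_sum]
    refine sum_mem fun i _ => ?_
    rw [C_mul]
    exact Submodule.smul_mem _ (C (c.coeff i.1)) (h i.2)

variable (hg : IsUnitSystem q g)

include hg

theorem C_sub_mem_polyIdeal {n : ℕ} {u v : Fin r × ℕ} (h1 : u.2 < v.2) (h2 : v.2 < n) :
    C (g u v) - (if IsNext u v ∧ v.2 < q v.1 then 1 else 0) ∈ polyIdeal (q := q) g n := by
  by_cases h3 : v.2 < q v.1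
  · refine Submodule.subset_span ⟨u, v, h1, h2, h3, ?_⟩
    simp [h3]
  · rw [hg.eq_zero _ _ (not_lt.1 h3), if_neg (by tauto)]
    simp

/-- The left ideal is stable under the adjoint action of the nilpotent subalgebra. -/
theorem ad_mem_polyIdeal_of_lt {n : ℕ} {x y : Fin r × ℕ} (h1 : x.2 < y.2) (h2 : y.2 < n)
    {p : A[X]} (hp : p ∈ polyIdeal (q := q) g n) :
    ad (C (g x y)) p ∈ polyIdeal (q := q) g n := by
  refine ad_mem_polyIdeal (fun u v h3 h4 _ => ?_) hp
  rw [ad_C_C, hg.comm, C_sub]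
  refine sub_mem ?_ ?_
  · split_ifs with h
    · obtain ⟨rfl, -⟩ := h
      have := C_sub_mem_polyIdeal hg (h1.trans h3) h4
      rwa [if_neg (by rintro ⟨⟨-, h⟩, -⟩; omega), sub_zero] at this
    · simp
  · split_ifs with h
    · obtain ⟨rfl, -⟩ := h
      have := C_sub_mem_polyIdeal hg (h3.trans h1) h2
      rwa [if_neg (by rintro ⟨⟨-, h⟩, -⟩; omega), sub_zero] at this
    · simp

/-- The left ideal is stable under the adjoint action of the matrix units from the leftmost column
to a new column. -/
theorem ad_mem_polyIdeal_of_ge {n : ℕ} {c b : Fin r × ℕ} (hc : n ≤ c.2) (hb : n ≤ b.2 + 1)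
    {p : A[X]} (hp : p ∈ polyIdeal (q := q) g n) :
    ad (C (g c b)) p ∈ polyIdeal (q := q) g n := by
  refine ad_mem_polyIdeal (fun u v h3 h4 _ => ?_) hp
  rw [ad_C_C, hg.comm, if_neg, if_neg]
  · simp
  · rintro ⟨rfl, -⟩
    omega
  · rintro ⟨rfl, -⟩
    omega

/-- Invariance of the new matrix entries under the old part of the nilpotent subalgebra. -/
theorem ad_T_mem_of_lt {n : ℕ} (hT : ∀ u v : Fin r × ℕ, u.2 < v.2 → v.2 < n + 1 → ∀ i j,
    ad (C (g u v)) (T q d g (n + 1) i j) ∈ polyIdeal (q := q) g (n + 1))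
    {u v : Fin r × ℕ} (h1 : u.2 < v.2) (h2 : v.2 < n + 1) (i j : Fin r) :
    ad (C (g u v)) (T q d g (n + 2) i j) ∈ polyIdeal (q := q) g (n + 1) := by
  by_cases hj : n + 1 < q j
  · have hz : ∀ b c : Fin r × ℕ, n ≤ b.2 → n + 1 ≤ c.2 → ad (C (g u v)) (C (g c b)) = 0 := by
      intro b c hb hc
      rw [ad_C_C, hg.comm, if_neg, if_neg]
      · simp
      · rintro ⟨rfl, -⟩
        omega
      · rintro ⟨rfl, -⟩
        omega
    have hm : ∀ {t p : A[X]}, (∀ u v : Fin r × ℕ, u.2 < v.2 → v.2 < n + 1 →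
        ad (C (g u v)) t ∈ polyIdeal (q := q) g (n + 1)) → p ∈ polyIdeal (q := q) g (n + 1) →
        p * t ∈ polyIdeal (q := q) g (n + 1) :=
      fun ht hp => mul_mem_polyIdeal ht hp
    -- The term `Q (n + 1) i (j, n + 1)` is `ad (g (j, n + 1) (j, n))` of the old entry; this
    -- derivation commutes with `ad (g u v)` and preserves the ideal.
    rw [T_succ_of_lt q d g hj, Q_succ,
      ← ad_T_replace d hg (k := j) (c := (j, n + 1)) (by omega) le_rfl]
    simp only [map_sub, map_add, map_sum, map_nsmul, ad_mul, ad_X]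
    refine sub_mem (add_mem (sub_mem (sub_mem ?_ (sum_mem fun h _ => ?_)) ?_) ?_)
      (sum_mem fun h _ => ?_)
    · have := ad_ad (C (g u v)) (C (g (j, n + 1) (j, n))) (T q d g (n + 1) i j)
      rw [hz _ _ le_rfl le_rfl] at this
      have h0 : ad (0 : A[X]) (T q d g (n + 1) i j) = 0 := by simp [ad_apply]
      rw [h0, eq_comm, sub_eq_zero] at this
      rw [this]
      exact ad_mem_polyIdeal_of_ge hg (c := (j, n + 1)) (b := (j, n)) (by simp) (by simp)
        (hT u v h1 h2 i j)
    · rw [hz _ _ (by simp) le_rfl, mul_zero, add_zero]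
      refine hm (fun x y h3 h4 => ?_) (hT u v h1 h2 i h)
      rw [ad_C_C, hg.comm, if_neg, if_neg]
      · simp
      · rintro ⟨rfl, -⟩
        simp at h3
        omega
      · rintro ⟨rfl, -⟩
        simp at h4
    · rw [zero_mul, zero_add]
      exact mul_left_mem_polyIdeal _ (hT u v h1 h2 i j)
    · exact nsmul_mem (hT u v h1 h2 i j) _
    · split_ifs with hh
      · have hc : ∀ x y : Fin r × ℕ, x.2 < y.2 → y.2 < n + 1 →
            ad (C (g x y)) (C ((T q d g (n + 1) h j).coeff (q h - 1))) ∈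
              polyIdeal (q := q) g (n + 1) := by
          intro x y h3 h4
          rw [ad_C_coeff]
          exact C_coeff_mem_polyIdeal (hT x y h3 h4 h j) _
        rw [map_zsmul, ad_mul]
        refine zsmul_mem (add_mem ?_ ?_) _
        · exact hm hc (hT u v h1 h2 i h)
        · exact mul_left_mem_polyIdeal _ (hc u v h1 h2)
      · rw [map_zero]
        exact zero_mem _
  · rw [T_succ_of_le q d g (not_lt.1 hj)]
    exact hT u v h1 h2 i j

/-- In the quotient, a unit standing at the right end is replaced by its character value. -/
theorem mkQ_mul_C {n : ℕ} {u v : Fin r × ℕ} (h1 : u.2 < v.2) (h2 : v.2 < n) (p : A[X]) :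
    (polyIdeal (q := q) g n).mkQ (p * C (g u v)) =
      if IsNext u v ∧ v.2 < q v.1 then (polyIdeal (q := q) g n).mkQ p else 0 := by
  have h3 := Submodule.smul_mem _ p (C_sub_mem_polyIdeal hg h1 h2)
  rw [smul_eq_mul, mul_sub] at h3
  have h4 := (Submodule.Quotient.eq _).2 h3
  change (polyIdeal (q := q) g n).mkQ _ = (polyIdeal (q := q) g n).mkQ _ at h4
  rw [h4]
  split_ifs <;> simp

/-- Two contractions occur: the replacement of `v` by `(l, n)`, and the contraction of `(h, n)` with
`(l, n)` as in `ad_Q_succ`. -/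
theorem ad_Q_succ_self {n : ℕ} {l : Fin r} {v : Fin r × ℕ} (hl : n < q l) (hv : n ≤ v.2)
    (hv' : v.2 < q v.1) (i : Fin r) :
    ad (C (g (l, n) v)) (Q q d g (n + 1) i v) =
      Q q d g (n + 1) i (l, n) + T q d g n i l * C (g v v) := by
  have h1 : ∀ h, ad (C (g (l, n) v)) (T q d g n i h * C (g v (h, n))) =
      T q d g n i h * C (g (l, n) (h, n)) -
        if h = l then T q d g n i l * C (g v v) else 0 := by
    intro h
    rw [ad_mul, ad_T_eq_zero d hg le_rfl hv, zero_mul, zero_add, ad_C_C, hg.comm,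
      if_pos ⟨rfl, hv'⟩, C_sub, mul_sub]
    congr 1
    by_cases h2 : h = l
    · subst h2
      rw [if_pos ⟨rfl, hl⟩, if_pos rfl]
    · rw [if_neg (by simp [h2]), if_neg h2, C_0, mul_zero]
  rw [Q_succ, map_sub, ad_Q_replace d hg hv' (by omega) le_rfl, map_sum, Q_succ]
  simp only [h1, Finset.sum_sub_distrib, Finset.sum_ite_eq', Finset.mem_univ, if_true]
  abel

/-! ### Brackets with units from the new column to its neighbour. -/

section New

variable {n : ℕ} {l k : Fin r} (hl : n < q l) (hk : n + 1 < q k) (i j : Fin r)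

include hk in
theorem mkQ_mul_C_next (h : Fin r) (p : A[X]) :
    (polyIdeal (q := q) g (n + 2)).mkQ (p * C (g (h, n) (k, n + 1))) =
      if h = k then (polyIdeal (q := q) g (n + 2)).mkQ p else 0 := by
  rw [mkQ_mul_C hg (by simp) (by simp)]
  refine if_congr ?_ rfl rfl
  simp [hk]

include hl hk in
-- A unit from the new column to its neighbour must be moved to the right end before it can be
-- evaluated. The commutator from this move gives the term with `n + 1 < q h`, one for each box of
-- the new column.
theorem mkQ_ad_Q_summand (h : Fin r) (hj : n + 1 < q j) :
    (polyIdeal (q := q) g (n + 2)).mkQ (ad (C (g (l, n) (k, n + 1)))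
      (T q d g (n + 1) i h * C (g (j, n + 1) (h, n + 1)))) =
    (if h = k then
      (polyIdeal (q := q) g (n + 2)).mkQ (T q d g n i l * C (g (j, n + 1) (k, n + 1))) else 0) +
    if j = k then (if n + 1 < q h then (polyIdeal (q := q) g (n + 2)).mkQ (T q d g n i l) else 0) +
      (if h = l then if n + 1 < q l then
        (polyIdeal (q := q) g (n + 2)).mkQ (T q d g (n + 1) i l) else 0 else 0) else 0 := by
  by_cases hh : n + 1 < q h
  · have h1 : C (g (h, n) (k, n + 1)) * C (g (j, n + 1) (h, n + 1)) =
        C (g (j, n + 1) (h, n + 1)) * C (g (h, n) (k, n + 1)) +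
          if j = k then C (g (h, n) (h, n + 1)) else 0 := by
      have := hg.comm (h, n) (k, n + 1) (j, n + 1) (h, n + 1)
      rw [if_neg (c := _ = (h, n) ∧ _) (by simp), sub_zero, sub_eq_iff_eq_add'] at this
      rw [← C_mul, this, C_add, C_mul]
      congr 1
      by_cases hjk : j = k
      · subst hjk
        simp [hj]
      · simp [hjk, Ne.symm hjk]
    rw [ad_mul, ad_T_succ d hg hl (by simp), if_pos (by omega), mul_assoc, h1, ad_C_C, hg.comm,
      if_neg (c := _ = (l, n) ∧ _) (by simp), sub_zero, mul_add, ← mul_assoc, map_add, map_add,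
      mkQ_mul_C_next hg hk, add_assoc]
    congr 1
    · split_ifs with h2
      · rw [h2]
      · rfl
    · by_cases hjk : j = k
      · subst hjk
        rw [if_pos rfl, if_pos ⟨rfl, hj⟩, if_pos rfl, mkQ_mul_C_next hg hh, if_pos rfl,
          mkQ_mul_C_next hg hh, if_pos hh]
        congr 1
        by_cases hlh : l = h
        · subst hlh
          simp [hh]
        · simp [hlh, Ne.symm hlh]
      · simp [hjk, Ne.symm hjk]
  · have h1 : h ≠ k := by rintro rfl; omega
    rw [hg.eq_zero _ (h, n + 1) (by simpa using hh), C_0, mul_zero, map_zero, map_zero, if_neg h1,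
      if_neg hh, zero_add, zero_add]
    split_ifs with h2 h3
    · subst h3
      omega
    all_goals rfl

include hl hk in
-- The terms with `g (j, n + 1) (k, n + 1)` from the two parts of `Q_succ` cancel, and the
-- reordering terms add up to the height of the new column times `T n i l`.
theorem mkQ_ad_Q (hj : n + 1 < q j) :
    (polyIdeal (q := q) g (n + 2)).mkQ (ad (C (g (l, n) (k, n + 1)))
      (Q q d g (n + 2) i (j, n + 1))) =
    if j = k then (polyIdeal (q := q) g (n + 2)).mkQ (Q q d g (n + 1) i (l, n)) -
      ((Finset.univ.filter fun h => n + 1 < q h).card •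
        (polyIdeal (q := q) g (n + 2)).mkQ (T q d g n i l) +
      if n + 1 < q l then (polyIdeal (q := q) g (n + 2)).mkQ (T q d g (n + 1) i l) else 0)
    else 0 := by
  have h1 : ad (C (g (l, n) (k, n + 1))) (Q q d g (n + 1) i (j, n + 1)) =
      T q d g n i l * C (g (j, n + 1) (k, n + 1)) +
        if j = k then Q q d g (n + 1) i (l, n) else 0 := by
    split_ifs with hjk
    · subst hjk
      rw [ad_Q_succ_self d hg hl (by simp) hj, add_comm]
    · rw [ad_Q_succ d hg hl (by simp) (by simp [Ne.symm hjk]), add_zero]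
  rw [Q_succ, map_sub, map_sub, h1, map_add, map_sum, map_sum]
  simp only [mkQ_ad_Q_summand d hg hl hk i j _ hj, Finset.sum_add_distrib, Finset.sum_ite_eq',
    Finset.mem_univ, if_true]
  rw [add_sub_add_left_eq_sub]
  split_ifs with hjk
  · rw [Finset.sum_add_distrib, Finset.sum_ite_eq', if_pos (Finset.mem_univ _), ← Finset.sum_filter,
      Finset.sum_const]
  · rw [Finset.sum_add_distrib, Finset.sum_ite_eq', if_pos (Finset.mem_univ _), ← Finset.sum_filter,
      Finset.sum_const]
  · simp

omit hg in
-- The leading coefficient of `T n h h` against the sign `(-1) ^ q h` of the quadratic term, when `q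
-- h = n + 1`.
theorem neg_one_pow_smul_mul_C (n : ℕ) (p : A[X]) :
    (-1 : ℤ) ^ (n + 1) • (p * C (-(-1) ^ n)) = p := by
  have h5 : (C (-(-1) ^ n) : A[X]) = C (((-(-1) ^ n : ℤ)) : A) := by push_cast; rfl
  rw [h5, map_intCast, ← Int.cast_comm, ← zsmul_eq_mul, smul_smul, pow_succ]
  have h6 : ((-1 : ℤ) ^ n * -1 * -(-1) ^ n) = 1 := by
    have : (-1 : ℤ) ^ n * (-1) ^ n = 1 := by rw [← pow_add, Even.neg_one_pow ⟨_, rfl⟩]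
    linarith
  rw [h6, one_smul]

include hl hk in
-- For a row of length exactly `n + 1`, moving the unit past the second factor leaves a commutator
-- containing the scalar leading coefficient of `T n h h`. Shorter rows contribute only through the
-- bracket with the second factor.
theorem mkQ_ad_product (hq : ∀ i, 0 < q i) (h : Fin r) (hj : n + 1 < q j) (hh : q h ≤ n + 1) :
    (polyIdeal (q := q) g (n + 2)).mkQ (ad (C (g (l, n) (k, n + 1)))
      ((-1 : ℤ) ^ q h • (T q d g (n + 1) i h * C ((T q d g (n + 1) h j).coeff (q h - 1))))) =
    if j = k then (if q h = n + 1 then (polyIdeal (q := q) g (n + 2)).mkQ (T q d g n i l) else 0) +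
      (-1 : ℤ) ^ q h • (polyIdeal (q := q) g (n + 2)).mkQ
        (T q d g (n + 1) i h * C ((T q d g n h l).coeff (q h - 1))) else 0 := by
  have h1 : ad (C (g (l, n) (k, n + 1))) (C ((T q d g (n + 1) h j).coeff (q h - 1))) =
      C ((T q d g n h l).coeff (q h - 1)) * C (g (j, n) (k, n + 1)) := by
    rw [ad_C_coeff, ad_T_succ d hg hl (by simp), if_pos (by omega), coeff_mul_C, C_mul]
  have hhk : h ≠ k := by rintro rfl; omega
  rw [map_zsmul, map_zsmul, ad_mul, h1, ad_T_succ d hg hl (by simp), ← mul_assoc, map_add,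
    mkQ_mul_C_next hg hk, smul_add]
  by_cases hn : n < q h
  · have hn' : q h = n + 1 := by omega
    have h2 : C (g (h, n) (k, n + 1)) * C ((T q d g (n + 1) h j).coeff n) =
        C ((T q d g (n + 1) h j).coeff n) * C (g (h, n) (k, n + 1)) +
          C ((T q d g n h h).coeff n) * C (g (j, n) (k, n + 1)) := by
      have h3 : ad (C (g (h, n) (k, n + 1))) (C ((T q d g (n + 1) h j).coeff n)) =
          C ((T q d g n h h).coeff n) * C (g (j, n) (k, n + 1)) := by
        rw [ad_C_coeff, ad_T_succ d hg hn (by simp), if_pos (by omega), coeff_mul_C, C_mul]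
      rw [← h3, ad_apply, add_sub_cancel]
    rw [if_pos hn, hn', Nat.add_sub_cancel, if_pos rfl, mul_assoc, h2, mul_add, ← mul_assoc,
      ← mul_assoc, map_add, mkQ_mul_C_next hg hk, mkQ_mul_C_next hg hk, if_neg hhk, zero_add,
      coeff_T d g hq hg.eq_zero (by omega),
      if_pos (c := h = h ∧ _) ⟨rfl, by omega⟩]
    split_ifs with hjk
    · rw [← map_zsmul, neg_one_pow_smul_mul_C]
    · simp
  · rw [if_neg hn, zero_mul, map_zero, smul_zero, zero_add, if_neg (c := q h = n + 1) (by omega),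
      zero_add]
    split_ifs <;> simp

/-- Invariance of the new matrix entries under the matrix units from the new column to its
neighbour. -/
theorem ad_T_mem_new (hq : ∀ i, 0 < q i)
    (hd : d (n + 1) = d n + (Finset.univ.filter fun h => n < q h).card) {l k : Fin r}
    (hl : n < q l) (hk : n + 1 < q k) (i j : Fin r) :
    ad (C (g (l, n) (k, n + 1))) (T q d g (n + 2) i j) ∈ polyIdeal (q := q) g (n + 2) := by
  rw [← Submodule.Quotient.mk_eq_zero]
  change (polyIdeal (q := q) g (n + 2)).mkQ _ = 0
  have hkn : n + 1 ≤ ((k, n + 1) : Fin r × ℕ).2 := le_rfl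
  by_cases hj : n + 1 < q j
  -- Rows ending just before the new column are special: each gives a copy of `T n i l`, and the row
  -- `h = l` also gives `T (n + 1) i l`.
  · have h1 : ∀ h, (polyIdeal (q := q) g (n + 2)).mkQ (ad (C (g (l, n) (k, n + 1)))
        (if q h ≤ n + 1 then
          (-1 : ℤ) ^ q h • (T q d g (n + 1) i h * C ((T q d g (n + 1) h j).coeff (q h - 1)))
          else 0)) =
        if j = k then (if q h = n + 1 then (polyIdeal (q := q) g (n + 2)).mkQ (T q d g n i l)
          else 0) + ((if q h ≤ n then (polyIdeal (q := q) g (n + 2)).mkQ ((-1 : ℤ) ^ q h •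
            (T q d g n i h * C ((T q d g n h l).coeff (q h - 1)))) else 0) +
            if h = l then if q h = n + 1 then
              (polyIdeal (q := q) g (n + 2)).mkQ (T q d g (n + 1) i l) else 0 else 0) else 0 := by
      intro h
      by_cases hh : q h ≤ n + 1
      · rw [if_pos hh, mkQ_ad_product d hg hl hk i j hq h hj hh]
        congr 2
        by_cases hn : q h ≤ n
        · rw [if_pos hn, if_neg (c := q h = n + 1) (by omega), T_succ_of_le q d g hn, ite_self,
            add_zero, map_zsmul]
        · have hn' : q h = n + 1 := by omega
          rw [if_neg hn, zero_add, hn', if_pos rfl, Nat.add_sub_cancel,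
            coeff_T d g hq hg.eq_zero (by omega), ← map_zsmul]
          by_cases hhl : h = l
          · rw [if_pos ⟨hhl, by omega⟩, neg_one_pow_smul_mul_C, if_pos hhl, hhl]
          · simp [hhl]
      · simp [hh, show ¬ q h = n + 1 by omega, show ¬ q h ≤ n by omega]
    rw [T_succ_of_lt q d g hj]
    simp only [map_sub, map_add, map_sum, map_nsmul, h1, mkQ_ad_Q d hg hl hk i j hj,
      ad_mul, ad_X, zero_mul, zero_add, ad_T_succ d hg hl hkn, if_pos (show n < q j by omega)]
    rw [← mul_assoc, mkQ_mul_C_next hg hk, mkQ_mul_C_next hg hk]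
    by_cases hjk : j = k
    · simp only [if_pos hjk, Finset.sum_add_distrib, Finset.sum_ite_eq', Finset.mem_univ, if_true]
      -- The brackets add up to the recursion for `T (n + 1) i l`. Its left-hand side occurs exactly
      -- once: from `Q` if row `l` reaches the new column, from the quadratic term if it ends just
      -- before.
      have h2 := congrArg (polyIdeal (q := q) g (n + 2)).mkQ (T_succ_of_lt q d g hl i)
      simp only [map_sub, map_add, map_sum, map_nsmul, apply_ite, map_zero] at h2
      have h3 : (if n + 1 < q l then (polyIdeal (q := q) g (n + 2)).mkQ (T q d g (n + 1) i l)
          else 0) + (if q l = n + 1 then (polyIdeal (q := q) g (n + 2)).mkQ (T q d g (n + 1) i l)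
          else 0) = (polyIdeal (q := q) g (n + 2)).mkQ (T q d g (n + 1) i l) := by
        by_cases hl' : q l = n + 1
        · simp [hl']
        · simp [hl', show n + 1 < q l by omega]
      -- The growth of `d` splits into the rows counted by the bracket of `Q` and those counted by
      -- the quadratic term.
      have h4 : (Finset.univ.filter fun h => n < q h).card =
          (Finset.univ.filter fun h => n + 1 < q h).card +
            (Finset.univ.filter fun h => q h = n + 1).card := by
        rw [← Finset.card_union_of_disjoint]
        · congr 1
          ext h
          simp
          omega
        · exact Finset.disjoint_filter.2 fun h _ h5 h6 => by omega
      rw [← Finset.sum_filter, Finset.sum_const, hd, h4]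
      rw [← h3] at h2
      simp only [add_smul] at h2 ⊢
      refine Eq.trans ?_ (sub_eq_zero.2 h2.symm)
      abel
    · simp [hjk]
  · rw [T_succ_of_le q d g (not_lt.1 hj), ad_T_succ d hg hl hkn]
    split_ifs
    · rw [mkQ_mul_C_next hg hk, if_neg]
      rintro rfl
      omega
    · simp

end New

/-- The coefficients of `T n` are invariant under the nilpotent subalgebra. -/
theorem ad_T_mem (hq : ∀ i, 0 < q i)
    (hd : ∀ n, d (n + 1) = d n + (Finset.univ.filter fun h => n < q h).card) (n : ℕ)
    {u v : Fin r × ℕ} (h1 : u.2 < v.2) (h2 : v.2 < n) (i j : Fin r) :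
    ad (C (g u v)) (T q d g n i j) ∈ polyIdeal (q := q) g n := by
  induction n generalizing u v i j with
  | zero => omega
  | succ n ih =>
    obtain _ | n := n
    · omega
    by_cases h3 : v.2 < n + 1
    · exact polyIdeal_mono (Nat.le_succ _)
        (ad_T_mem_of_lt d hg (fun u v h1 h2 i j => ih h1 h2 i j) h1 h3 i j)
    obtain ⟨k, c⟩ := v
    obtain rfl : c = n + 1 := by simp at h2 h3; omega
    by_cases hk : n + 1 < q k
    · have hnew : ∀ l, n < q l → ad (C (g (l, n) (k, n + 1))) (T q d g (n + 2) i j) ∈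
          polyIdeal (q := q) g (n + 2) := fun l hl => ad_T_mem_new d hg hq (hd n) hl hk i j
      obtain ⟨l, b⟩ := u
      by_cases hb : b = n
      · subst hb
        by_cases hl : b < q l
        · exact hnew l hl
        · rw [hg.eq_zero_left _ _ (by simpa using hl)]
          simp [ad_apply]
      · have hb' : b < n := by simp at h1; omega
        -- A longer unit is a commutator through the box `(k, n)`; the Jacobi identity reduces it to
        -- an old unit and a unit between neighbouring columns.
        have h4 : C (g (l, b) (k, n + 1)) = ad (C (g (l, b) (k, n))) (C (g (k, n) (k, n + 1))) := by
          rw [ad_C_C, hg.comm, if_pos ⟨rfl, by simp; omega⟩, if_neg, sub_zero]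
          rintro ⟨h, -⟩
          simp at h
          omega
        rw [h4, ad_ad]
        refine sub_mem (ad_mem_polyIdeal_of_lt hg hb' (by simp) (hnew k (by omega)))
          (ad_mem_polyIdeal_of_lt hg (by simp) (by simp) ?_)
        exact polyIdeal_mono (Nat.le_succ _) (ad_T_mem_of_lt d hg
          (fun u v h1 h2 i j => ih h1 h2 i j) hb' (by simp) i j)
    · rw [hg.eq_zero _ _ (by simpa using hk)]
      simp [ad_apply]

end Invariance

/-! ### Identification of `Wtilde` with `T`. -/

section MatrixUnits

variable (𝕜 : Type*) [Field 𝕜] (q : Fin r → ℕ)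

variable {q} in
/-- The row and the column of a box. -/
def pos (a : Box q) : Fin r × ℕ := (a.1, (a.2 : ℕ))

variable {q} in
theorem pos_injective : Function.Injective (pos (q := q)) := fun _ _ h =>
  box_ext (Prod.ext_iff.1 h).1 (Prod.ext_iff.1 h).2

variable {q} in
theorem pos_lt (a : Box q) : (pos a).2 < q (pos a).1 := a.2.2

variable {q} in
theorem exists_pos_eq {x : Fin r × ℕ} (h : x.2 < q x.1) : ∃ a : Box q, pos a = x :=
  ⟨⟨x.1, x.2, h⟩, rfl⟩

/-- The matrix unit from the box at `y` to the box at `x`, or zero if there are no such boxes. -/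
def matUnit (x y : Fin r × ℕ) : gl 𝕜 q :=
  Matrix.of fun a b => if pos a = x ∧ pos b = y then 1 else 0

variable {q} in
theorem matUnit_pos (a b : Box q) : matUnit 𝕜 q (pos a) (pos b) = Matrix.single a b 1 := by
  ext c e
  simp [matUnit, Matrix.single_apply, pos_injective.eq_iff, eq_comm]

theorem matUnit_eq_zero_left {x : Fin r × ℕ} (h : q x.1 ≤ x.2) (y) : matUnit 𝕜 q x y = 0 := by
  ext c e
  simp only [matUnit, Matrix.of_apply, Matrix.zero_apply, ite_eq_right_iff]
  rintro ⟨rfl, -⟩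
  exact absurd (pos_lt c) h.not_gt

theorem matUnit_eq_zero_right {y : Fin r × ℕ} (h : q y.1 ≤ y.2) (x) : matUnit 𝕜 q x y = 0 := by
  ext c e
  simp only [matUnit, Matrix.of_apply, Matrix.zero_apply, ite_eq_right_iff]
  rintro ⟨-, rfl⟩
  exact absurd (pos_lt e) h.not_gt

theorem matUnit_mul (x y z w : Fin r × ℕ) : matUnit 𝕜 q x y * matUnit 𝕜 q z w =
    if y = z ∧ y.2 < q y.1 then matUnit 𝕜 q x w else 0 := by
  by_cases hy : y.2 < q y.1
  · obtain ⟨b, rfl⟩ := exists_pos_eq hy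
    by_cases hx : x.2 < q x.1
    · obtain ⟨a, rfl⟩ := exists_pos_eq hx
      by_cases hz : z.2 < q z.1
      · obtain ⟨c, rfl⟩ := exists_pos_eq hz
        by_cases hw : w.2 < q w.1
        · obtain ⟨e, rfl⟩ := exists_pos_eq hw
          rw [matUnit_pos, matUnit_pos, matUnit_pos]
          by_cases h : b = c
          · subst h
            simp [hy]
          · simp [h, pos_injective.eq_iff]
        · rw [matUnit_eq_zero_right 𝕜 q (not_lt.1 hw), matUnit_eq_zero_right 𝕜 q (not_lt.1 hw)]
          simp
      · rw [matUnit_eq_zero_left 𝕜 q (not_lt.1 hz), if_neg, mul_zero]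
        rintro ⟨rfl, -⟩
        exact hz hy
    · rw [matUnit_eq_zero_left 𝕜 q (not_lt.1 hx), matUnit_eq_zero_left 𝕜 q (not_lt.1 hx)]
      simp
  · rw [matUnit_eq_zero_right 𝕜 q (not_lt.1 hy), if_neg (by tauto), zero_mul]

theorem isUnitSystem_of_lie {A : Type*} [Ring A] (f : gl 𝕜 q →+ A)
    (hf : ∀ a b, f (a * b - b * a) = f a * f b - f b * f a) :
    IsUnitSystem q fun x y => f (matUnit 𝕜 q x y) where
  eq_zero x y h := by rw [matUnit_eq_zero_right 𝕜 q h, map_zero]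
  eq_zero_left x y h := by rw [matUnit_eq_zero_left 𝕜 q h, map_zero]
  comm x y z w := by
    rw [← hf, matUnit_mul, matUnit_mul, map_sub]
    congr 1
    · split_ifs <;> simp
    · by_cases h : w = x
      · subst h
        split_ifs <;> simp
      · simp [h]

/-- The matrix units as elements of `U(𝔤)`. -/
def unitU (x y : Fin r × ℕ) : Ug 𝕜 q := inc 𝕜 q (matUnit 𝕜 q x y)

theorem inc_lie (a b : gl 𝕜 q) : inc 𝕜 q (a * b - b * a) =
    inc 𝕜 q a * inc 𝕜 q b - inc 𝕜 q b * inc 𝕜 q a :=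
  LieHom.map_lie (UniversalEnvelopingAlgebra.ι 𝕜 : gl 𝕜 q →ₗ⁅𝕜⁆ Ug 𝕜 q) a b

theorem isUnitSystem_unitU : IsUnitSystem q (unitU 𝕜 q) :=
  isUnitSystem_of_lie 𝕜 q (inc 𝕜 q).toAddMonoidHom (inc_lie 𝕜 q)

/-- The number of boxes in the `n` rightmost columns. -/
def numRight (n : ℕ) : ℕ := ∑ h, min (q h) n

theorem numRight_succ (n : ℕ) :
    numRight q (n + 1) = numRight q n + (Finset.univ.filter fun h => n < q h).card := by
  rw [numRight, numRight, Finset.card_filter, ← Finset.sum_add_distrib]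
  refine Finset.sum_congr rfl fun h _ => ?_
  split_ifs <;> omega

variable {q}

theorem F_pow_apply (k : ℕ) (a b : Box q) :
    (F 𝕜 q ^ k) a b = if a.1 = b.1 ∧ (a.2 : ℕ) = b.2 + k then 1 else 0 := by
  induction k generalizing b with
  | zero =>
    rw [pow_zero, Matrix.one_apply]
    refine if_congr ⟨?_, fun h => box_ext h.1 h.2⟩ rfl rfl
    rintro rfl
    exact ⟨rfl, rfl⟩
  | succ k ih =>
    rw [pow_succ, Matrix.mul_apply]
    by_cases hb : (b.2 : ℕ) + 1 < q b.1
    · rw [Finset.sum_eq_single ⟨b.1, b.2 + 1, hb⟩]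
      · rw [ih]
        simp [F, add_assoc, add_comm 1 k]
      · intro c _ hc
        have : ¬ (c.1 = b.1 ∧ (c.2 : ℕ) = b.2 + 1) := fun h => hc (box_ext h.1 h.2)
        simp [F, this]
      · simp
    · rw [Finset.sum_eq_zero, if_neg]
      · rintro ⟨h1, h2⟩
        have h3 := a.2.2
        have h4 := congrArg q h1
        omega
      · intro c _
        have : ¬ (c.1 = b.1 ∧ (c.2 : ℕ) = b.2 + 1) := by
          rintro ⟨h1, h2⟩
          have h3 := c.2.2
          have h4 := congrArg q h1
          omega
        simp [F, this]

theorem Ft_pow_apply (k : ℕ) (a b : Box q) :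
    (Ft 𝕜 q ^ k) a b = if a.1 = b.1 ∧ (b.2 : ℕ) = a.2 + k then 1 else 0 := by
  rw [Ft, ← Matrix.transpose_pow, Matrix.transpose_apply, F_pow_apply]
  simp only [eq_comm]

/-- A sum over the boxes that contains at most one box in every row. -/
theorem sum_box_eq {M : Type*} [AddCommMonoid M] (c : Fin r → ℕ) (f : Fin r → M) :
    ∑ b : Box q, (if (b.2 : ℕ) = c b.1 then f b.1 else 0) =
      ∑ h, if c h < q h then f h else 0 := by
  rw [Fintype.sum_sigma]
  refine Finset.sum_congr rfl fun h _ => ?_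
  split_ifs with hc
  · rw [Finset.sum_eq_single ⟨c h, hc⟩]
    · simp
    · intro b _ hb
      rw [if_neg]
      exact fun h' => hb (Fin.ext h')
    · simp
  · refine Finset.sum_eq_zero fun b _ => if_neg ?_
    have := b.2
    simp only
    omega

/-- For a fixed box the sum counts the boxes in the columns strictly to its right; this is the
source of the shift `numRight`. -/
theorem D_apply (b c : Box q) :
    D 𝕜 q b c = if b = c then -(numRight q b.2 : 𝕜) else 0 := by
  have h1 : ∀ x y : Box q, (if 1 ≤ deg x y then
      Matrix.single y x 1 * Matrix.single x y 1 else 0 : gl 𝕜 q) b c =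
      if y = b then if (x.2 : ℕ) < y.2 then (if b = c then 1 else 0) else 0 else 0 := by
    intro x y
    have h2 : 1 ≤ deg x y ↔ (x.2 : ℕ) < y.2 := by unfold deg; omega
    simp only [h2]
    by_cases hxy : (x.2 : ℕ) < y.2
    · simp only [if_pos hxy, Matrix.single_mul_single_same, mul_one, Matrix.single_apply]
      by_cases hy : y = b
      · subst hy; simp
      · simp [hy]
    · simp [hxy]
  rw [D, Matrix.neg_apply, Matrix.sum_apply]
  simp only [Matrix.sum_apply, h1]
  have h2 : ∀ m n : ℕ, (Finset.univ.filter fun x : Fin m => (x : ℕ) < n).card = min m n := by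
    intro m n
    rw [Finset.card_filter, Fin.sum_univ_eq_sum_range (fun x => if x < n then 1 else 0) m,
      ← Finset.card_filter, ← Finset.card_range (min m n)]
    congr 1
    ext x
    simp
  have h3 : ∀ x : Box q, (∑ y : Box q, if y = b then
      if (x.2 : ℕ) < y.2 then (if b = c then 1 else 0) else 0 else 0 : 𝕜) =
      if (x.2 : ℕ) < b.2 then (if b = c then 1 else 0) else 0 := fun x => by simp
  simp only [h3]
  rw [← Finset.sum_filter, Finset.sum_const]
  have h4 : (Finset.univ.filter fun x : Box q => (x.2 : ℕ) < b.2).card = numRight q b.2 := by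
    rw [Finset.card_filter, Fintype.sum_sigma, numRight]
    refine Finset.sum_congr rfl fun h _ => ?_
    rw [← h2, Finset.card_filter]
  rw [h4]
  split_ifs <;> simp

theorem sc_apply (M : gl 𝕜 q) (a b : Box q) :
    sc 𝕜 q M a b = algebraMap 𝕜 (Ug 𝕜 q)[X] (M a b) := rfl

theorem sc_proj (P : Box q → Prop) [DecidablePred P] :
    sc 𝕜 q (proj 𝕜 q P) = Matrix.diagonal fun a => if P a then 1 else 0 := by
  ext1 a b
  rw [sc_apply, proj, Matrix.diagonal_apply, Matrix.diagonal_apply]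
  split_ifs <;> simp

theorem mul_sc_proj (M : UMat 𝕜 q) (P : Box q → Prop) [DecidablePred P] (a b : Box q) :
    (M * sc 𝕜 q (proj 𝕜 q P)) a b = if P b then M a b else 0 := by
  rw [sc_proj, Matrix.mul_diagonal]
  split_ifs <;> simp

theorem sc_proj_mul (M : UMat 𝕜 q) (P : Box q → Prop) [DecidablePred P] (a b : Box q) :
    (sc 𝕜 q (proj 𝕜 q P) * M) a b = if P a then M a b else 0 := by
  rw [sc_proj, Matrix.diagonal_mul]
  split_ifs <;> simp

section Step

variable {M : UMat 𝕜 q} {t : Fin r → Fin r → (Ug 𝕜 q)[X]} {n : ℕ}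
  (hM : ∀ a b, M a b =
    if IsRight a ∧ (b.2 : ℕ) + 1 = min (q b.1) (n + 1) then t a.1 b.1 else 0)

include hM

/-- The shift moves the entry at `(h, n)` to `(h, n + 1)`, and drops it if row `h` has no such box;
so exactly the rows reaching the new column remain. -/
theorem mul_sc_Ft_apply (a b : Box q) : (M * sc 𝕜 q (Ft 𝕜 q)) a b =
    if IsRight a ∧ (b.2 : ℕ) = n + 1 then t a.1 b.1 else 0 := by
  have hF : ∀ e, sc 𝕜 q (Ft 𝕜 q) e b = if e.1 = b.1 ∧ (b.2 : ℕ) = e.2 + 1 then 1 else 0 := by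
    intro e
    have := Ft_pow_apply (𝕜 := 𝕜) 1 e b
    rw [pow_one] at this
    rw [sc_apply, this]
    split_ifs <;> simp
  rw [Matrix.mul_apply]
  simp only [hF, mul_ite, mul_one, mul_zero]
  have hb := b.2.2
  by_cases hb0 : (b.2 : ℕ) = 0
  · rw [Finset.sum_eq_zero, if_neg (by omega)]
    exact fun e _ => if_neg (by omega)
  · rw [Finset.sum_eq_single ⟨b.1, b.2 - 1, by omega⟩, if_pos ⟨rfl, by simp; omega⟩, hM]
    · refine if_congr (and_congr_right fun _ => ?_) rfl rfl
      simp only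
      omega
    · intro e _ he
      refine if_neg fun h => he (box_ext h.1 ?_)
      simp only
      omega
    · simp

/-- The power `(-F) ^ k` accompanies the coefficient of `x ^ k` and carries a rightmost box `k`
steps to the left. So the row of the box `b` sees only the exponent `b.2`. -/
theorem resTerm_mul_sc_Ft_apply (b c : Box q) :
    (resTerm M * sc 𝕜 q (Ft 𝕜 q)) b c =
      if (c.2 : ℕ) = n + 1 then (-1 : ℤ) ^ (b.2 : ℕ) • C ((t b.1 c.1).coeff b.2) else 0 := by
  have hk : ∀ k e, ((M.map fun p => C (p.coeff k)) * sc 𝕜 q (Ft 𝕜 q)) e c =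
      if IsRight e ∧ (c.2 : ℕ) = n + 1 then C ((t e.1 c.1).coeff k) else 0 := by
    intro k e
    refine mul_sc_Ft_apply 𝕜 (t := fun i j => C ((t i j).coeff k)) (fun a b => ?_) e c
    rw [Matrix.map_apply, hM]
    split_ifs <;> simp
  have hF : ∀ k e, sc 𝕜 q ((-F 𝕜 q) ^ k) b e =
      if b.1 = e.1 ∧ (b.2 : ℕ) = e.2 + k then (-1) ^ k else 0 := by
    intro k e
    rw [sc_apply, ← neg_one_smul 𝕜 (F 𝕜 q), _root_.smul_pow, Matrix.smul_apply, F_pow_apply]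
    split_ifs <;> simp
  have hb : (b.2 : ℕ) < numCols q := b.2.2.trans_le (Finset.le_sup (Finset.mem_univ b.1))
  rw [resTerm, Finset.sum_mul, Matrix.sum_apply]
  simp only [mul_assoc, Matrix.mul_apply (M := sc 𝕜 q _), hk, hF]
  by_cases hc : (c.2 : ℕ) = n + 1
  · rw [if_pos hc, Finset.sum_eq_single (b.2 : ℕ), Finset.sum_eq_single ⟨b.1, 0, by omega⟩]
    · simp [hc, IsRight]
    · intro e _ he
      by_cases h : b.1 = e.1 ∧ (b.2 : ℕ) = e.2 + b.2
      · exact (he (box_ext h.1.symm (by change (e.2 : ℕ) = 0; omega))).elim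
      · rw [if_neg h, zero_mul]
    · simp
    · intro k _ hk
      refine Finset.sum_eq_zero fun e _ => ?_
      by_cases h : (b.2 : ℕ) = e.2 + k
      · rw [if_neg (c := IsRight e ∧ _), mul_zero]
        rintro ⟨h1, -⟩
        unfold IsRight at h1
        omega
      · rw [if_neg (by tauto), zero_mul]
    · exact fun h => absurd (Finset.mem_range.2 hb) h
  · rw [if_neg hc]
    refine Finset.sum_eq_zero fun k _ => Finset.sum_eq_zero fun e _ => ?_
    rw [if_neg (c := IsRight e ∧ _) (by tauto), mul_zero]

end Step

theorem E_apply (a b : Box q) : E 𝕜 q a b = C (unitU 𝕜 q (pos b) (pos a)) := by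
  rw [unitU, matUnit_pos]
  rfl

theorem Edeg_apply (j : ℤ) (a b : Box q) :
    Edeg 𝕜 q j a b = if deg b a = j then C (unitU 𝕜 q (pos b) (pos a)) else 0 := by
  rw [unitU, matUnit_pos]
  rfl

variable (q) in
/-- The matrices `T` with entries in `U(𝔤)[z]`. -/
noncomputable abbrev TU : ℕ → Fin r → Fin r → (Ug 𝕜 q)[X] := T q (numRight q) (unitU 𝕜 q)

variable (q) in
/-- The row vectors `Q` with entries in `U(𝔤)[z]`. -/
noncomputable abbrev QU : ℕ → Fin r → Fin r × ℕ → (Ug 𝕜 q)[X] := Q q (numRight q) (unitU 𝕜 q)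

theorem Wtilde_one_apply (hq : ∀ i, 0 < q i) (a b : Box q) : Wtilde 𝕜 q 1 a b =
    if IsRight a ∧ (b.2 : ℕ) + 1 = min (q b.1) 1 then TU 𝕜 q 1 a.1 b.1 else 0 := by
  have h1 : Wtilde 𝕜 q 1 a b =
      if IsRight b then if IsRight a then zOne 𝕜 q a b + E 𝕜 q a b else 0 else 0 := by
    rw [Wtilde, mul_sc_proj, sc_proj_mul, Matrix.add_apply]
  have hb : IsRight b ↔ (b.2 : ℕ) + 1 = min (q b.1) 1 := by
    have := hq b.1
    unfold IsRight
    omega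
  rw [h1]
  simp only [← hb]
  by_cases h2 : IsRight a
  · by_cases h3 : IsRight b
    · have h4 : a = b ↔ a.1 = b.1 := ⟨fun h => h ▸ rfl, fun h => box_ext h (h2.trans h3.symm)⟩
      have h5 : pos b = (b.1, 0) := Prod.ext rfl h3
      have h6 : pos a = (a.1, 0) := Prod.ext rfl h2
      rw [if_pos h3, if_pos h2, if_pos ⟨h2, h3⟩, TU, T_succ_of_lt q _ _ (hq b.1), Q_succ, Q_zero,
        Finset.sum_eq_single a.1, Finset.sum_eq_zero (f := fun h => ite (q h ≤ 0) _ _), E_apply, h5,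
        h6, zOne, Matrix.diagonal_apply]
      · simp only [T_zero, h4]
        split_ifs <;> simp [numRight, add_comm]
      · intro h _
        rw [if_neg (hq h).not_ge]
      · intro h _ hh
        rw [T_zero, if_neg hh.symm, zero_mul]
      · simp
    · rw [if_neg h3, if_neg (by tauto)]
  · simp [h2]

/-- By `ad_T_replace` each row reaching the new column contributes the same vector, which gives the
factor `r₁`; the sign comes from the order of the bracket. -/
theorem bracket_term_apply {n : ℕ} {M : UMat 𝕜 q}
    (hM : ∀ a b, M a b =
      if IsRight a ∧ (b.2 : ℕ) + 1 = min (q b.1) (n + 1) then TU 𝕜 q (n + 1) a.1 b.1 else 0)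
    (a c : Box q) :
    bracketOne M (sc 𝕜 q (proj 𝕜 q fun a => (a.2 : ℕ) + 2 = n + 2 ∧ n + 2 ≤ q a.1) *
      Edeg 𝕜 q (-1)) a c = if IsRight a ∧ (c.2 : ℕ) = n + 1 then
        -((Finset.univ.filter fun i => n + 2 ≤ q i).card • QU 𝕜 q (n + 1) a.1 (pos c)) else 0 := by
  have h1 : ∀ b, M a b * (sc 𝕜 q (proj 𝕜 q fun a => (a.2 : ℕ) + 2 = n + 2 ∧ n + 2 ≤ q a.1) *
      Edeg 𝕜 q (-1)) b c - (sc 𝕜 q (proj 𝕜 q fun a => (a.2 : ℕ) + 2 = n + 2 ∧ n + 2 ≤ q a.1) *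
      Edeg 𝕜 q (-1)) b c * M a b = if IsRight a ∧ (c.2 : ℕ) = n + 1 then
        if (b.2 : ℕ) = n then if n + 2 ≤ q b.1 then - QU 𝕜 q (n + 1) a.1 (pos c) else 0 else 0
        else 0 := by
    intro b
    rw [sc_proj_mul, hM, Edeg_apply]
    by_cases ha : IsRight a
    · by_cases hb : (b.2 : ℕ) = n
      · by_cases hqb : n + 2 ≤ q b.1
        · have h2 : deg c b = -1 ↔ (c.2 : ℕ) = n + 1 := by unfold deg; omega
          have h3 : pos b = (b.1, n) := Prod.ext rfl hb
          simp only [ha, hb, hqb, h2, true_and, if_true, and_true]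
          rw [if_pos (by omega)]
          split_ifs with hc
          · have := ad_T_replace (numRight q) (isUnitSystem_unitU 𝕜 q) (n := n) (k := b.1)
              (c := pos c) (by omega) (by simp [pos, hc]) a.1
            rw [QU, ← this, ad_apply, h3, neg_sub]
          · simp
        · simp [hqb]
      · simp [hb]
    · simp [ha]
  rw [bracketOne, Matrix.of_apply]
  simp only [h1]
  split_ifs with h
  · refine (sum_box_eq (fun _ => n) fun k =>
      if n + 2 ≤ q k then - QU 𝕜 q (n + 1) a.1 (pos c) else 0).trans ?_
    rw [← Finset.sum_filter, ← Finset.sum_filter, Finset.sum_const, Finset.filter_filter, smul_neg]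
    congr 4
    ext h
    simp
    omega
  · simp

theorem linear_term_apply {n : ℕ} {M : UMat 𝕜 q} {t : Fin r → Fin r → (Ug 𝕜 q)[X]}
    (hM : ∀ a b, M a b =
      if IsRight a ∧ (b.2 : ℕ) + 1 = min (q b.1) (n + 1) then t a.1 b.1 else 0)
    {a c : Box q} (ha : IsRight a) (hc : (c.2 : ℕ) = n + 1) :
    (M * sc 𝕜 q (Ft 𝕜 q) * (zOne 𝕜 q + Edeg 𝕜 q 0 + sc 𝕜 q (D 𝕜 q))) a c =
      X * t a.1 c.1 + ∑ h, t a.1 h * C (unitU 𝕜 q (pos c) (h, n + 1)) -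
        numRight q (n + 1) • t a.1 c.1 := by
  have h1 : ∀ b : Box q, (M * sc 𝕜 q (Ft 𝕜 q)) a b *
      (zOne 𝕜 q + Edeg 𝕜 q 0 + sc 𝕜 q (D 𝕜 q)) b c =
      (if (b.2 : ℕ) = n + 1 then t a.1 b.1 * C (unitU 𝕜 q (pos c) (b.1, n + 1)) else 0) +
        if b = c then X * t a.1 c.1 - numRight q (n + 1) • t a.1 c.1 else 0 := by
    intro b
    rw [mul_sc_Ft_apply 𝕜 hM]
    by_cases hb : (b.2 : ℕ) = n + 1
    · have h2 : deg c b = 0 := by unfold deg; omega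
      have h3 : pos b = (b.1, n + 1) := Prod.ext rfl hb
      rw [if_pos ⟨ha, hb⟩, if_pos hb, Matrix.add_apply, Matrix.add_apply, Edeg_apply, if_pos h2,
        sc_apply, D_apply, zOne, Matrix.diagonal_apply, h3, hb]
      split_ifs with h
      · subst h
        rw [mul_add, mul_add, map_neg, map_natCast, mul_neg, X_mul, nsmul_eq_mul,
          Nat.cast_comm]
        abel
      · simp
    · rw [if_neg (by tauto), if_neg hb, if_neg (by rintro rfl; exact hb hc)]
      simp
  rw [Matrix.mul_apply]
  simp only [h1]
  rw [Finset.sum_add_distrib, Finset.sum_ite_eq', if_pos (Finset.mem_univ _)]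
  rw [sum_box_eq (fun _ => n + 1) fun h => t a.1 h * C (unitU 𝕜 q (pos c) (h, n + 1))]
  have h4 : ∀ h, (if n + 1 < q h then t a.1 h * C (unitU 𝕜 q (pos c) (h, n + 1)) else 0) =
      t a.1 h * C (unitU 𝕜 q (pos c) (h, n + 1)) := by
    intro h
    split_ifs with hh
    · rfl
    · rw [(isUnitSystem_unitU 𝕜 q).eq_zero _ (h, n + 1) (by simpa using hh)]
      simp
  simp only [h4]
  abel

/-- At the leftmost box of an exhausted row `h` the residue has exponent and sign governed by `q h -
1`; rewriting the sign with `q h` gives the overall minus. -/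
theorem quadratic_term_apply (hq : ∀ i, 0 < q i) {n : ℕ} {M : UMat 𝕜 q}
    {t : Fin r → Fin r → (Ug 𝕜 q)[X]} (hM : ∀ a b, M a b =
      if IsRight a ∧ (b.2 : ℕ) + 1 = min (q b.1) (n + 1) then t a.1 b.1 else 0)
    {a c : Box q} (ha : IsRight a) (hc : (c.2 : ℕ) = n + 1) :
    (M * sc 𝕜 q (proj 𝕜 q fun a => IsLeft a ∧ q a.1 < n + 2) * resTerm M * sc 𝕜 q (Ft 𝕜 q)) a c =
      - ∑ h, if q h ≤ n + 1 then
        (-1 : ℤ) ^ q h • (t a.1 h * C ((t h c.1).coeff (q h - 1))) else 0 := by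
  have h1 : ∀ b : Box q, (M * sc 𝕜 q (proj 𝕜 q fun a => IsLeft a ∧ q a.1 < n + 2)) a b *
      (resTerm M * sc 𝕜 q (Ft 𝕜 q)) b c =
      if (b.2 : ℕ) = q b.1 - 1 then (if q b.1 ≤ n + 1 then
        -((-1 : ℤ) ^ q b.1 • (t a.1 b.1 * C ((t b.1 c.1).coeff (q b.1 - 1)))) else 0) else 0 := by
    intro b
    have hb := hq b.1
    rw [mul_sc_proj, resTerm_mul_sc_Ft_apply 𝕜 hM, if_pos hc, hM]
    by_cases h2 : (b.2 : ℕ) = q b.1 - 1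
    · by_cases h3 : q b.1 ≤ n + 1
      · rw [if_pos ⟨by unfold IsLeft; omega, by omega⟩, if_pos ⟨ha, by omega⟩, if_pos h2, if_pos h3,
          h2, mul_smul_comm, ← neg_smul]
        congr 1
        obtain ⟨m, hm⟩ := Nat.exists_eq_succ_of_ne_zero hb.ne'
        rw [hm, Nat.succ_eq_add_one, Nat.add_sub_cancel, pow_succ]
        simp
      · rw [if_neg (by omega), if_neg h3, zero_mul, ite_self]
    · rw [if_neg (c := _ ∧ q b.1 < n + 2), if_neg h2, zero_mul]
      unfold IsLeft
      omega
  rw [mul_assoc _ (resTerm M), Matrix.mul_apply]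
  simp only [h1]
  rw [sum_box_eq (fun h => q h - 1) fun h => if q h ≤ n + 1 then
    -((-1 : ℤ) ^ q h • (t a.1 h * C ((t h c.1).coeff (q h - 1)))) else 0, ← Finset.sum_neg_distrib]
  refine Finset.sum_congr rfl fun h _ => ?_
  rw [if_pos (by have := hq h; omega)]
  split_ifs <;> simp

theorem Wtilde_apply [CharZero 𝕜] (hq : ∀ i, 0 < q i) (n : ℕ) (a b : Box q) :
    Wtilde 𝕜 q (n + 1) a b = if IsRight a ∧ (b.2 : ℕ) + 1 = min (q b.1) (n + 1) then
      TU 𝕜 q (n + 1) a.1 b.1 else 0 := by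
  induction n generalizing a b with
  | zero => exact Wtilde_one_apply 𝕜 hq a b
  | succ n hM =>
    have h1 : Wtilde 𝕜 q (n + 2) =
        Wtilde 𝕜 q (n + 1) * sc 𝕜 q (proj 𝕜 q fun a => IsLeft a ∧ q a.1 < n + 2) -
        (1 / ((Finset.univ.filter fun i => n + 2 ≤ q i).card : 𝕜)) • bracketOne (Wtilde 𝕜 q (n + 1))
          (sc 𝕜 q (proj 𝕜 q fun a => (a.2 : ℕ) + 2 = n + 2 ∧ n + 2 ≤ q a.1) * Edeg 𝕜 q (-1)) -
        Wtilde 𝕜 q (n + 1) * sc 𝕜 q (Ft 𝕜 q) * (zOne 𝕜 q + Edeg 𝕜 q 0 + sc 𝕜 q (D 𝕜 q)) *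
          sc 𝕜 q (proj 𝕜 q fun a => (a.2 : ℕ) + 1 = n + 2) +
        Wtilde 𝕜 q (n + 1) * sc 𝕜 q (proj 𝕜 q fun a => IsLeft a ∧ q a.1 < n + 2) *
          resTerm (Wtilde 𝕜 q (n + 1)) * sc 𝕜 q (Ft 𝕜 q) *
          sc 𝕜 q (proj 𝕜 q fun a => (a.2 : ℕ) + 1 = n + 2) := rfl
    rw [h1, Matrix.add_apply, Matrix.sub_apply, Matrix.sub_apply, Matrix.smul_apply,
      mul_sc_proj, mul_sc_proj, mul_sc_proj, bracket_term_apply 𝕜 hM]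
    have hb := b.2.2
    by_cases hc : (b.2 : ℕ) = n + 1
    · have hT : ¬ (IsLeft b ∧ q b.1 < n + 2) := by unfold IsLeft; omega
      rw [if_neg hT, if_pos (c := (b.2 : ℕ) + 1 = n + 2) (by omega),
        if_pos (c := (b.2 : ℕ) + 1 = n + 2) (by omega)]
      by_cases ha : IsRight a
      -- The box `b` lies in the leftmost column, so `r₁` is positive, and nonzero in `𝕜` by
      -- characteristic zero.
      · have hr : ((Finset.univ.filter fun i => n + 2 ≤ q i).card : 𝕜) ≠ 0 := by
          rw [Nat.cast_ne_zero, Finset.card_ne_zero]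
          exact ⟨b.1, by simp; omega⟩
        rw [if_pos ⟨ha, hc⟩, if_pos (c := _ ∧ _ = min _ _) ⟨ha, by omega⟩,
          linear_term_apply 𝕜 hM ha hc, quadratic_term_apply 𝕜 hq hM ha hc,
          show TU 𝕜 q (n + 1 + 1) a.1 b.1 = _ from
            T_succ_of_lt q _ _ (n := n + 1) (by omega) _, Q_succ, smul_neg,
          ← Nat.cast_smul_eq_nsmul 𝕜 (Finset.card _), smul_smul, one_div_mul_cancel hr, one_smul,
          show pos b = (b.1, n + 1) from Prod.ext rfl hc]
        abel
      · have hz : ∀ N : UMat 𝕜 q, (Wtilde 𝕜 q (n + 1) * N) a b = 0 := by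
          intro N
          rw [Matrix.mul_apply]
          refine Finset.sum_eq_zero fun e _ => ?_
          rw [hM, if_neg (by tauto), zero_mul]
        rw [if_neg (c := _ ∧ (b.2 : ℕ) = n + 1) (by tauto), if_neg (c := _ ∧ _ = min _ _) (by tauto),
          mul_assoc, hz, mul_assoc, mul_assoc, hz]
        simp
    · rw [if_neg (c := IsRight a ∧ (b.2 : ℕ) = n + 1) (by tauto), if_neg (c := _ = n + 2) (by omega),
        if_neg (c := _ = n + 2) (by omega), smul_zero, sub_zero, sub_zero, add_zero, hM]
      by_cases h2 : IsRight a ∧ (b.2 : ℕ) + 1 = min (q b.1) (n + 1 + 1)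
      · rw [if_pos h2, if_pos (c := IsLeft b ∧ _) (by unfold IsLeft; omega), if_pos ⟨h2.1, by omega⟩,
          show TU 𝕜 q (n + 1 + 1) a.1 b.1 = _ from
            T_succ_of_le q _ _ (n := n + 1) (by omega) _]
      · rw [if_neg h2]
        split_ifs with h3 h4
        · exact absurd ⟨h4.1, by unfold IsLeft at h3; omega⟩ h2
        all_goals rfl

end MatrixUnits

/-! ### The decomposition `𝔤 = 𝔤^f ⊕ U^⊥`. -/

section Complement

variable (𝕜 : Type*) [Field 𝕜] {q : Fin r → ℕ}

variable {𝕜} in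
theorem single_mem_grade (a b : Box q) (c : 𝕜) :
    Matrix.single a b c ∈ grade 𝕜 q (deg a b) := by
  intro x y h
  rw [Matrix.single_apply_of_ne]
  rintro ⟨rfl, rfl⟩
  exact h rfl

variable {𝕜} in
theorem single_mem_gePos {a b : Box q} (h : (a.2 : ℕ) < b.2) (c : 𝕜) :
    Matrix.single a b c ∈ gePos 𝕜 q := by
  have h1 : 1 ≤ deg a b := by unfold deg; omega
  exact le_iSup (fun j : {j : ℤ // 1 ≤ j} => grade 𝕜 q j) ⟨deg a b, h1⟩ (single_mem_grade a b c)

variable {𝕜} in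
theorem proj_mul_single (P : Box q → Prop) [DecidablePred P] (a b : Box q) (c : 𝕜) :
    proj 𝕜 q P * Matrix.single a b c = if P a then Matrix.single a b c else 0 := by
  ext x y
  rw [proj, Matrix.diagonal_mul]
  by_cases h : x = a
  · subst h
    split_ifs <;> simp
  · split_ifs <;> simp [Ne.symm h]

variable {𝕜} in
theorem single_mem_Uperp {a b : Box q} (h : IsLeft a → (a.2 : ℕ) < b.2) (c : 𝕜) :
    Matrix.single a b c ∈ Uperp 𝕜 q := by
  by_cases ha : IsLeft a
  · refine Submodule.mem_sup_right ⟨Matrix.single a b c, single_mem_gePos (h ha) c, ?_⟩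
    rw [LinearMap.mulLeft_apply, proj_mul_single, if_pos ha]
  · refine Submodule.mem_sup_left ⟨Matrix.single a b c, ?_⟩
    rw [LinearMap.mulLeft_apply, proj_mul_single, if_pos ha]

variable {𝕜} in
theorem mem_Uperp_iff {A : gl 𝕜 q} :
    A ∈ Uperp 𝕜 q ↔ ∀ a b : Box q, IsLeft a → (b.2 : ℕ) ≤ a.2 → A a b = 0 := by
  constructor
  · intro hA a b ha hab
    obtain ⟨_, ⟨B, rfl⟩, _, ⟨B', hB', rfl⟩, rfl⟩ := Submodule.mem_sup.1 hA
    simp [proj, Matrix.diagonal_mul, ha, apply_eq_zero_of_mem_gePos hB' hab]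
  · intro h
    rw [Matrix.matrix_eq_sum_single A]
    refine sum_mem fun a _ => sum_mem fun b _ => ?_
    by_cases hab : IsLeft a → (a.2 : ℕ) < b.2
    · exact single_mem_Uperp hab _
    · push Not at hab
      rw [h a b hab.1 hab.2, Matrix.single_zero]
      exact zero_mem _

theorem F_pow_mul_Ft_pow_apply {k l : ℕ} {a b : Box q} (ha : IsLeft a) (hb : IsLeft b) :
    (F 𝕜 q ^ k * Ft 𝕜 q ^ l) a b = if k = l ∧ a = b ∧ l ≤ (b.2 : ℕ) then 1 else 0 := by
  rw [Matrix.mul_apply]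
  simp only [F_pow_apply, Ft_pow_apply, mul_ite, mul_one, mul_zero, ← ite_and]
  have hab : ∀ e : Box q, (e.1 = b.1 ∧ (b.2 : ℕ) = e.2 + l) ∧ a.1 = e.1 ∧ (a.2 : ℕ) = e.2 + k →
      a = b := fun e he => box_ext (he.2.1.trans he.1.1) (by
    have := congrArg q (he.2.1.trans he.1.1)
    unfold IsLeft at ha hb
    omega)
  split_ifs with h
  · obtain ⟨rfl, rfl, h⟩ := h
    have h1 := a.2.2
    rw [Finset.sum_eq_single ⟨a.1, a.2 - k, by omega⟩, if_pos]
    · simp only [true_and, and_self]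
      omega
    · intro e _ he
      refine if_neg fun h2 => he (box_ext h2.1.1 ?_)
      simp only
      omega
    · simp
  · refine Finset.sum_eq_zero fun e _ => if_neg fun he => h ?_
    have := hab e he
    subst this
    exact ⟨by omega, rfl, by omega⟩

/-- Between leftmost boxes `F ^ k * Ft ^ l` vanishes unless `k = l`, so a single term of `phi` is
seen. Modulo `U^⊥`, `phi` of the unit from `a` to `b` is the unit from the box `l` steps left of `a`
to `b`, or zero. -/
theorem phi_single_apply (l : ℕ) {a b : Box q} (hb : IsLeft b) {c x : Box q} (hc : IsLeft c) :
    phi 𝕜 q l (Matrix.single b a 1) c x =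
      if c = b ∧ l ≤ (b.2 : ℕ) ∧ a.1 = x.1 ∧ (x.2 : ℕ) = a.2 + l then 1 else 0 := by
  have h1 : ∀ k, (F 𝕜 q ^ k * Ft 𝕜 q ^ l * Matrix.single b a 1 * Ft 𝕜 q ^ l * F 𝕜 q ^ (l - k) :
      gl 𝕜 q) c x =
      (F 𝕜 q ^ k * Ft 𝕜 q ^ l) c b * (Ft 𝕜 q ^ l * F 𝕜 q ^ (l - k)) a x := by
    intro k
    rw [mul_assoc, Matrix.mul_apply, Finset.sum_eq_single a]
    · simp
    · intro e _ he
      rw [Matrix.mul_single_apply_of_ne _ _ _ _ _ he, zero_mul]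
    · simp
  rw [phi, Matrix.sum_apply]
  simp only [h1, F_pow_mul_Ft_pow_apply 𝕜 hc hb]
  rw [Finset.sum_eq_single l]
  · rw [Nat.sub_self, pow_zero, mul_one, Ft_pow_apply]
    split_ifs <;> first | (exfalso; tauto) | simp
  · intro k _ hk
    rw [if_neg (by tauto), zero_mul]
  · simp

/-- Commuting with `F` transports entries along diagonals, an entry being zero when the transport
leaves the matrix too early. Moving left from `x` weakly to the right of `a` ends at a leftmost row
index, where `U^⊥` has zero entries; moving right from `x` strictly to the left of `a` always ends
in zero. The sum is everything because `phi` corrects each remaining unit. -/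
theorem isCompl_centralizerF_Uperp (hq : ∀ i, 0 < q i) :
    IsCompl (centralizerF 𝕜 q) (Uperp 𝕜 q) := by
  constructor
  · rw [Submodule.disjoint_def]
    intro A hA hU
    rw [mem_Uperp_iff] at hU
    have hA : F 𝕜 q * A = A * F 𝕜 q := hA
    have hF : ∀ a b : Box q, F 𝕜 q a b = if a.1 = b.1 ∧ (a.2 : ℕ) = b.2 + 1 then 1 else 0 :=
      fun a b => rfl
    have h1 : ∀ (a a' x : Box q), a'.1 = a.1 → (a'.2 : ℕ) = a.2 + 1 → (F 𝕜 q * A) a' x = A a x := by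
      intro a a' x h h'
      rw [Matrix.mul_apply, Finset.sum_eq_single a]
      · rw [hF, if_pos ⟨h, h'⟩, one_mul]
      · intro e _ he
        rw [hF, if_neg, zero_mul]
        exact fun h2 => he (box_ext (h2.1.symm.trans h) (by omega))
      · simp
    have h2 : ∀ (a x x' : Box q), x'.1 = x.1 → (x'.2 : ℕ) = x.2 + 1 → (A * F 𝕜 q) a x = A a x' := by
      intro a x x' h h'
      rw [Matrix.mul_apply, Finset.sum_eq_single x']
      · rw [hF, if_pos ⟨h, h'⟩, mul_one]
      · intro e _ he
        rw [hF, if_neg, mul_zero]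
        exact fun h2 => he (box_ext (h2.1.trans h.symm) (by omega))
      · simp
    have h3 : ∀ (a x : Box q), IsLeft x → (A * F 𝕜 q) a x = 0 := by
      intro a x h
      rw [Matrix.mul_apply]
      refine Finset.sum_eq_zero fun e _ => ?_
      rw [hF, if_neg, mul_zero]
      rintro ⟨h4, h5⟩
      have h6 := e.2.2
      have h7 := congrArg q h4
      unfold IsLeft at h
      omega
    have h4 : ∀ (a x : Box q), IsRight a → (F 𝕜 q * A) a x = 0 := by
      intro a x h
      rw [Matrix.mul_apply]
      refine Finset.sum_eq_zero fun e _ => ?_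
      rw [hF, if_neg, zero_mul]
      rintro ⟨h4, h5⟩
      unfold IsRight at h
      omega
    have hle : ∀ (n : ℕ) (a x : Box q), (a.2 : ℕ) + n + 1 = q a.1 → (x.2 : ℕ) ≤ a.2 →
        A a x = 0 := by
      intro n
      induction n with
      | zero => exact fun a x h h' => hU a x h h'
      | succ n ih =>
        intro a x h h'
        have ha' : (a.2 : ℕ) + 1 < q a.1 := by omega
        rw [← h1 a ⟨a.1, a.2 + 1, ha'⟩ x rfl rfl, hA]
        by_cases hx : (x.2 : ℕ) + 1 < q x.1
        · rw [h2 _ x ⟨x.1, x.2 + 1, hx⟩ rfl rfl]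
          exact ih _ _ (by simp; omega) (by simp; omega)
        · exact h3 _ _ (by have := x.2.2; unfold IsLeft; omega)
    have hgt : ∀ (n : ℕ) (a x : Box q), (a.2 : ℕ) = n → n < (x.2 : ℕ) → A a x = 0 := by
      intro n
      induction n with
      | zero =>
        intro a x ha hx
        have hx' := x.2.2
        rw [← h2 a ⟨x.1, x.2 - 1, by omega⟩ x rfl (by simp; omega), ← hA, h4 _ _ ha]
      | succ n ih =>
        intro a x ha hx
        have hx' := x.2.2
        have ha' := a.2.2
        rw [← h2 a ⟨x.1, x.2 - 1, by omega⟩ x rfl (by simp; omega), ← hA,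
          h1 ⟨a.1, a.2 - 1, by omega⟩ a _ rfl (by simp; omega)]
        exact ih _ _ (by simp; omega) (by simp; omega)
    ext a x
    by_cases h : (x.2 : ℕ) ≤ a.2
    · have ha := a.2.2
      exact hle (q a.1 - a.2 - 1) a x (by omega) h
    · exact hgt _ a x rfl (by omega)
  · rw [codisjoint_iff, eq_top_iff]
    rintro A -
    rw [Matrix.matrix_eq_sum_single A]
    refine sum_mem fun b _ => sum_mem fun x _ => ?_
    rw [← mul_one (A b x), ← smul_eq_mul, ← Matrix.smul_single]
    refine Submodule.smul_mem _ _ ?_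
    by_cases hbx : IsLeft b → (b.2 : ℕ) < x.2
    · exact Submodule.mem_sup_right (single_mem_Uperp hbx _)
    · push Not at hbx
      obtain ⟨hb, hx⟩ := hbx
      have ha : IsRight (⟨x.1, 0, hq x.1⟩ : Box q) := rfl
      -- The box `x` lies `x.2` steps left of the rightmost box of its row, so this element of `𝔤^f`
      -- agrees with the unit in all rows indexed by leftmost boxes.
      rw [← add_sub_cancel (phi 𝕜 q x.2 (Matrix.single b ⟨x.1, 0, hq x.1⟩ 1)) (Matrix.single b x 1)]
      refine Submodule.add_mem_sup (phi_single_mem _ ha hb) (mem_Uperp_iff.2 fun c y hc _ => ?_)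
      rw [Matrix.sub_apply, phi_single_apply 𝕜 _ hb hc, Matrix.single_apply, sub_eq_zero]
      refine if_congr ⟨?_, ?_⟩ rfl rfl
      · rintro ⟨rfl, rfl⟩
        simp [hx]
      · rintro ⟨rfl, -, h1, h2⟩
        exact ⟨rfl, box_ext h1 (by simpa using h2.symm)⟩

end Complement

/-! ### Kazhdan symbols of the entries of `T`. -/

section Symbols

variable (𝕜 : Type*) [Field 𝕜] (q : Fin r → ℕ)

/-- The pairs of an element of `F_Δ U(𝔤)` and of its symbol. -/
def hasSym (Δ : ℤ) : Submodule 𝕜 (Ug 𝕜 q × Sg 𝕜 q) :=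
  symbolPairs 𝕜 q Δ ⊔ (kazhdan 𝕜 q (Δ - 1)).prod ⊥

variable {q}

theorem kazhdan_mono {Δ Δ' : ℤ} (h : Δ ≤ Δ') : kazhdan 𝕜 q Δ ≤ kazhdan 𝕜 q Δ' :=
  Submodule.span_mono fun _ ⟨l, h1, h2, h3⟩ => ⟨l, h1, h2.trans h, h3⟩

variable {𝕜}

theorem kazhdan_mul {Δ Δ' : ℤ} {u v : Ug 𝕜 q} (hu : u ∈ kazhdan 𝕜 q Δ)
    (hv : v ∈ kazhdan 𝕜 q Δ') : u * v ∈ kazhdan 𝕜 q (Δ + Δ') := by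
  have h := Submodule.mul_mem_mul hu hv
  rw [kazhdan, kazhdan, Submodule.span_mul_span] at h
  refine Submodule.span_mono ?_ h
  rintro _ ⟨_, ⟨l, h1, h2, rfl⟩, _, ⟨l', h1', h2', rfl⟩, rfl⟩
  refine ⟨l ++ l', fun p hp => ?_, ?_, by simp⟩
  · rcases List.mem_append.1 hp with hp | hp
    exacts [h1 p hp, h1' p hp]
  · rw [List.map_append, List.sum_append]
    exact add_le_add h2 h2'

theorem symbolPairs_mul {Δ Δ' : ℤ} {u v : Ug 𝕜 q × Sg 𝕜 q} (hu : u ∈ symbolPairs 𝕜 q Δ)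
    (hv : v ∈ symbolPairs 𝕜 q Δ') : u * v ∈ symbolPairs 𝕜 q (Δ + Δ') := by
  have h := Submodule.mul_mem_mul hu hv
  rw [symbolPairs, symbolPairs, Submodule.span_mul_span] at h
  refine Submodule.span_mono ?_ h
  rintro _ ⟨_, ⟨l, h1, h2, rfl⟩, _, ⟨l', h1', h2', rfl⟩, rfl⟩
  refine ⟨l ++ l', fun p hp => ?_, ?_, by simp⟩
  · rcases List.mem_append.1 hp with hp | hp
    exacts [h1 p hp, h1' p hp]
  · rw [List.map_append, List.sum_append, h2, h2']

theorem fst_mem_kazhdan_of_symbolPairs {Δ : ℤ} {u : Ug 𝕜 q × Sg 𝕜 q}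
    (hu : u ∈ symbolPairs 𝕜 q Δ) : u.1 ∈ kazhdan 𝕜 q Δ := by
  have h : symbolPairs 𝕜 q Δ ≤ (kazhdan 𝕜 q Δ).comap (LinearMap.fst 𝕜 _ _) := by
    refine Submodule.span_le.2 ?_
    rintro _ ⟨l, h1, h2, rfl⟩
    exact Submodule.subset_span ⟨l, h1, h2.le, rfl⟩
  exact h hu

theorem mem_hasSym_iff {Δ : ℤ} {u : Ug 𝕜 q} {s : Sg 𝕜 q} : (u, s) ∈ hasSym 𝕜 q Δ ↔
    ∃ v, (v, s) ∈ symbolPairs 𝕜 q Δ ∧ u - v ∈ kazhdan 𝕜 q (Δ - 1) := by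
  rw [hasSym, Submodule.mem_sup]
  constructor
  · rintro ⟨⟨v, t⟩, hv, ⟨k, t'⟩, ⟨hk, ht⟩, h⟩
    obtain ⟨rfl, rfl⟩ := Prod.mk.inj h
    obtain rfl : t' = 0 := ht
    refine ⟨v, by rwa [add_zero], ?_⟩
    rwa [add_sub_cancel_left]
  · rintro ⟨v, hv, hk⟩
    exact ⟨(v, s), hv, (u - v, 0), ⟨hk, rfl⟩, by simp⟩

theorem fst_mem_kazhdan {Δ : ℤ} {u : Ug 𝕜 q × Sg 𝕜 q} (hu : u ∈ hasSym 𝕜 q Δ) :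
    u.1 ∈ kazhdan 𝕜 q Δ := by
  obtain ⟨v, hv, hk⟩ := mem_hasSym_iff.1 (show (u.1, u.2) ∈ _ from hu)
  rw [← sub_add_cancel u.1 v]
  exact add_mem (kazhdan_mono 𝕜 (by omega) hk) (fst_mem_kazhdan_of_symbolPairs hv)

theorem mem_hasSym_of_kazhdan {Δ : ℤ} {u : Ug 𝕜 q} (hu : u ∈ kazhdan 𝕜 q (Δ - 1)) :
    (u, 0) ∈ hasSym 𝕜 q Δ :=
  mem_hasSym_iff.2 ⟨0, zero_mem _, by rwa [sub_zero]⟩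

theorem hasSym_mul {Δ Δ' : ℤ} {u v : Ug 𝕜 q × Sg 𝕜 q} (hu : u ∈ hasSym 𝕜 q Δ)
    (hv : v ∈ hasSym 𝕜 q Δ') : u * v ∈ hasSym 𝕜 q (Δ + Δ') := by
  obtain ⟨u', hu', hk⟩ := mem_hasSym_iff.1 (show (u.1, u.2) ∈ _ from hu)
  obtain ⟨v', hv', hk'⟩ := mem_hasSym_iff.1 (show (v.1, v.2) ∈ _ from hv)
  refine mem_hasSym_iff.2 ⟨u' * v', symbolPairs_mul hu' hv', ?_⟩
  have h : u.1 * v.1 - u' * v' = (u.1 - u') * v.1 + u' * (v.1 - v') := by noncomm_ring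
  rw [h]
  exact add_mem (kazhdan_mono 𝕜 (by omega) (kazhdan_mul hk (fst_mem_kazhdan hv)))
    (kazhdan_mono 𝕜 (by omega) (kazhdan_mul (fst_mem_kazhdan_of_symbolPairs hu') hk'))

theorem inc_mem_hasSym {j : ℤ} {a : gl 𝕜 q} (ha : a ∈ grade 𝕜 q j) :
    (inc 𝕜 q a, SymmetricAlgebra.ι 𝕜 (gl 𝕜 q) a) ∈ hasSym 𝕜 q (1 - j) := by
  refine Submodule.mem_sup_left (Submodule.subset_span ⟨[(j, a)], ?_, ?_, ?_⟩) <;> simp [ha]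

theorem one_mem_hasSym : (1 : Ug 𝕜 q × Sg 𝕜 q) ∈ hasSym 𝕜 q 0 := by
  refine Submodule.mem_sup_left (Submodule.subset_span ⟨[], ?_, ?_, rfl⟩) <;> simp

theorem isSymbol_of_mem_hasSym {Δ : ℤ} {u : Ug 𝕜 q} {s : Sg 𝕜 q} (h : (u, s) ∈ hasSym 𝕜 q Δ) :
    IsSymbol 𝕜 q Δ (mk 𝕜 q u) s := by
  obtain ⟨v, hv, hk⟩ := mem_hasSym_iff.1 h
  exact ⟨v, hv, u - v, hk, map_sub _ _ _⟩

theorem isSymbol_sub {Δ : ℤ} {x : UmodI 𝕜 q} {s s' : Sg 𝕜 q} (h : IsSymbol 𝕜 q Δ x s)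
    (h' : IsSymbol 𝕜 q Δ x s') : IsSymbol 𝕜 q Δ 0 (s - s') := by
  obtain ⟨u, hu, hk⟩ := h
  obtain ⟨u', hu', hk'⟩ := h'
  refine ⟨u - u', sub_mem hu hu', ?_⟩
  rw [map_sub]
  convert sub_mem hk hk' using 1
  abel

/-- The polynomials with coefficients in `U(𝔤)` and their symbols, where the indeterminate has
degree one. -/
def PolySym (Δ : ℤ) (p : (Ug 𝕜 q)[X]) (s : (Sg 𝕜 q)[X]) : Prop :=
  ∀ l : ℕ, (p.coeff l, s.coeff l) ∈ hasSym 𝕜 q (Δ - l)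

variable {Δ Δ' : ℤ} {p p' : (Ug 𝕜 q)[X]} {s s' : (Sg 𝕜 q)[X]}

theorem PolySym.zero : PolySym Δ (0 : (Ug 𝕜 q)[X]) 0 := fun _ => zero_mem _

theorem PolySym.add (h : PolySym Δ p s) (h' : PolySym Δ p' s') : PolySym Δ (p + p') (s + s') :=
  fun l => by
    rw [coeff_add, coeff_add]
    exact add_mem (h l) (h' l)

theorem PolySym.sub (h : PolySym Δ p s) (h' : PolySym Δ p' s') : PolySym Δ (p - p') (s - s') :=
  fun l => by
    rw [coeff_sub, coeff_sub]
    exact sub_mem (h l) (h' l)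

theorem PolySym.zsmul (n : ℤ) (h : PolySym Δ p s) : PolySym Δ (n • p) (n • s) :=
  fun l => by
    rw [coeff_smul, coeff_smul]
    exact zsmul_mem (h l) n

theorem _root_.Prod.mk_finsetSum {ι M N : Type*} [AddCommMonoid M] [AddCommMonoid N] (t : Finset ι)
    (f : ι → M) (g : ι → N) : (∑ i ∈ t, f i, ∑ i ∈ t, g i) = ∑ i ∈ t, (f i, g i) :=
  Prod.ext (by simp [Prod.fst_sum]) (by simp [Prod.snd_sum])

theorem PolySym.sum {ι : Type*} {t : Finset ι} {p : ι → (Ug 𝕜 q)[X]} {s : ι → (Sg 𝕜 q)[X]}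
    (h : ∀ i ∈ t, PolySym Δ (p i) (s i)) : PolySym Δ (∑ i ∈ t, p i) (∑ i ∈ t, s i) := by
  intro l
  rw [finsetSum_coeff, finsetSum_coeff, Prod.mk_finsetSum]
  exact sum_mem fun i hi => h i hi l

theorem PolySym.mul (h : PolySym Δ p s) (h' : PolySym Δ' p' s') :
    PolySym (Δ + Δ') (p * p') (s * s') := by
  intro l
  rw [coeff_mul, coeff_mul, Prod.mk_finsetSum]
  refine sum_mem fun i hi => ?_
  have h1 := hasSym_mul (h i.1) (h' i.2)
  have h2 := Finset.HasAntidiagonal.mem_antidiagonal.1 hi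
  rwa [show Δ - i.1 + (Δ' - i.2) = Δ + Δ' - l by omega] at h1

theorem PolySym.C {u : Ug 𝕜 q} {x : Sg 𝕜 q} (h : (u, x) ∈ hasSym 𝕜 q Δ) :
    PolySym Δ (Polynomial.C u) (Polynomial.C x) := by
  intro l
  rw [coeff_C, coeff_C]
  split_ifs with hl
  · simpa [hl] using h
  · exact zero_mem _

theorem PolySym.X_mul (h : PolySym Δ p s) : PolySym (Δ + 1) (X * p) (X * s) := by
  rintro (_ | l)
  · rw [coeff_X_mul_zero, coeff_X_mul_zero]
    exact zero_mem _
  · rw [coeff_X_mul, coeff_X_mul]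
    convert h l using 1
    congr 1
    push_cast
    ring

/-- An integer multiple stays in degree `Δ`, one below the degree of the recursion step, so the
shift by `D` is invisible in the symbol. -/
theorem PolySym.lower (h : PolySym Δ p s) (n : ℕ) : PolySym (Δ + 1) (n • p) 0 := by
  intro l
  rw [coeff_smul, coeff_zero]
  refine mem_hasSym_of_kazhdan (nsmul_mem ?_ n)
  have h1 := fst_mem_kazhdan (h l)
  rwa [show Δ + 1 - l - 1 = Δ - l by ring]

variable (𝕜 q) in
/-- The matrix units as elements of `S(𝔤)`. -/
noncomputable def unitS (x y : Fin r × ℕ) : Sg 𝕜 q :=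
  SymmetricAlgebra.ι 𝕜 (gl 𝕜 q) (matUnit 𝕜 q x y)

variable (𝕜 q) in
/-- The symbols of the matrices `T`. -/
noncomputable abbrev TS : ℕ → Fin r → Fin r → (Sg 𝕜 q)[X] := T q (fun _ => 0) (unitS 𝕜 q)

theorem unit_mem_hasSym (x y : Fin r × ℕ) :
    (unitU 𝕜 q x y, unitS 𝕜 q x y) ∈ hasSym 𝕜 q (x.2 + 1 - y.2) := by
  have h : matUnit 𝕜 q x y ∈ grade 𝕜 q (y.2 - x.2) := by
    intro a b hab
    simp only [matUnit, Matrix.of_apply, ite_eq_right_iff]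
    rintro ⟨rfl, rfl⟩
    exact absurd rfl hab
  have h1 := inc_mem_hasSym h
  rwa [show (1 - ((y.2 : ℤ) - x.2)) = x.2 + 1 - y.2 by ring] at h1

/-- Apart from that shift the recursion is homogeneous, with `X` of degree one and `g c x` of degree
`c.2 + 1 - x.2`; hence the symbols satisfy it with `d = 0`. -/
theorem polySym_T_Q (hq : ∀ i, 0 < q i) (n : ℕ) :
    (∀ i j, PolySym (min (q j) n : ℕ) (TU 𝕜 q n i j) (TS 𝕜 q n i j)) ∧
    (∀ i c, PolySym (c.2 + 1) (QU 𝕜 q n i c) (Q q (fun _ => 0) (unitS 𝕜 q) n i c)) := by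
  induction n with
  | zero =>
    refine ⟨fun i j => ?_, fun i c => PolySym.zero⟩
    rw [TU, TS, T_zero, T_zero]
    split_ifs
    · have h1 : PolySym 0 (0 - C (1 : Ug 𝕜 q)) (0 - C (1 : Sg 𝕜 q)) :=
        PolySym.zero.sub (PolySym.C one_mem_hasSym)
      simpa using h1
    · exact PolySym.zero
  | succ n ih =>
    obtain ⟨ihT, ihQ⟩ := ih
    have hQ : ∀ i c, PolySym (c.2 + 1) (QU 𝕜 q (n + 1) i c)
        (Q q (fun _ => 0) (unitS 𝕜 q) (n + 1) i c) := by
      intro i c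
      rw [QU, Q_succ, Q_succ]
      refine (ihQ i c).sub (PolySym.sum fun h _ => ?_)
      by_cases hh : n < q h
      · have h1 := (ihT i h).mul (PolySym.C (unit_mem_hasSym (𝕜 := 𝕜) (q := q) c (h, n)))
        rw [min_eq_right hh.le] at h1
        convert h1 using 1
        ring
      · rw [unitU, unitS, matUnit_eq_zero_right 𝕜 q (not_lt.1 hh)]
        simpa using PolySym.zero
    refine ⟨fun i j => ?_, hQ⟩
    by_cases hj : n < q j
    · have hT := ihT i j
      rw [min_eq_right hj.le] at hT
      rw [TU, TS, T_succ_of_lt q _ _ hj, T_succ_of_lt q _ _ hj, zero_smul, min_eq_right hj]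
      push_cast
      refine (((hQ i (j, n)).sub hT.X_mul).add (hT.lower _)).sub (PolySym.sum fun h _ => ?_)
      split_ifs with hh
      · refine PolySym.zsmul _ ?_
        have h1 := ihT h j (q h - 1)
        rw [min_eq_right hj.le] at h1
        have h2 := (ihT i h).mul (PolySym.C h1)
        rw [min_eq_left hh] at h2
        convert h2 using 1
        have := hq h
        omega
      · exact PolySym.zero
    · rw [TU, TS, T_succ_of_le q _ _ (not_lt.1 hj), T_succ_of_le q _ _ (not_lt.1 hj),
        show min (q j) (n + 1) = min (q j) n by omega]
      exact ihT i j

end Symbols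

/-! ### The Premet map and the comparison with `Z(z)`. -/

section Premet

variable {𝕜 : Type*} [Field 𝕜] {q : Fin r → ℕ}

theorem le_numCols (i : Fin r) : q i ≤ numCols q := Finset.le_sup (Finset.mem_univ i)

theorem mk_eq_zero_of_mem {u : Ug 𝕜 q} (h : u ∈ leftIdeal 𝕜 q) : mk 𝕜 q u = 0 :=
  (Submodule.Quotient.mk_eq_zero _).2 h

theorem unitU_sub_mem_leftIdeal {u v : Fin r × ℕ} (h : u.2 < v.2) (hv : v.2 < q v.1) :
    unitU 𝕜 q u v - (if IsNext u v then 1 else 0) ∈ leftIdeal 𝕜 q := by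
  by_cases hu : u.2 < q u.1
  · obtain ⟨a, rfl⟩ := exists_pos_eq hu
    obtain ⟨b, rfl⟩ := exists_pos_eq hv
    refine Submodule.subset_span ⟨Matrix.single a b 1, single_mem_gePos h 1, ?_⟩
    rw [unitU, matUnit_pos, trace_F_single, mul_one]
    congr 1
    have h1 : F 𝕜 q b a = if b.1 = a.1 ∧ (b.2 : ℕ) = a.2 + 1 then 1 else 0 := rfl
    rw [h1, apply_ite (algebraMap 𝕜 (Ug 𝕜 q)), map_one, map_zero]
    exact if_congr ⟨fun h2 => ⟨h2.1.symm, h2.2⟩, fun h2 => ⟨h2.1.symm, h2.2⟩⟩ rfl rfl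
  · have h1 : ¬ IsNext u v := by
      rintro ⟨h1, h2⟩
      rw [h1] at hu
      omega
    rw [if_neg h1, unitU, matUnit_eq_zero_left 𝕜 q (not_lt.1 hu), map_zero, sub_zero]
    exact zero_mem _

theorem coeff_mem_leftIdeal {n : ℕ} {p : (Ug 𝕜 q)[X]}
    (hp : p ∈ polyIdeal (q := q) (unitU 𝕜 q) n) (k : ℕ) : p.coeff k ∈ leftIdeal 𝕜 q := by
  induction hp using Submodule.span_induction generalizing k with
  | mem x hx =>
    obtain ⟨u, v, h1, -, h2, rfl⟩ := hx
    have h3 : C (unitU 𝕜 q u v) - (if IsNext u v then 1 else 0) =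
        C (unitU 𝕜 q u v - (if IsNext u v then 1 else 0)) := by
      split_ifs <;> simp
    rw [h3, coeff_C]
    by_cases hk : k = 0
    · rw [if_pos hk]
      exact unitU_sub_mem_leftIdeal h1 h2
    · rw [if_neg hk]
      exact zero_mem _
  | zero => exact zero_mem _
  | add x y _ _ hx hy =>
    rw [coeff_add]
    exact add_mem (hx k) (hy k)
  | smul c x _ hx =>
    rw [smul_eq_mul, coeff_mul]
    exact sum_mem fun i _ => Submodule.smul_mem _ _ (hx i.2)

theorem mk_coeff_TU_mem (hq : ∀ i, 0 < q i) (i j : Fin r) (l : ℕ) :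
    mk 𝕜 q ((TU 𝕜 q (numCols q) i j).coeff l) ∈ WAlg 𝕜 q := by
  refine ⟨_, ?_, rfl⟩
  rw [SetLike.mem_coe, Submodule.mem_iInf]
  rintro ⟨a, ha⟩
  rw [LinearMap.mem_ker, LinearMap.comp_apply]
  refine mk_eq_zero_of_mem ?_
  rw [LinearMap.sub_apply, LinearMap.mulLeft_apply, LinearMap.mulRight_apply]
  have key : ∀ x y : Box q, (x.2 : ℕ) < y.2 →
      inc 𝕜 q (Matrix.single x y 1) * (TU 𝕜 q (numCols q) i j).coeff l -
        (TU 𝕜 q (numCols q) i j).coeff l * inc 𝕜 q (Matrix.single x y 1) ∈ leftIdeal 𝕜 q := by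
    intro x y hxy
    have h1 := ad_T_mem (numRight q) (isUnitSystem_unitU 𝕜 q) hq (numRight_succ q) (numCols q)
      (u := pos x) (v := pos y) hxy (y.2.2.trans_le (le_numCols _)) i j
    have h2 := coeff_mem_leftIdeal h1 l
    rwa [coeff_ad_C, unitU, matUnit_pos] at h2
  change inc 𝕜 q a * _ - _ * inc 𝕜 q a ∈ _
  rw [Matrix.matrix_eq_sum_single a]
  simp only [map_sum, Finset.sum_mul, Finset.mul_sum, ← Finset.sum_sub_distrib]
  refine sum_mem fun x _ => sum_mem fun y _ => ?_
  by_cases hxy : (x.2 : ℕ) < y.2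
  · have h : Matrix.single x y (a x y) = a x y • Matrix.single x y (1 : 𝕜) := by
      rw [Matrix.smul_single, smul_eq_mul, mul_one]
    rw [h, map_smul (inc 𝕜 q), smul_mul_assoc, mul_smul_comm, ← smul_sub]
    have h1 := Submodule.smul_mem _ (algebraMap 𝕜 (Ug 𝕜 q) (a x y)) (key x y hxy)
    rwa [smul_eq_mul, ← Algebra.smul_def] at h1
  · rw [apply_eq_zero_of_mem_gePos ha (not_lt.1 hxy), Matrix.single_zero, map_zero, zero_mul,
      mul_zero, sub_zero]
    exact zero_mem _

/-- The linear map on `𝔤` sending the matrix units `e_{bx}` that span a complement of `U^⊥` to given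
vectors and the other matrix units to zero. -/
noncomputable def complMap {M : Type*} [AddCommGroup M] [Module 𝕜 M] (v : Box q → Box q → M) :
    gl 𝕜 q →ₗ[𝕜] M :=
  ∑ b, ∑ x, if IsLeft b ∧ (x.2 : ℕ) ≤ b.2 then
    (Matrix.entryLinearMap 𝕜 𝕜 b x).smulRight (v b x) else 0

theorem complMap_apply {M : Type*} [AddCommGroup M] [Module 𝕜 M] (v : Box q → Box q → M)
    (a : gl 𝕜 q) : complMap v a =
      ∑ b, ∑ x : Box q, if IsLeft b ∧ (x.2 : ℕ) ≤ b.2 then a b x • v b x else 0 := by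
  simp only [complMap, LinearMap.sum_apply]
  refine Finset.sum_congr rfl fun b _ => Finset.sum_congr rfl fun x _ => ?_
  split_ifs <;> rfl

theorem map_complMap {M M' : Type*} [AddCommGroup M] [Module 𝕜 M] [AddCommGroup M'] [Module 𝕜 M']
    (f : M →ₗ[𝕜] M') (v : Box q → Box q → M) (a : gl 𝕜 q) :
    f (complMap v a) = complMap (fun b x => f (v b x)) a := by
  simp only [complMap_apply, map_sum, apply_ite f, map_smul, map_zero]

variable (𝕜 q) in
/-- The coefficients of the matrix `T` of the whole pyramid, as a linear map `𝔤 → U(𝔤)`. -/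
noncomputable def liftU : gl 𝕜 q →ₗ[𝕜] Ug 𝕜 q :=
  complMap fun b x => (-1 : 𝕜) ^ (x.2 : ℕ) • (TU 𝕜 q (numCols q) x.1 b.1).coeff x.2

variable (𝕜 q) in
/-- The symbols of the elements `liftU`. -/
noncomputable def liftS : gl 𝕜 q →ₗ[𝕜] Sg 𝕜 q :=
  complMap fun b x => (-1 : 𝕜) ^ (x.2 : ℕ) • (TS 𝕜 q (numCols q) x.1 b.1).coeff x.2

/-- The component of degree `j` of an element of `𝔤`. -/
def homPart (j : ℤ) (a : gl 𝕜 q) : gl 𝕜 q := Matrix.of fun b x => if deg b x = j then a b x else 0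

theorem homPart_of_mem {j : ℤ} {a : gl 𝕜 q} (ha : a ∈ grade 𝕜 q j) : homPart j a = a := by
  ext b x
  rw [homPart, Matrix.of_apply]
  split_ifs with h
  · rfl
  · exact (ha b x h).symm

/-- Entries of Kazhdan degree below `Δ` are allowed, as they do not affect the symbol; injectivity
needs this generality beyond homogeneous elements. -/
theorem lift_mem_hasSym (hq : ∀ i, 0 < q i) {Δ : ℤ} {a : gl 𝕜 q}
    (ha : ∀ b x : Box q, IsLeft b → (x.2 : ℕ) ≤ b.2 → Δ < (b.2 : ℕ) + 1 - (x.2 : ℕ) → a b x = 0) :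
    (liftU 𝕜 q a, liftS 𝕜 q (homPart (1 - Δ) a)) ∈ hasSym 𝕜 q Δ := by
  rw [liftU, liftS, complMap_apply, complMap_apply]
  simp only [Prod.mk_finsetSum]
  refine sum_mem fun b _ => sum_mem fun x _ => ?_
  by_cases hbx : IsLeft b ∧ (x.2 : ℕ) ≤ b.2
  · rw [if_pos hbx, if_pos hbx]
    have h1 := (polySym_T_Q (𝕜 := 𝕜) hq (numCols q)).1 x.1 b.1 x.2
    rw [min_eq_left (le_numCols b.1), ← hbx.1] at h1
    push_cast at h1
    have h2 : ((-1 : 𝕜) ^ (x.2 : ℕ) • (TU 𝕜 q (numCols q) x.1 b.1).coeff x.2,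
        (-1 : 𝕜) ^ (x.2 : ℕ) • (TS 𝕜 q (numCols q) x.1 b.1).coeff x.2) ∈
          hasSym 𝕜 q ((b.2 : ℕ) + 1 - (x.2 : ℕ)) := Submodule.smul_mem _ ((-1 : 𝕜) ^ (x.2 : ℕ)) h1
    rcases lt_trichotomy Δ ((b.2 : ℕ) + 1 - (x.2 : ℕ)) with h | h | h
    · rw [homPart, Matrix.of_apply, ha b x hbx.1 hbx.2 h, ite_self, zero_smul, zero_smul]
      exact zero_mem _
    · rw [homPart, Matrix.of_apply, if_pos (by unfold deg; omega), h]
      exact Submodule.smul_mem _ (a b x) h2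
    · rw [homPart, Matrix.of_apply, if_neg (by unfold deg; omega), zero_smul]
      exact mem_hasSym_of_kazhdan
        (Submodule.smul_mem _ _ (kazhdan_mono 𝕜 (by omega) (fst_mem_kazhdan h2)))
  · rw [if_neg hbx, if_neg hbx]
    exact zero_mem _

variable (hc : IsCompl (centralizerF 𝕜 q) (Uperp 𝕜 q))

theorem etaF_ι (a : gl 𝕜 q) : etaF hc (SymmetricAlgebra.ι 𝕜 (gl 𝕜 q) a) =
    SymmetricAlgebra.ι 𝕜 (centralizerF 𝕜 q) (piF hc a) +
      algebraMap 𝕜 _ (Matrix.trace (F 𝕜 q * a)) := by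
  rw [etaF, SymmetricAlgebra.lift_ι_apply]
  rfl

theorem piF_eq_zero {a : gl 𝕜 q} (h : a ∈ Uperp 𝕜 q) : piF hc a = 0 :=
  (Submodule.projectionOnto_apply_eq_zero_iff hc).2 h

theorem F_apply_eq_zero {a b : Box q} (h : (a.2 : ℕ) ≤ b.2) : F 𝕜 q a b = 0 := by
  rw [F, Matrix.of_apply, if_neg]
  omega

/-- A unit into a non-leftmost box from a box weakly to its right lies in `U^⊥` and pairs to zero
with `f`, so `η^f` kills it and the recursion for the symbols becomes linear. Each coefficient is
then the projection of a single unit, up to the sign built into `liftS`. -/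
theorem etaF_liftS (hq : ∀ i, 0 < q i) (a : gl 𝕜 q) :
    etaF hc (liftS 𝕜 q a) = SymmetricAlgebra.ι 𝕜 (centralizerF 𝕜 q) (piF hc a) := by
  have h0 : ∀ x y : Fin r × ℕ, q y.1 ≤ y.2 → etaF hc (unitS 𝕜 q x y) = 0 := by
    intro x y h
    rw [unitS, matUnit_eq_zero_right 𝕜 q h, map_zero, map_zero]
  have h1 : ∀ c x : Fin r × ℕ, c.2 + 1 < q c.1 → x.2 ≤ c.2 → etaF hc (unitS 𝕜 q c x) = 0 := by
    intro c x h h'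
    by_cases hx : x.2 < q x.1
    · obtain ⟨c, rfl⟩ := exists_pos_eq (show c.2 < q c.1 by omega)
      obtain ⟨x, rfl⟩ := exists_pos_eq hx
      rw [unitS, matUnit_pos, etaF_ι, trace_F_single, F_apply_eq_zero h', zero_mul, map_zero,
        piF_eq_zero hc (single_mem_Uperp (fun hl => absurd hl h.ne) 1), map_zero, add_zero]
    · exact h0 _ _ (not_lt.1 hx)
  have h2 : ∀ b x : Box q, IsLeft b → (x.2 : ℕ) ≤ b.2 →
      etaF hc ((-1 : 𝕜) ^ (x.2 : ℕ) • (TS 𝕜 q (numCols q) x.1 b.1).coeff x.2) =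
        SymmetricAlgebra.ι 𝕜 (centralizerF 𝕜 q) (piF hc (Matrix.single b x 1)) := by
    intro b x hb hx
    have h3 := ((map_T_Q (q := q) (fun _ => 0) (unitS 𝕜 q) (etaF hc : Sg 𝕜 q →+*
      SymmetricAlgebra 𝕜 (centralizerF 𝕜 q)) (numCols q)).1 x.1 b.1).symm
    have h4 := congrArg (fun p => p.coeff x.2) h3
    have hb' : (b.2 : ℕ) + 1 = q b.1 := hb
    simp only [coeff_map, RingHom.coe_coe] at h4
    rw [T_linear_of_eq_zero hq h0 h1 _ _ (le_numCols b.1), coeff_add, finsetSum_coeff] at h4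
    rw [map_smul, TS, h4]
    have h5 : ∀ (l : ℕ) (c : SymmetricAlgebra 𝕜 (centralizerF 𝕜 q)),
        ((-X) ^ l * C c).coeff x.2 = if l = x.2 then (-1) ^ l * c else 0 := by
      intro l c
      have h6 : (-X : (SymmetricAlgebra 𝕜 (centralizerF 𝕜 q))[X]) ^ l = C ((-1) ^ l) * X ^ l := by
        rw [neg_pow (X : (SymmetricAlgebra 𝕜 (centralizerF 𝕜 q))[X]), C_pow, C_neg, C_1]
      rw [h6, coeff_mul_C, coeff_C_mul, coeff_X_pow]
      split_ifs with h7 h8 h8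
      · rw [mul_one]
      · exact absurd h7.symm h8
      · exact absurd h8.symm h7
      · rw [mul_zero, zero_mul]
    have h6 : (if x.1 = b.1 then -(-X : (SymmetricAlgebra 𝕜 (centralizerF 𝕜 q))[X]) ^ q b.1
        else 0).coeff x.2 = 0 := by
      split_ifs
      · have h7 := h5 (q b.1) 1
        rw [C_1, mul_one, if_neg (by omega)] at h7
        rw [coeff_neg, h7, neg_zero]
      · exact coeff_zero _
    simp only [h5, h6, zero_add]
    rw [Finset.sum_eq_single (x.2 : ℕ), if_pos rfl, Algebra.smul_def, map_pow, map_neg, map_one,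
      ← mul_assoc, ← mul_pow, neg_one_mul, neg_neg, one_pow, one_mul]
    · have h7 : ((b.1, q b.1 - 1) : Fin r × ℕ) = pos b := by
        rw [← hb', Nat.add_sub_cancel]
        rfl
      rw [h7, show ((x.1, (x.2 : ℕ)) : Fin r × ℕ) = pos x from rfl, unitS, matUnit_pos, etaF_ι,
        trace_F_single, F_apply_eq_zero hx, zero_mul, map_zero, add_zero]
    · exact fun l _ hl => if_neg hl
    · exact fun hl => absurd (Finset.mem_range.2 (by omega)) hl
  have h3 : etaF hc (liftS 𝕜 q a) = (etaF hc).toLinearMap (liftS 𝕜 q a) := rfl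
  rw [h3, liftS, map_complMap, complMap_apply]
  conv_rhs => rw [Matrix.matrix_eq_sum_single a]
  simp only [map_sum]
  refine Finset.sum_congr rfl fun b _ => Finset.sum_congr rfl fun x _ => ?_
  rw [← mul_one (a b x), ← smul_eq_mul (a b x), ← Matrix.smul_single, map_smul (piF hc),
    map_smul (SymmetricAlgebra.ι 𝕜 (centralizerF 𝕜 q)), smul_eq_mul, mul_one]
  split_ifs with hbx
  · rw [AlgHom.toLinearMap_apply, h2 b x hbx.1 hbx.2]
  · rw [piF_eq_zero hc (single_mem_Uperp (fun hl => not_le.1 fun h => hbx ⟨hl, h⟩) 1), map_zero,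
      smul_zero]

/-- Units of positive degree lie in `U^⊥`, so `η^f` sends them to their pairing with `f`, as the
Fock space criterion requires. -/
theorem etaF_eq_zero {Δ : ℤ} {s : Sg 𝕜 q} (h : IsSymbol 𝕜 q Δ 0 s) : etaF hc s = 0 := by
  refine eq_zero_of_isSymbol_zero 𝕜 (etaF hc) (fun i j hij => ?_) h
  rw [etaF_ι, piF_eq_zero hc (single_mem_Uperp (fun _ => hij) 1), trace_F_single, map_zero,
    zero_add, mul_one]

/-- Linear functionals extend to the symmetric algebra, and they separate points. -/
theorem _root_.SymmetricAlgebra.ι_eq_zero {K M : Type*} [Field K] [AddCommGroup M] [Module K M]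
    {x : M} (h : SymmetricAlgebra.ι K M x = 0) : x = 0 := by
  refine (Module.forall_dual_apply_eq_zero_iff K x).1 fun φ => ?_
  rw [← SymmetricAlgebra.lift_ι_apply φ x, h, map_zero]

variable (𝕜) in
/-- The Premet map given by the coefficients of `W(z)`. -/
noncomputable def premet (hq : ∀ i, 0 < q i) : centralizerF 𝕜 q →ₗ[𝕜] WAlg 𝕜 q :=
  (mk 𝕜 q ∘ₗ liftU 𝕜 q ∘ₗ (centralizerF 𝕜 q).subtype).codRestrict (WAlg 𝕜 q) fun a => by
    rw [LinearMap.comp_apply, LinearMap.comp_apply, liftU, map_complMap, complMap_apply]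
    refine sum_mem fun b _ => sum_mem fun x _ => ?_
    split_ifs
    · rw [map_smul]
      exact Submodule.smul_mem _ _ (Submodule.smul_mem _ _ (mk_coeff_TU_mem hq _ _ _))
    · exact zero_mem _

theorem coe_premet (hq : ∀ i, 0 < q i) (a : centralizerF 𝕜 q) :
    (premet 𝕜 hq a : UmodI 𝕜 q) = mk 𝕜 q (liftU 𝕜 q a) := rfl

/-- The entries of `a` that detect `U^⊥` vanish by descending induction on their Kazhdan degree `b.2
- x.2 + 1`: the top part of `a` gives a symbol of `w a = 0`, and `η^f` recovers it modulo `U^⊥`. -/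
theorem premet_injective (hq : ∀ i, 0 < q i) : Function.Injective (premet 𝕜 hq) := by
  have hc := isCompl_centralizerF_Uperp 𝕜 hq
  rw [injective_iff_map_eq_zero]
  rintro ⟨a, ha⟩ h
  have h0 : mk 𝕜 q (liftU 𝕜 q a) = 0 := by
    rw [← coe_premet hq ⟨a, ha⟩, h]
    rfl
  have key : ∀ (m : ℕ) (b x : Box q), IsLeft b → (x.2 : ℕ) ≤ b.2 →
      numCols q ≤ (b.2 : ℕ) - x.2 + m → a b x = 0 := by
    intro m
    induction m with
    | zero =>
      intro b x _ _ h
      have h1 := b.2.2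
      have h2 := le_numCols (q := q) b.1
      omega
    | succ m ih =>
      intro b x hb hx h
      have h1 : (liftU 𝕜 q a, liftS 𝕜 q (homPart (1 - ((b.2 : ℕ) + 1 - (x.2 : ℕ))) a)) ∈
          hasSym 𝕜 q ((b.2 : ℕ) + 1 - (x.2 : ℕ)) :=
        lift_mem_hasSym hq fun b' x' hb' hx' h' => ih b' x' hb' hx' (by omega)
      have h2 := isSymbol_of_mem_hasSym h1
      rw [h0] at h2
      have h3 := etaF_eq_zero hc h2
      rw [etaF_liftS hc hq] at h3
      have h4 := (Submodule.projectionOnto_apply_eq_zero_iff hc).1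
        (SymmetricAlgebra.ι_eq_zero h3)
      have h5 := mem_Uperp_iff.1 h4 b x hb hx
      rwa [homPart, Matrix.of_apply, if_pos (by unfold deg; omega)] at h5
  have h1 : a ∈ Uperp 𝕜 q :=
    mem_Uperp_iff.2 fun b x hb hx => key (numCols q) b x hb hx (by omega)
  exact Subtype.ext (Submodule.disjoint_def.1 hc.disjoint a ha h1)

theorem isPremetMap_premet (hq : ∀ i, 0 < q i) : IsPremetMap hc (premet 𝕜 hq) := by
  have key : ∀ (Δ : ℤ) (a : centralizerF 𝕜 q), (a : gl 𝕜 q) ∈ grade 𝕜 q (1 - Δ) →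
      (liftU 𝕜 q a, liftS 𝕜 q a) ∈ hasSym 𝕜 q Δ := by
    intro Δ a ha
    have h1 := lift_mem_hasSym hq (Δ := Δ) (a := (a : gl 𝕜 q)) fun b x _ _ h =>
      ha b x (by unfold deg; omega)
    rwa [homPart_of_mem ha] at h1
  refine ⟨premet_injective hq, fun Δ a ha => ⟨_, fst_mem_kazhdan (key Δ a ha), rfl⟩,
    fun Δ a ha => ?_⟩
  have h1 := isSymbol_of_mem_hasSym (key Δ a ha)
  refine ⟨⟨_, h1⟩, fun s hs => ?_⟩
  -- Two symbols of the same element differ by a symbol of zero.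
  have h2 := etaF_eq_zero hc (isSymbol_sub hs h1)
  rw [map_sub, sub_eq_zero, etaF_liftS hc hq] at h2
  rw [h2, piF, Submodule.projectionOnto_apply_left]

theorem leadCoeff_apply (l : ℕ) (a b : Box q) : leadCoeff 𝕜 q l a b =
    if IsRight a ∧ IsLeft b ∧ a.1 = b.1 ∧ l = q b.1 then -(-1) ^ l else 0 := by
  have hb := b.2.2
  cases l with
  | zero =>
    rw [if_neg (by omega)]
    rfl
  | succ k =>
    rw [leadCoeff, Matrix.smul_apply, proj, proj, Matrix.mul_diagonal, Matrix.diagonal_mul,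
      Ft_pow_apply]
    by_cases h1 : IsRight a
    · have h1' : (a.2 : ℕ) = 0 := h1
      by_cases h2 : IsLeft b
      · have h2' : (b.2 : ℕ) + 1 = q b.1 := h2
        rw [if_pos h1, if_pos h2, one_mul, mul_one, pow_succ, mul_neg_one, neg_neg, smul_eq_mul,
          mul_ite, mul_one, mul_zero]
        exact if_congr ⟨fun h => ⟨h1, h2, h.1, by omega⟩, fun h => ⟨h.2.2.1, by omega⟩⟩ rfl rfl
      · rw [if_neg h2, mul_zero, smul_zero, if_neg (by tauto)]
    · rw [if_neg h1, zero_mul, zero_mul, smul_zero, if_neg (by tauto)]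

/-- The exponent is below both row lengths exactly when the box `l` steps to the left of `a` exists
and lies weakly to the right of `b`. -/
theorem liftU_phi_single (l : ℕ) {a b : Box q} (ha : IsRight a) (hb : IsLeft b) :
    liftU 𝕜 q (phi 𝕜 q l (Matrix.single b a 1)) =
      if l < min (q a.1) (q b.1) then
        (-1 : 𝕜) ^ l • (TU 𝕜 q (numCols q) a.1 b.1).coeff l else 0 := by
  have ha' : (a.2 : ℕ) = 0 := ha
  have hb' : (b.2 : ℕ) + 1 = q b.1 := hb
  rw [liftU, complMap_apply]
  have h1 : ∀ c x : Box q, (if IsLeft c ∧ (x.2 : ℕ) ≤ c.2 then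
      phi 𝕜 q l (Matrix.single b a 1) c x •
        (-1 : 𝕜) ^ (x.2 : ℕ) • (TU 𝕜 q (numCols q) x.1 c.1).coeff x.2 else 0) =
      if c = b ∧ l ≤ (b.2 : ℕ) ∧ a.1 = x.1 ∧ (x.2 : ℕ) = l then
        (-1 : 𝕜) ^ l • (TU 𝕜 q (numCols q) a.1 b.1).coeff l else 0 := by
    intro c x
    by_cases h : c = b ∧ l ≤ (b.2 : ℕ) ∧ a.1 = x.1 ∧ (x.2 : ℕ) = l
    · obtain ⟨rfl, h1, h2, h3⟩ := h
      rw [if_pos ⟨hb, by omega⟩, phi_single_apply 𝕜 _ hb hb, if_pos ⟨rfl, h1, h2, by omega⟩,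
        if_pos ⟨rfl, h1, h2, h3⟩, one_smul, h2, h3]
    · rw [if_neg h]
      split_ifs with h1
      · rw [phi_single_apply 𝕜 _ hb h1.1, if_neg, zero_smul]
        rwa [ha', zero_add]
      · rfl
  simp only [h1]
  split_ifs with h
  · rw [Finset.sum_eq_single b, Finset.sum_eq_single ⟨a.1, l, by omega⟩, if_pos]
    · exact ⟨rfl, by omega, rfl, rfl⟩
    · intro x _ hx
      refine if_neg fun h2 => hx (box_ext h2.2.2.1.symm h2.2.2.2)
    · simp
    · exact fun c _ hcb => Finset.sum_eq_zero fun x _ => if_neg fun h2 => hcb h2.1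
    · simp
  · refine Finset.sum_eq_zero fun c _ => Finset.sum_eq_zero fun x _ => if_neg fun h2 => h ?_
    have := x.2.2
    rw [h2.2.2.1]
    omega

theorem Z_map_extend_premet [CharZero 𝕜] (hq : ∀ i, 0 < q i) (l : ℕ) :
    (Z 𝕜 q l).map (extend (premet 𝕜 hq)) = W 𝕜 q l := by
  ext a b
  have hN := (hq a.1).trans_le (le_numCols a.1)
  obtain ⟨n, hn⟩ := Nat.exists_eq_succ_of_ne_zero hN.ne'
  rw [Nat.succ_eq_add_one] at hn
  rw [Matrix.map_apply, Z, Matrix.of_apply, W, Matrix.map_apply, extend, LinearMap.coprod_apply,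
    LinearMap.toSpanSingleton_apply, LinearMap.comp_apply, hn, Wtilde_apply 𝕜 hq, ← hn,
    min_eq_left (le_numCols b.1)]
  rw [leadCoeff_apply]
  by_cases h : IsRight a ∧ IsLeft b
  · rw [dif_pos h, if_pos (show IsRight a ∧ (b.2 : ℕ) + 1 = q b.1 from h)]
    dsimp only
    rw [map_smul (premet 𝕜 hq), map_smul, Submodule.subtype_apply, coe_premet]
    simp only [h.1, h.2, true_and]
    rw [liftU_phi_single l h.1 h.2]
    by_cases hl : l < min (q a.1) (q b.1)
    · rw [if_pos hl, map_smul, smul_smul, ← mul_pow, neg_one_mul, neg_neg, one_pow, one_smul,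
        if_neg (by omega), zero_smul, zero_add]
    -- From this exponent on `phi` contributes zero, and only the scalar leading coefficient of the
    -- diagonal entries remains, which is `leadCoeff`.
    · have hU := isUnitSystem_unitU 𝕜 q
      rw [if_neg hl, map_zero, smul_zero, add_zero, TU, coeff_T _ _ hq hU.eq_zero
        (by have := le_numCols (q := q) a.1; omega), ← map_smul]
      congr 1
      rw [min_eq_left (le_numCols a.1)]
      by_cases h1 : a.1 = b.1 ∧ l = q b.1
      · rw [if_pos h1, if_pos ⟨h1.1, by rw [h1.1]; exact h1.2⟩]
        simp [Algebra.smul_def]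
      · rw [if_neg h1, if_neg (fun h2 => h1 ⟨h2.1, by rw [← h2.1]; exact h2.2⟩), zero_smul]
  · rw [dif_neg h]
    dsimp only
    rw [map_zero, map_zero, add_zero, if_neg (by tauto), zero_smul, if_neg (by exact h),
      coeff_zero, map_zero]

end Premet

end RightPyramid

theorem proposition6p7 {𝕜 : Type*} [Field 𝕜] [CharZero 𝕜] {r : ℕ} (q : Fin r → ℕ)
    (hq : ∀ i, 0 < q i) :
    ∃ (hc : IsCompl (RightPyramid.centralizerF 𝕜 q) (RightPyramid.Uperp 𝕜 q))
      (w : RightPyramid.centralizerF 𝕜 q →ₗ[𝕜] RightPyramid.WAlg 𝕜 q),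
      RightPyramid.IsPremetMap hc w ∧
      ∀ l : ℕ, (RightPyramid.Z 𝕜 q l).map (RightPyramid.extend w) = RightPyramid.W 𝕜 q l :=
  ⟨RightPyramid.isCompl_centralizerF_Uperp 𝕜 hq, RightPyramid.premet 𝕜 hq,
    RightPyramid.isPremetMap_premet _ hq, RightPyramid.Z_map_extend_premet hq⟩
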